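/- Let $K$ be a field of characteristic different from $2$, with algebraic closure $\overline K$. For a sextuple $x=(x_1,\dots,x_6)$ of points of ${\bf P}^2(\overline K)$, given by a $6\times 3$ matrix of homogeneous coordinates, let $m_{\{i,j,k\}}$ ($i<j<k$) be the minor formed by the rows $i,j,k$, and let $d_2$ be the determinant of the $6\times6$ matrix with the rows $(x_{i,0}^2, x_{i,1}^2, x_{i,2}^2, x_{i,0}x_{i,1}, x_{i,0}x_{i,2}, x_{i,1}x_{i,2})$. For $\{i_1,\dots,i_6\}=\{1,\dots,6\}$ put $$\gamma_{(i_1i_2i_3)(i_4i_5i_6)} := m_{\{i_1,i_2,i_3\}}\, m_{\{i_4,i_5,i_6\}}\, d_2,$$ $$\gamma_{(i_1i_2)(i_3i_4)(i_5i_6)} := m_{\{i_1,i_3,i_4\}} m_{\{i_2,i_3,i_4\}} m_{\{i_3,i_5,i_6\}} m_{\{i_4,i_5,i_6\}} m_{\{i_5,i_1,i_2\}} m_{\{i_6,i_1,i_2\}}.$$ These are $10+30=40$ forms: the indices may be permuted within the parentheses, the two triples may be interchanged, and the three pairs may be permuted cyclically, without changing the form. Let $\widetilde M\subset{\bf P}^{39}_K$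 (Coble's gamma variety) be the Zariski closure of the set of all points $(\gamma_{\cdot}(x))$, for $x$ in general position, i.e. such that no three of the six points lie on a line and not all six lie on a conic. Let $I\subset S=K[X_0,\dots,X_{39}]$ be the homogeneous ideal of $\widetilde M$, and let $H(n)=\dim_K (S/I)_n$ be its Hilbert function. Then the following hold. (i) The Hilbert series of $\widetilde M$ is $\displaystyle\sum_{n\ge 0}H(n)T^n=\frac{1+5T+15T^2+5T^3+T^4}{(1-T)^5}$. (ii) The Hilbert polynomial of $\widetilde M$ is $\frac98T^4+\frac94T^3+\frac{27}8T^2+\frac94T+1$, and it agrees with the Hilbert function $H$ in all degrees $\ge 0$. (iii) $\widetilde M$ is a projective variety (i.e. $I$ is a prime ideal) of degree $27$. (iv) The Castelnuovo–Mumford regularity of the structure sheaf $\mathscr O_{\widetilde M}$, considered as a coherent sheaf on ${\bf P}^{39}_K$, is equal to $4$, and that of the ideal sheaf $\mathscr I_{\widetilde M}\subset\mathscr O_{{\bf P}^{39}_K}$ is equal to $5$. Here, the regularity of a coherent sheaf $\mathscr F$ on ${\bf P}^{39}_K$ is the least integer $m$ such that $H^i({\bf P}^{39}_K,\mathscr F(m-i))=0$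 for all $i>0$. -/

import Mathlib

open scoped LinearAlgebra.Projectivization

noncomputable section

namespace CobleGamma

/-! ## Coble's irrational invariants

A sextuple of points of the projective plane is given by a `6 × 3` matrix `x`, the rows of which are
homogeneous coordinates of the six points. -/

section Invariants

variable {L : Type*} [Field L]

/-- The six quadratic monomials in the homogeneous coordinates of a point of the plane. -/
def quadraticMonomials (v : Fin 3 → L) : Fin 6 → L :=
  ![v 0 ^ 2, v 1 ^ 2, v 2 ^ 2, v 0 * v 1, v 0 * v 2, v 1 * v 2]

/-- Six points are in general position if no three of them lie on a line
and if not all six of them lie on a conic. -/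
def GeneralPosition (x : Matrix (Fin 6) (Fin 3) L) : Prop :=
  (∀ i j k : Fin 6, i < j → j < k → LinearIndependent L ![x i, x j, x k]) ∧
    ¬ ∃ c : Fin 6 → L, c ≠ 0 ∧ ∀ i, ∑ j, c j * quadraticMonomials (x i) j = 0

/-- The minor `m_S` of `x` that is formed by the rows with index in the three-element set `S`,
taken in increasing order. (The value `0` for other sets `S` is never used.) -/
def minor (x : Matrix (Fin 6) (Fin 3) L) (S : Finset (Fin 6)) : L :=
  if h : S.card = 3 then (x.submatrix (S.orderEmbOfFin h) id).det else 0

/-- The invariant `d₂`. -/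
def conicDet (x : Matrix (Fin 6) (Fin 3) L) : L :=
  (Matrix.of fun i => quadraticMonomials (x i)).det

/-- The symbols `(i₁i₂i₃)(i₄i₅i₆)`, where indices may be permuted within the triples and the two
triples may be interchanged. Each of them is represented by its unique normal form. -/
abbrev TripleSymbol : Type :=
  {s : Equiv.Perm (Fin 6) // s 0 = 0 ∧ s 1 < s 2 ∧ s 3 < s 4 ∧ s 4 < s 5}

/-- The symbols `(i₁i₂)(i₃i₄)(i₅i₆)`, where indices may be permuted within the pairs and the three
pairs may be permuted cyclically. Each of them is represented by its unique normal form. -/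
abbrev PairSymbol : Type :=
  {s : Equiv.Perm (Fin 6) // s 0 = 0 ∧ s 2 < s 3 ∧ s 4 < s 5}

/-- The set of the `10 + 30` symbols that label the irrational invariants. -/
abbrev Symbols : Type := TripleSymbol ⊕ PairSymbol

/-- Coble's forty irrational invariants. -/
def gamma (x : Matrix (Fin 6) (Fin 3) L) : Symbols → L
  | .inl s => minor x {s.1 0, s.1 1, s.1 2} * minor x {s.1 3, s.1 4, s.1 5} * conicDet x
  | .inr s =>
      minor x {s.1 0, s.1 2, s.1 3} * minor x {s.1 1, s.1 2, s.1 3} *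
        minor x {s.1 2, s.1 4, s.1 5} * minor x {s.1 3, s.1 4, s.1 5} *
        minor x {s.1 4, s.1 0, s.1 1} * minor x {s.1 5, s.1 0, s.1 1}

end Invariants

/-! ## Projective varieties over `K`

Subvarieties of the projective space over a field `K` are described by their points over an
algebraically closed extension field `L`; equations have coefficients in `K`. -/

section Varieties

variable (K : Type*) {L ι : Type*} [Field K] [Field L] [Algebra K L]

/-- The homogeneous ideal of a set `Z` of points of projective space: the polynomials over `K` that
vanish at every vector of homogeneous coordinates of every point in `Z`. (For an infinite field `L`,
it is generated by the homogeneous polynomials that vanish on `Z`.) -/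
def homogeneousIdeal (Z : Set (ℙ L (ι → L))) : Ideal (MvPolynomial ι K) :=
  MvPolynomial.vanishingIdeal K {v | ∃ hv : v ≠ 0, Projectivization.mk L v hv ∈ Z}

/-- The Zariski closure of a set of points of projective space. -/
def zariskiClosure (Z : Set (ℙ L (ι → L))) : Set (ℙ L (ι → L)) :=
  {P | ∀ f ∈ homogeneousIdeal K Z, MvPolynomial.aeval P.rep f = 0}

/-- The image, in the `39`-dimensional projective space, of Coble's gamma map. -/
def gammaImage (L : Type*) [Field L] : Set (ℙ L (Symbols → L)) :=
  {P | ∃ x : Matrix (Fin 6) (Fin 3) L, GeneralPosition x ∧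
    ∃ h : gamma x ≠ 0, P = Projectivization.mk L (gamma x) h}

/-- Coble's gamma variety over `K`. -/
def gammaVariety : Set (ℙ (AlgebraicClosure K) (Symbols → AlgebraicClosure K)) :=
  zariskiClosure K (gammaImage (AlgebraicClosure K))

/-- The homogeneous ideal of Coble's gamma variety, in the polynomial ring in 40 variables. -/
def gammaIdeal : Ideal (MvPolynomial Symbols K) :=
  homogeneousIdeal K (gammaVariety K)

end Varieties

/-! ## Hilbert function, Hilbert series, Hilbert polynomial, degree -/

section Hilbert

variable {K ι : Type*} [Field K]

/-- The homogeneous component of degree `n` of the homogeneous coordinate ring `S / I`. -/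
def quotientComponent (I : Ideal (MvPolynomial ι K)) (n : ℕ) :
    Submodule K (MvPolynomial ι K ⧸ I) :=
  (MvPolynomial.homogeneousSubmodule ι K n).map (Ideal.Quotient.mkₐ K I).toLinearMap

/-- The Hilbert function of `S / I`. -/
def hilbertFunction (I : Ideal (MvPolynomial ι K)) (n : ℕ) : ℕ :=
  Module.finrank K (quotientComponent I n)

/-- The Hilbert series of `S / I`. -/
def hilbertSeries (I : Ideal (MvPolynomial ι K)) : PowerSeries ℚ :=
  PowerSeries.mk fun n => (hilbertFunction I n : ℚ)

/-- `P` is the Hilbert polynomial of `S / I`: it agrees with the Hilbert function in all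
sufficiently large degrees. (There is at most one such polynomial.) -/
def IsHilbertPolynomial (I : Ideal (MvPolynomial ι K)) (P : Polynomial ℚ) : Prop :=
  ∀ᶠ n : ℕ in Filter.atTop, (hilbertFunction I n : ℚ) = P.eval (n : ℚ)

/-- The projective scheme with the homogeneous ideal `I` has degree `e`: the leading coefficient of
its Hilbert polynomial, times `r!` for `r` the degree of this polynomial, is `e`. -/
def HasDegree (I : Ideal (MvPolynomial ι K)) (e : ℕ) : Prop :=
  ∃ P : Polynomial ℚ, IsHilbertPolynomial I P ∧
    (P.natDegree.factorial : ℚ) * P.leadingCoeff = e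

end Hilbert

/-! ## Cohomology of coherent sheaves on projective space, Castelnuovo–Mumford regularity

Let `M` be a graded module over the polynomial ring `S`, with homogeneous components `𝓜 n`, and `F`
the associated quasi-coherent sheaf on the projective space `Proj S`. The cohomology of the twist
`F(d)` is computed by the Čech complex for the standard affine covering by the sets `D₊(X_i)`. -/

section Cohomology

variable {K ι M : Type*} [Field K] [AddCommGroup M] [Module (MvPolynomial ι K) M]

/-- The monomials in the variables `X_{a 0}, …, X_{a (r-1)}`. -/
def monomials {r : ℕ} (a : Fin r → ι) : Submonoid (MvPolynomial ι K) :=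
  Submonoid.closure (Set.range fun j => MvPolynomial.X (a j))

theorem monomials_comp_le {r s : ℕ} (a : Fin r → ι) (f : Fin s → Fin r) :
    monomials (K := K) (a ∘ f) ≤ monomials a := by
  apply Submonoid.closure_mono
  rintro _ ⟨j, rfl⟩
  exact ⟨f j, rfl⟩

/-- The sections of `F(d)` over the intersection of the sets `D₊(X_{a j})`: the elements of degree
`d` of the localized module, i.e. those generated by the fractions `m / s` for `m` homogeneous of
some degree `n` and `s` a monomial of degree `e` such that `n - e = d`. -/
def twistedSections (𝓜 : ℕ → AddSubgroup M) (d : ℤ) {r : ℕ} (a : Fin r → ι) :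
    AddSubgroup (LocalizedModule (monomials (K := K) a) M) :=
  AddSubgroup.closure {z | ∃ (n e : ℕ) (m : M) (s : monomials (K := K) a),
    m ∈ 𝓜 n ∧ s.1.IsHomogeneous e ∧ (n : ℤ) - (e : ℤ) = d ∧ z = LocalizedModule.mk m s}

variable (K ι M) in
/-- The Čech `p`-cochains of all degrees together, i.e. of the direct sum of the `F(d)`. -/
abbrev TotalCochains (p : ℕ) : Type _ :=
  ∀ a : Fin (p + 1) → ι, LocalizedModule (monomials (K := K) a) M

/-- The Čech differential
`(dφ)(a₀, …, a_{p+1}) = ∑ⱼ (-1)ʲ φ(a₀, …, âⱼ, …, a_{p+1})|_{D₊(X_{a₀} ⋯ X_{a_{p+1}})}`. -/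
def cechDifferential (p : ℕ) : TotalCochains K ι M p →+ TotalCochains K ι M (p + 1) :=
  AddMonoidHom.mk'
    (fun φ a => ∑ j : Fin (p + 2), (-1 : MvPolynomial ι K) ^ (j : ℕ) •
      LocalizedModule.liftOfLE (M := M) (monomials (a ∘ j.succAbove)) (monomials a)
        (monomials_comp_le a j.succAbove) (φ (a ∘ j.succAbove)))
    (fun φ ψ => by
      funext a
      simp [Finset.sum_add_distrib, smul_add])

/-- The Čech `p`-cochains of the sheaf `F(d)`. -/
def cochains (𝓜 : ℕ → AddSubgroup M) (d : ℤ) (p : ℕ) : AddSubgroup (TotalCochains K ι M p) :=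
  AddSubgroup.pi Set.univ fun a => twistedSections 𝓜 d a

/-- The Čech `p`-cocycles of the sheaf `F(d)`. -/
def cocycles (𝓜 : ℕ → AddSubgroup M) (d : ℤ) (p : ℕ) : AddSubgroup (TotalCochains K ι M p) :=
  cochains 𝓜 d p ⊓ (cechDifferential p).ker

/-- The Čech `p`-coboundaries of the sheaf `F(d)`. -/
def coboundaries (𝓜 : ℕ → AddSubgroup M) (d : ℤ) :
    (p : ℕ) → AddSubgroup (TotalCochains K ι M p)
  | 0 => ⊥
  | p + 1 => (cochains 𝓜 d p).map (cechDifferential p)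

variable (K ι) in
/-- The cohomology group `Hᵖ(F(d))`. -/
abbrev Cohomology (𝓜 : ℕ → AddSubgroup M) (d : ℤ) (p : ℕ) : Type _ :=
  cocycles (K := K) (ι := ι) 𝓜 d p ⧸
    (coboundaries (K := K) (ι := ι) 𝓜 d p).addSubgroupOf (cocycles 𝓜 d p)

variable (K ι) in
/-- `F` is `m`-regular in the sense of Castelnuovo and Mumford: `Hⁱ(F(m - i)) = 0` for all
`i > 0`. -/
def IsRegular (𝓜 : ℕ → AddSubgroup M) (m : ℤ) : Prop :=
  ∀ i : ℕ, 0 < i → Subsingleton (Cohomology K ι 𝓜 (m - i) i)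

variable (K ι) in
/-- The Castelnuovo–Mumford regularity of `F` is `r`: this is the least `m` such that `F` is
`m`-regular. -/
def HasRegularity (𝓜 : ℕ → AddSubgroup M) (r : ℤ) : Prop :=
  IsLeast {m : ℤ | IsRegular K ι 𝓜 m} r

/-- The grading of `S / I`, the associated sheaf of which is the structure sheaf of the closed
subscheme of projective space that is defined by `I`. -/
def structureGrading (I : Ideal (MvPolynomial ι K)) (n : ℕ) :
    AddSubgroup (MvPolynomial ι K ⧸ I) :=
  (quotientComponent I n).toAddSubgroup

/-- The grading of `I`, the associated sheaf of which is the ideal sheaf of the closed subscheme of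
projective space that is defined by `I`. -/
def idealGrading (I : Ideal (MvPolynomial ι K)) (n : ℕ) : AddSubgroup I :=
  (MvPolynomial.homogeneousSubmodule ι K n).toAddSubgroup.comap I.toAddSubgroup.subtype

end Cohomology

end CobleGamma

end

/-! Let `A` be the subalgebra of `K[X₀,…,X₆]` generated by the forty forms at the generic sextuple
in normal form (`chart`, six variables), each multiplied by the seventh variable. The forms are
multiplied by a common factor when the points are rescaled or moved by a matrix of `GL₃`
(`cgamma_diagonal_mul_mul`), and every sextuple in general position can be brought into normal form
(`exists_chart`). Hence `I` is the kernel of `S → A` (`gammaIdeal_eq_ker`); it is prime, and `S/I ≅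
A`.

The core is that `A` is free of rank `27` over a polynomial ring `P` in five linear forms.
Generators: the forty invariants lie in the span of five `params` `ℓ` and five `coords` `y`
(`four_mul_gammaList_chart`). Thirty identities between triple products of invariants
(`gammaList_binomial`), read modulo `ℓ` and solved over `ℤ[1/2]`, put `yᵢyⱼyₖ`, `yᵢ³` and `yᵢ(yⱼ² -
yₖ²)`, for distinct indices, into the ideal of `ℓ` (`coords_cubic`). So `A/(ℓ)` is spanned by `1`,
the `yᵢ`, the `yᵢyⱼ`, five cubics and one quartic, which are `1 + 5 + 15 + 5 + 1 = 27` elements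
(`fullSpan_pow`). Independence: the `ℓ` are algebraically independent
(`algebraicIndependent_params`), and over the point `ℓ = (0,0,0,0,1)` there are `27` distinct limit
points, with `y`-coordinates `0`, `±eᵢ` and the sixteen sign vectors with an even number of entries
`-1` (`exists_curve`). If the `27` generators were dependent over `P`, a linear form in `y` that
separates these points would have a minimal polynomial over the integrally closed ring `P` of degree
`< 27`. This polynomial is monic, and its specialisation at `(0,0,0,0,1)` would have `27` distinct
roots (`combination_injective`).

The numerators of the Hilbert series are the degrees of the free generators. The value `4!·9/8` is
the degree.

For the regularity, the `ℓ` are a regular sequence on `S/I` with quotient of top degree `4`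
(`exists_isLinearSystem_gammaIdeal`). Whenever `r ≥ 1` linear forms are a regular sequence on `S/I`
and the quotient has finite length and top degree `e`, the long exact sequences of local cohomology
show that `Hⁱ(S/I)` vanishes for `i ≠ r` and that `Hʳ(S/I)` is nonzero in exactly the degrees `≤ e -
r` (`IsLinearSystem.acyclic`, `IsLinearSystem.not_acyclic_of_le`). The augmented Čech complex
computes this cohomology. With `r = 5` and `e = 4` the regularities are `4` and, by comparison with
`S`, `5`. -/

noncomputable section

namespace CobleGamma

/-! ### Maps between localized modules -/

section Localization

variable {R M N : Type*} [CommRing R] [AddCommGroup M] [Module R M] [AddCommGroup N] [Module R N]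

theorem liftOfLE_mk {S T : Submonoid R} (h : S ≤ T) (m : M) (s : S) :
    LocalizedModule.liftOfLE S T h (LocalizedModule.mk m s) =
      LocalizedModule.mk m ⟨s.1, h s.2⟩ := by
  rw [IsLocalizedModule.mk_eq_mk', IsLocalizedModule.mk_eq_mk']
  exact IsLocalizedModule.liftOfLE_mk' ..

/-- The map of localized modules that is induced by a linear map. -/
def locMap (S : Submonoid R) (g : M →ₗ[R] N) : LocalizedModule S M →ₗ[R] LocalizedModule S N :=
  IsLocalizedModule.map S (LocalizedModule.mkLinearMap S M) (LocalizedModule.mkLinearMap S N) g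

theorem locMap_mk (S : Submonoid R) (g : M →ₗ[R] N) (m : M) (s : S) :
    locMap S g (LocalizedModule.mk m s) = LocalizedModule.mk (g m) s := by
  rw [IsLocalizedModule.mk_eq_mk', IsLocalizedModule.mk_eq_mk']
  exact IsLocalizedModule.map_mk' ..

theorem locMap_liftOfLE {S T : Submonoid R} (h : S ≤ T) (g : M →ₗ[R] N)
    (z : LocalizedModule S M) :
    locMap T g (LocalizedModule.liftOfLE S T h z) =
      LocalizedModule.liftOfLE S T h (locMap S g z) := by
  induction z using LocalizedModule.induction_on with
  | h m s => rw [locMap_mk, liftOfLE_mk, liftOfLE_mk, locMap_mk]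

theorem liftOfLE_liftOfLE {S T U : Submonoid R} (h : S ≤ T) (h' : T ≤ U)
    (z : LocalizedModule S M) :
    LocalizedModule.liftOfLE T U h' (LocalizedModule.liftOfLE S T h z) =
      LocalizedModule.liftOfLE S U (h.trans h') z := by
  induction z using LocalizedModule.induction_on with
  | h m s => rw [liftOfLE_mk, liftOfLE_mk, liftOfLE_mk]

theorem mk_eq_zero_iff {S : Submonoid R} (m : M) (s : S) :
    LocalizedModule.mk m s = 0 ↔ ∃ u : S, u.1 • m = 0 := by
  rw [← LocalizedModule.zero_mk 1, LocalizedModule.mk_eq]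
  simp [Submonoid.smul_def]

theorem locMap_injective (S : Submonoid R) (g : M →ₗ[R] N) (hg : Function.Injective g) :
    Function.Injective (locMap S g) := by
  rw [injective_iff_map_eq_zero]
  intro z
  induction z using LocalizedModule.induction_on with
  | h m s =>
    rw [locMap_mk, mk_eq_zero_iff, mk_eq_zero_iff]
    rintro ⟨u, hu⟩
    rw [← map_smul] at hu
    exact ⟨u, hg (by rw [hu, map_zero])⟩

end Localization

/-! ### The augmented Čech complex and local cohomology -/

section Complex

variable {K ι M : Type*} [Field K] [AddCommGroup M] [Module (MvPolynomial ι K) M]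

open MvPolynomial

variable (K ι M) in
/-- The cochains of the augmented Čech complex. -/
abbrev AugCochains (i : ℕ) : Type _ :=
  ∀ a : Fin i → ι, LocalizedModule (monomials (K := K) a) M

/-- The restriction of one of the components of a cochain. -/
def restrict {i r : ℕ} (z : AugCochains K ι M i) (b : Fin r → ι) (a : Fin i → ι)
    (h : monomials (K := K) a ≤ monomials b) : LocalizedModule (monomials (K := K) b) M :=
  LocalizedModule.liftOfLE (M := M) (monomials a) (monomials b) h (z a)

theorem restrict_congr {i r : ℕ} (z : AugCochains K ι M i) (b : Fin r → ι) {a a' : Fin i → ι}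
    (e : a = a') (h : monomials (K := K) a ≤ monomials b) :
    restrict z b a h = restrict z b a' (e ▸ h) := by
  subst e
  rfl

/-- The differential of the augmented Čech complex. -/
def augDiff (i : ℕ) : AugCochains K ι M i →+ AugCochains K ι M (i + 1) :=
  AddMonoidHom.mk'
    (fun φ a => ∑ j : Fin (i + 1), (-1 : MvPolynomial ι K) ^ (j : ℕ) •
      LocalizedModule.liftOfLE (M := M) (monomials (a ∘ j.succAbove)) (monomials a)
        (monomials_comp_le a j.succAbove) (φ (a ∘ j.succAbove)))
    (fun φ ψ => by
      funext a
      simp [Finset.sum_add_distrib, smul_add])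

theorem augDiff_apply {i : ℕ} (z : AugCochains K ι M i) (b : Fin (i + 1) → ι) :
    augDiff i z b = ∑ j : Fin (i + 1), (-1 : MvPolynomial ι K) ^ (j : ℕ) •
      restrict z b (b ∘ j.succAbove) (monomials_comp_le b j.succAbove) := rfl

theorem augDiff_smul {i : ℕ} (f : MvPolynomial ι K) (z : AugCochains K ι M i) :
    augDiff i (f • z) = f • augDiff i z := by
  funext b
  simp only [augDiff_apply, restrict, Pi.smul_apply, map_smul, Finset.smul_sum]
  exact Finset.sum_congr rfl fun j _ => smul_comm _ _ _

theorem augDiff_augDiff {i : ℕ} (z : AugCochains K ι M i) : augDiff (i + 1) (augDiff i z) = 0 := by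
  funext b
  have hle : ∀ p : Fin (i + 2) × Fin (i + 1),
      monomials (K := K) ((b ∘ p.1.succAbove) ∘ p.2.succAbove) ≤ monomials b := fun p =>
    (monomials_comp_le _ _).trans (monomials_comp_le _ _)
  have h : augDiff (i + 1) (augDiff i z) b = ∑ p : Fin (i + 2) × Fin (i + 1),
      (-1 : MvPolynomial ι K) ^ (p.1 + p.2 : ℕ) •
        restrict z b ((b ∘ p.1.succAbove) ∘ p.2.succAbove) (hle p) := by
    rw [Fintype.sum_prod_type, augDiff_apply]
    refine Finset.sum_congr rfl fun j _ => ?_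
    rw [restrict, augDiff_apply, map_sum, Finset.smul_sum]
    refine Finset.sum_congr rfl fun k _ => ?_
    rw [map_smul, smul_smul, ← pow_add, restrict, restrict, liftOfLE_liftOfLE]
  rw [h, Pi.zero_apply]
  -- The two orders of deleting the same pair of entries give the same restriction with opposite
  -- signs.
  refine Finset.sum_involution (fun p _ => (p.1.succAbove p.2, p.2.predAbove p.1)) ?_ ?_ ?_ ?_
  · rintro ⟨j, k⟩ -
    have e : (b ∘ (j.succAbove k).succAbove) ∘ (k.predAbove j).succAbove =
        (b ∘ j.succAbove) ∘ k.succAbove := by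
      funext l
      simp [Fin.succAbove_succAbove_succAbove_predAbove]
    simp only
    rw [restrict_congr z b e, Fin.neg_one_pow_succAbove_add_predAbove, neg_smul, add_neg_cancel]
  · rintro ⟨j, k⟩ - - e
    exact Fin.succAbove_ne j k (Prod.ext_iff.1 e).1
  · simp
  · rintro ⟨j, k⟩ -
    simp [Fin.succAbove_succAbove_predAbove, Fin.predAbove_predAbove_succAbove]

/-- The cochains of degree `d`. -/
def augSections (𝓜 : ℕ → AddSubgroup M) (d : ℤ) (i : ℕ) : AddSubgroup (AugCochains K ι M i) :=
  AddSubgroup.pi Set.univ fun a => twistedSections 𝓜 d a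

theorem mem_augSections {𝓜 : ℕ → AddSubgroup M} {d : ℤ} {i : ℕ} {z : AugCochains K ι M i} :
    z ∈ augSections 𝓜 d i ↔ ∀ a, z a ∈ twistedSections 𝓜 d a := by
  simp [augSections, AddSubgroup.mem_pi]

/-- The coboundaries of degree `d`. -/
def augBoundaries (𝓜 : ℕ → AddSubgroup M) (d : ℤ) :
    (i : ℕ) → AddSubgroup (AugCochains K ι M i)
  | 0 => ⊥
  | i + 1 => (augSections 𝓜 d i).map (augDiff i)

theorem augDiff_of_mem_augBoundaries {𝓜 : ℕ → AddSubgroup M} {d : ℤ} {i : ℕ}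
    {z : AugCochains K ι M i} (hz : z ∈ augBoundaries 𝓜 d i) : augDiff i z = 0 := by
  cases i with
  | zero =>
    rw [augBoundaries, AddSubgroup.mem_bot] at hz
    rw [hz, map_zero]
  | succ i =>
    obtain ⟨w, -, rfl⟩ := hz
    exact augDiff_augDiff w

variable (K ι) in
/-- The vanishing of the `i`-th local cohomology of `M` in degree `d`. -/
def Acyclic (𝓜 : ℕ → AddSubgroup M) (d : ℤ) (i : ℕ) : Prop :=
  ∀ z : AugCochains K ι M i, z ∈ augSections 𝓜 d i → augDiff i z = 0 → z ∈ augBoundaries 𝓜 d i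

/-- The augmented complex is the Čech complex with `M` itself put in front, so positions shift by
one; for `i > 0` the groups `Hⁱ` of the sheaf and `Hⁱ⁺¹` of the augmented complex agree by
definition. -/
theorem isRegular_iff {𝓜 : ℕ → AddSubgroup M} {m : ℤ} :
    IsRegular K ι 𝓜 m ↔ ∀ i : ℕ, 0 < i → Acyclic K ι 𝓜 (m - i) (i + 1) := by
  refine forall₂_congr fun i hi => ?_
  obtain ⟨i, rfl⟩ : ∃ j, i = j + 1 := ⟨i - 1, by omega⟩
  rw [QuotientAddGroup.subsingleton_iff, AddSubgroup.addSubgroupOf_eq_top]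
  constructor
  · intro h z hz hz'
    exact h ⟨hz, hz'⟩
  · rintro h z ⟨hz, hz'⟩
    exact h z hz hz'

/-- Multiplication by a homogeneous polynomial shifts degrees. -/
def IsGraded (𝓜 : ℕ → AddSubgroup M) : Prop :=
  ∀ (e n : ℕ) (f : MvPolynomial ι K) (m : M), f.IsHomogeneous e → m ∈ 𝓜 n → f • m ∈ 𝓜 (n + e)

theorem exists_isHomogeneous_of_mem_monomials {r : ℕ} {a : Fin r → ι} {s : MvPolynomial ι K}
    (hs : s ∈ monomials a) : ∃ e, s.IsHomogeneous e := by
  induction hs using Submonoid.closure_induction with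
  | mem x hx =>
    obtain ⟨j, rfl⟩ := hx
    exact ⟨1, isHomogeneous_X _ _⟩
  | one => exact ⟨0, isHomogeneous_one _ _⟩
  | mul x y _ _ hx hy =>
    obtain ⟨e, he⟩ := hx
    obtain ⟨e', he'⟩ := hy
    exact ⟨e + e', he.mul he'⟩

/-- Fractions can be added over a common denominator, so the generated subgroup consists of single
fractions. Zero is listed apart: for negative `d` and the empty tuple no fraction of degree `d`
exists. -/
theorem mem_twistedSections {𝓜 : ℕ → AddSubgroup M} (h𝓜 : IsGraded (K := K) (ι := ι) 𝓜) {d : ℤ}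
    {r : ℕ} {a : Fin r → ι} {z : LocalizedModule (monomials (K := K) a) M}
    (hz : z ∈ twistedSections 𝓜 d a) :
    z = 0 ∨ ∃ (n e : ℕ) (m : M) (s : monomials (K := K) a),
      m ∈ 𝓜 n ∧ s.1.IsHomogeneous e ∧ (n : ℤ) - (e : ℤ) = d ∧ z = LocalizedModule.mk m s := by
  induction hz using AddSubgroup.closure_induction with
  | mem x hx => exact Or.inr hx
  | zero => exact Or.inl rfl
  | add x y _ _ hx hy =>
    obtain rfl | ⟨n, e, m, s, hm, hs, hd, rfl⟩ := hx
    · rwa [zero_add]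
    obtain rfl | ⟨n', e', m', s', hm', hs', hd', rfl⟩ := hy
    · rw [add_zero]
      exact Or.inr ⟨n, e, m, s, hm, hs, hd, rfl⟩
    refine Or.inr ⟨n + e', e + e', s'.1 • m + s.1 • m', s * s',
      add_mem (h𝓜 _ _ _ _ hs' hm) ?_, hs.mul hs', by push_cast; omega, LocalizedModule.mk_add_mk⟩
    have : n + e' = n' + e := by omega
    rw [this]
    exact h𝓜 _ _ _ _ hs hm'
  | neg x _ hx =>
    obtain rfl | ⟨n, e, m, s, hm, hs, hd, rfl⟩ := hx
    · exact Or.inl neg_zero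
    · exact Or.inr ⟨n, e, -m, s, neg_mem hm, hs, hd, LocalizedModule.mk_neg.symm⟩

theorem mk_mem_twistedSections {𝓜 : ℕ → AddSubgroup M} {d : ℤ} {r : ℕ} {a : Fin r → ι} {n e : ℕ}
    {m : M} {s : monomials (K := K) a} (hm : m ∈ 𝓜 n) (hs : s.1.IsHomogeneous e)
    (hd : (n : ℤ) - (e : ℤ) = d) : LocalizedModule.mk m s ∈ twistedSections 𝓜 d a :=
  AddSubgroup.subset_closure ⟨n, e, m, s, hm, hs, hd, rfl⟩

theorem smul_mem_twistedSections {𝓜 : ℕ → AddSubgroup M} (h𝓜 : IsGraded (K := K) (ι := ι) 𝓜)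
    {d : ℤ} {r : ℕ} {a : Fin r → ι} {z : LocalizedModule (monomials (K := K) a) M}
    (hz : z ∈ twistedSections 𝓜 d a) {f : MvPolynomial ι K} {k : ℕ} (hf : f.IsHomogeneous k) :
    f • z ∈ twistedSections 𝓜 (d + k) a := by
  obtain rfl | ⟨n, e, m, s, hm, hs, hd, rfl⟩ := mem_twistedSections h𝓜 hz
  · rw [smul_zero]
    exact zero_mem _
  · rw [LocalizedModule.smul'_mk]
    exact mk_mem_twistedSections (h𝓜 _ _ _ _ hf hm) hs (by push_cast; omega)

theorem smul_mem_augSections {𝓜 : ℕ → AddSubgroup M} (h𝓜 : IsGraded (K := K) (ι := ι) 𝓜)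
    {d : ℤ} {i : ℕ} {z : AugCochains K ι M i} (hz : z ∈ augSections 𝓜 d i)
    {f : MvPolynomial ι K} {k : ℕ} (hf : f.IsHomogeneous k) :
    f • z ∈ augSections 𝓜 (d + k) i := by
  rw [mem_augSections] at hz ⊢
  exact fun a => smul_mem_twistedSections h𝓜 (hz a) hf

theorem smul_mem_augBoundaries {𝓜 : ℕ → AddSubgroup M} (h𝓜 : IsGraded (K := K) (ι := ι) 𝓜)
    {d : ℤ} {i : ℕ} {z : AugCochains K ι M i} (hz : z ∈ augBoundaries 𝓜 d i)
    {f : MvPolynomial ι K} {k : ℕ} (hf : f.IsHomogeneous k) :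
    f • z ∈ augBoundaries 𝓜 (d + k) i := by
  cases i with
  | zero =>
    rw [augBoundaries, AddSubgroup.mem_bot] at hz ⊢
    rw [hz, smul_zero]
  | succ i =>
    obtain ⟨w, hw, rfl⟩ := hz
    exact ⟨f • w, smul_mem_augSections h𝓜 hw hf, augDiff_smul f w⟩

theorem augDiff_mem_augSections {𝓜 : ℕ → AddSubgroup M} (h𝓜 : IsGraded (K := K) (ι := ι) 𝓜)
    {d : ℤ} {i : ℕ} {z : AugCochains K ι M i} (hz : z ∈ augSections 𝓜 d i) :
    augDiff i z ∈ augSections 𝓜 d (i + 1) := by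
  rw [mem_augSections] at hz ⊢
  intro b
  rw [augDiff_apply]
  refine sum_mem fun j _ => ?_
  have h : restrict z b (b ∘ j.succAbove) (monomials_comp_le b j.succAbove) ∈
      twistedSections 𝓜 d b := by
    have hj := hz (b ∘ j.succAbove)
    rw [restrict]
    obtain hj | ⟨n, e, m, s, hm, hs, hd, hj⟩ := mem_twistedSections h𝓜 hj
    · rw [hj, map_zero]
      exact zero_mem _
    · rw [hj, liftOfLE_mk]
      exact mk_mem_twistedSections hm hs hd
  obtain h1 | h1 := neg_one_pow_eq_or (MvPolynomial ι K) (j : ℕ)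
  · rwa [h1, one_smul]
  · rw [h1, neg_smul, one_smul]
    exact neg_mem h

/-! ### Multiplication by powers of linear forms -/

theorem monomials_le_cons {r : ℕ} (x : ι) (b : Fin r → ι) :
    monomials (K := K) b ≤ monomials (Fin.cons x b : Fin (r + 1) → ι) := by
  apply Submonoid.closure_mono
  rintro _ ⟨j, rfl⟩
  exact ⟨j.succ, by simp⟩

theorem exists_eq_of_mem_monomials_cons {r : ℕ} {x : ι} {b : Fin r → ι} {s : MvPolynomial ι K}
    (hs : s ∈ monomials (Fin.cons x b : Fin (r + 1) → ι)) :
    ∃ k : ℕ, ∃ u ∈ monomials (K := K) b, s = X x ^ k * u := by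
  induction hs using Submonoid.closure_induction with
  | mem y hy =>
    obtain ⟨j, rfl⟩ := hy
    cases j using Fin.cases with
    | zero => exact ⟨1, 1, one_mem _, by simp⟩
    | succ j => exact ⟨0, X (b j), Submonoid.subset_closure ⟨j, rfl⟩, by simp⟩
  | one => exact ⟨0, 1, one_mem _, by simp⟩
  | mul y z _ _ hy hz =>
    obtain ⟨k, u, hu, rfl⟩ := hy
    obtain ⟨l, v, hv, rfl⟩ := hz
    exact ⟨k + l, u * v, mul_mem hu hv, by ring⟩

theorem exists_pow_smul_eq_zero {r : ℕ} {x : ι} {b : Fin r → ι}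
    {y : LocalizedModule (monomials (K := K) b) M}
    (hy : LocalizedModule.liftOfLE _ _ (monomials_le_cons x b) y = 0) :
    ∃ k : ℕ, (X x : MvPolynomial ι K) ^ k • y = 0 := by
  induction y using LocalizedModule.induction_on with
  | h m s =>
    rw [liftOfLE_mk, mk_eq_zero_iff] at hy
    obtain ⟨⟨u, hu⟩, hum⟩ := hy
    obtain ⟨k, v, hv, rfl⟩ := exists_eq_of_mem_monomials_cons hu
    refine ⟨k, ?_⟩
    rw [LocalizedModule.smul'_mk, mk_eq_zero_iff]
    exact ⟨⟨v, hv⟩, by rw [smul_smul, mul_comm]; exact hum⟩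

theorem exists_pow_smul_eq_liftOfLE {𝓜 : ℕ → AddSubgroup M}
    (h𝓜 : IsGraded (K := K) (ι := ι) 𝓜) {d : ℤ} {r : ℕ} {x : ι} {b : Fin r → ι}
    {y : LocalizedModule (monomials (K := K) (Fin.cons x b : Fin (r + 1) → ι)) M}
    (hy : y ∈ twistedSections 𝓜 d (Fin.cons x b : Fin (r + 1) → ι)) :
    ∃ k : ℕ, ∃ w ∈ twistedSections 𝓜 (d + k) b,
      LocalizedModule.liftOfLE _ _ (monomials_le_cons x b) w =
        (X x : MvPolynomial ι K) ^ k • y := by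
  obtain rfl | ⟨n, e, m, ⟨s, hs⟩, hm, he, hd, rfl⟩ := mem_twistedSections h𝓜 hy
  · exact ⟨0, 0, zero_mem _, by simp⟩
  · obtain ⟨k, v, hv, rfl⟩ := exists_eq_of_mem_monomials_cons hs
    obtain ⟨e', he'⟩ := exists_isHomogeneous_of_mem_monomials hv
    by_cases hv0 : v = 0
    · subst hv0
      refine ⟨0, 0, zero_mem _, ?_⟩
      rw [map_zero, eq_comm, LocalizedModule.smul'_mk, mk_eq_zero_iff]
      exact ⟨⟨_, hs⟩, by simp⟩
    have hek : e = k + e' := he.inj_right ((isHomogeneous_X_pow x k).mul he')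
      (mul_ne_zero (pow_ne_zero _ (X_ne_zero x)) hv0)
    refine ⟨k, LocalizedModule.mk m ⟨v, hv⟩, mk_mem_twistedSections hm he' ?_, ?_⟩
    · rw [hek] at hd
      push_cast at hd
      omega
    · rw [liftOfLE_mk, LocalizedModule.smul'_mk, LocalizedModule.mk_eq]
      refine ⟨1, ?_⟩
      simp only [one_smul, Submonoid.smul_def, smul_smul]
      rw [mul_comm]

/-- After inverting `X x` the complex is contractible by the homotopy `z ↦ (b ↦ z (x, b))`. As there
are finitely many components, one power of `X x` clears all denominators of this homotopy, and a
further power kills the remaining torsion. -/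
theorem pow_X_smul_mem_augBoundaries [Finite ι] {𝓜 : ℕ → AddSubgroup M}
    (h𝓜 : IsGraded (K := K) (ι := ι) 𝓜) {d : ℤ} {i : ℕ} {z : AugCochains K ι M i}
    (hz : z ∈ augSections 𝓜 d i) (hz' : augDiff i z = 0) (x : ι) :
    ∃ k : ℕ, (X x : MvPolynomial ι K) ^ k • z ∈ augBoundaries 𝓜 (d + k) i := by
  have _ := Fintype.ofFinite ι
  classical
  cases i with
  | zero =>
    obtain ⟨k, hk⟩ := exists_pow_smul_eq_zero (x := x) (b := (Fin.elim0 : Fin 0 → ι))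
      (y := z Fin.elim0) (by
        have h := congrFun hz' (Fin.cons x Fin.elim0)
        rw [augDiff_apply] at h
        rw [Fin.sum_univ_one, Fin.val_zero, pow_zero, one_smul] at h
        rw [restrict_congr z _ (a' := Fin.elim0) (by funext j; exact j.elim0)] at h
        exact h)
    refine ⟨k, ?_⟩
    rw [augBoundaries, AddSubgroup.mem_bot]
    funext a
    have : a = Fin.elim0 := by funext j; exact j.elim0
    subst this
    exact hk
  | succ i =>
    rw [mem_augSections] at hz
    choose k w hw hwk using fun b : Fin i → ι =>
      exists_pow_smul_eq_liftOfLE (x := x) h𝓜 (hz (Fin.cons x b))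
    obtain ⟨k₀, hk₀⟩ : ∃ k₀, ∀ b, k b ≤ k₀ :=
      ⟨Finset.univ.sup k, fun b => Finset.le_sup (Finset.mem_univ b)⟩
    -- The homotopy applied to `z`, multiplied by the common power `k₀` so that it is defined
    -- without inverting `X x`.
    let w₀ : AugCochains K ι M i := fun b => (X x : MvPolynomial ι K) ^ (k₀ - k b) • w b
    have hw₀ : w₀ ∈ augSections 𝓜 (d + k₀) i := by
      rw [mem_augSections]
      intro b
      have := smul_mem_twistedSections h𝓜 (hw b) (isHomogeneous_X_pow (R := K) x (k₀ - k b))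
      have e : d + (k₀ : ℤ) = d + k b + ((k₀ - k b : ℕ) : ℤ) := by
        have := hk₀ b
        omega
      rw [e]
      exact this
    have hw₀' : ∀ b, LocalizedModule.liftOfLE _ _ (monomials_le_cons x b) (w₀ b) =
        (X x : MvPolynomial ι K) ^ k₀ • z (Fin.cons x b) := by
      intro b
      simp only [w₀]
      rw [map_smul, hwk, smul_smul, ← pow_add, Nat.sub_add_cancel (hk₀ b)]
    have key : ∀ b : Fin (i + 1) → ι, ∃ l : ℕ, (X x : MvPolynomial ι K) ^ l •
        ((X x : MvPolynomial ι K) ^ k₀ • z b - augDiff i w₀ b) = 0 := by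
      intro b
      apply exists_pow_smul_eq_zero
      -- The cocycle condition at `(x, b)`: deleting `x` gives `z b`, and deleting the other entries
      -- gives, with the opposite sign, the boundary of the homotopy.
      have h := congrFun hz' (Fin.cons x b)
      rw [augDiff_apply, Fin.sum_univ_succ] at h
      simp only [Fin.val_zero, pow_zero, one_smul, Fin.val_succ, Pi.zero_apply] at h
      rw [restrict_congr z _ (a' := b) (by funext j; simp)] at h
      rw [map_sub, map_smul, augDiff_apply, map_sum]
      have e : ∀ j : Fin (i + 1), LocalizedModule.liftOfLE _ _ (monomials_le_cons x b)
          ((-1 : MvPolynomial ι K) ^ (j : ℕ) • restrict w₀ b (b ∘ j.succAbove)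
            (monomials_comp_le b j.succAbove)) = (X x : MvPolynomial ι K) ^ k₀ •
          ((-1 : MvPolynomial ι K) ^ (j : ℕ) •
            restrict z (Fin.cons x b : Fin (i + 2) → ι)
              ((Fin.cons x b : Fin (i + 2) → ι) ∘ j.succ.succAbove)
              (monomials_comp_le _ j.succ.succAbove)) := by
        intro j
        have hc : (Fin.cons x b : Fin (i + 2) → ι) ∘ j.succ.succAbove =
            (Fin.cons x (b ∘ j.succAbove) : Fin (i + 1) → ι) := by
          funext l
          cases l using Fin.cases with
          | zero => simp
          | succ l => simp
        rw [restrict_congr z _ hc, smul_comm, map_smul]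
        congr 1
        rw [restrict, restrict, liftOfLE_liftOfLE, ← map_smul, ← hw₀', liftOfLE_liftOfLE]
      rw [Finset.sum_congr rfl fun j _ => e j, ← Finset.smul_sum, ← smul_sub]
      have h2 : ∑ j : Fin (i + 1), (-1 : MvPolynomial ι K) ^ ((j : ℕ) + 1) •
          restrict z (Fin.cons x b : Fin (i + 2) → ι)
            ((Fin.cons x b : Fin (i + 2) → ι) ∘ j.succ.succAbove)
            (monomials_comp_le _ j.succ.succAbove) = - ∑ j : Fin (i + 1),
          (-1 : MvPolynomial ι K) ^ (j : ℕ) •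
          restrict z (Fin.cons x b : Fin (i + 2) → ι)
            ((Fin.cons x b : Fin (i + 2) → ι) ∘ j.succ.succAbove)
            (monomials_comp_le _ j.succ.succAbove) := by
        rw [← Finset.sum_neg_distrib]
        refine Finset.sum_congr rfl fun j _ => ?_
        rw [pow_succ, mul_neg_one, neg_smul]
      rw [h2, ← sub_eq_add_neg] at h
      rw [restrict] at h
      rw [h, smul_zero]
    choose l hl using key
    obtain ⟨l₀, hl₀⟩ : ∃ l₀, ∀ b, l b ≤ l₀ :=
      ⟨Finset.univ.sup l, fun b => Finset.le_sup (Finset.mem_univ b)⟩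
    refine ⟨k₀ + l₀, (X x : MvPolynomial ι K) ^ l₀ • w₀, ?_, ?_⟩
    · have := smul_mem_augSections h𝓜 hw₀ (isHomogeneous_X_pow (R := K) x l₀)
      rw [Nat.cast_add, ← add_assoc]
      exact this
    · rw [augDiff_smul, eq_comm, ← sub_eq_zero, pow_add, mul_comm, mul_smul, ← smul_sub]
      funext b
      rw [← Nat.sub_add_cancel (hl₀ b), pow_add, mul_smul]
      have := hl b
      rw [Pi.smul_apply, Pi.smul_apply, Pi.sub_apply, Pi.smul_apply, this, smul_zero, Pi.zero_apply]

theorem homogeneousComponent_isHomogeneous_mul {σ R : Type*} [CommRing R] {g : MvPolynomial σ R}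
    {k : ℕ} (hg : g.IsHomogeneous k) (f : MvPolynomial σ R) (n : ℕ) :
    homogeneousComponent n (g * f) = if k ≤ n then g * homogeneousComponent (n - k) f else 0 := by
  have h : g * f = ∑ i ∈ Finset.range (f.totalDegree + 1), g * homogeneousComponent i f := by
    rw [← Finset.mul_sum, sum_homogeneousComponent]
  rw [h, map_sum]
  have h2 : ∀ i, homogeneousComponent n (g * homogeneousComponent i f) =
      if n = k + i then g * homogeneousComponent i f else 0 := fun i =>
    homogeneousComponent_of_mem (hg.mul (homogeneousComponent_isHomogeneous i f))
  simp only [h2]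
  split_ifs with hk
  · obtain ⟨e, rfl⟩ := Nat.exists_eq_add_of_le hk
    simp only [add_right_inj, add_tsub_cancel_left, Finset.sum_ite_eq, Finset.mem_range,
      ite_eq_left_iff, not_lt]
    intro he
    rw [homogeneousComponent_eq_zero _ _ he, mul_zero]
  · exact Finset.sum_eq_zero fun i _ => if_neg (by omega)

theorem mem_span_range_X {σ R : Type*} [CommRing R] {l : MvPolynomial σ R}
    (hl : l.IsHomogeneous 1) : l ∈ Ideal.span (Set.range (X : σ → MvPolynomial σ R)) := by
  rw [← Set.image_univ, mem_ideal_span_X_image]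
  intro m hm
  by_contra! h
  have hm0 : m = 0 := by
    ext i
    exact h i (Set.mem_univ i)
  have := hl (mem_support_iff.1 hm)
  simp [hm0] at this

/-- The polynomials that annihilate the class of `z` form a homogeneous ideal. Its radical contains
the variables and therefore every linear form. -/
theorem pow_smul_mem_augBoundaries [Finite ι] {𝓜 : ℕ → AddSubgroup M}
    (h𝓜 : IsGraded (K := K) (ι := ι) 𝓜) {d : ℤ} {i : ℕ} {z : AugCochains K ι M i}
    (hz : z ∈ augSections 𝓜 d i) (hz' : augDiff i z = 0) {l : MvPolynomial ι K}
    (hl : l.IsHomogeneous 1) :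
    ∃ k : ℕ, l ^ k • z ∈ augBoundaries 𝓜 (d + k) i := by
  -- The condition is imposed on every homogeneous component, since boundaries are only considered
  -- in a fixed degree.
  let Q : Ideal (MvPolynomial ι K) :=
    { carrier := {f | ∀ e : ℕ, homogeneousComponent e f • z ∈ augBoundaries 𝓜 (d + e) i}
      add_mem' := fun {f g} hf hg e => by
        rw [map_add, add_smul]
        exact add_mem (hf e) (hg e)
      zero_mem' := fun e => by
        rw [map_zero, zero_smul]
        exact zero_mem _
      smul_mem' := fun g f hf e => by
        rw [smul_eq_mul, ← sum_homogeneousComponent g, Finset.sum_mul, map_sum, Finset.sum_smul]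
        refine sum_mem fun k _ => ?_
        have hk := homogeneousComponent_isHomogeneous k g
        rw [homogeneousComponent_isHomogeneous_mul hk]
        split_ifs with hke
        · rw [mul_smul]
          have := smul_mem_augBoundaries h𝓜 (hf (e - k)) hk
          rwa [add_assoc, ← Nat.cast_add, Nat.sub_add_cancel hke] at this
        · rw [zero_smul]
          exact zero_mem _ }
  have hX : ∀ x, (X x : MvPolynomial ι K) ∈ Q.radical := by
    intro x
    obtain ⟨k, hk⟩ := pow_X_smul_mem_augBoundaries h𝓜 hz hz' x
    refine ⟨k, fun e => ?_⟩
    rw [homogeneousComponent_of_mem (isHomogeneous_X_pow x k)]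
    split_ifs with h
    · rw [h]
      exact hk
    · rw [zero_smul]
      exact zero_mem _
  have hlQ : l ∈ Q.radical :=
    Ideal.span_le.2 (by rintro _ ⟨x, rfl⟩; exact hX x) (mem_span_range_X hl)
  obtain ⟨k, hk⟩ := hlQ
  refine ⟨k, ?_⟩
  have h := hk k
  have hlk : (l ^ k).IsHomogeneous k := by
    have := hl.pow k
    rwa [one_mul] at this
  rwa [homogeneousComponent_of_mem hlk, if_pos rfl] at h

end Complex

/-! ### Pieces of the long exact cohomology sequence -/

section Exact

variable {K ι M M' M'' : Type*} [Field K] [AddCommGroup M] [Module (MvPolynomial ι K) M]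
  [AddCommGroup M'] [Module (MvPolynomial ι K) M'] [AddCommGroup M'']
  [Module (MvPolynomial ι K) M'']

open MvPolynomial

/-- The map of cochains that is induced by a linear map. -/
def mapCochain (g : M →ₗ[MvPolynomial ι K] M') (i : ℕ) :
    AugCochains K ι M i →ₗ[MvPolynomial ι K] AugCochains K ι M' i :=
  LinearMap.pi fun a => locMap (monomials a) g ∘ₗ LinearMap.proj a

theorem mapCochain_apply (g : M →ₗ[MvPolynomial ι K] M') {i : ℕ} (z : AugCochains K ι M i)
    (a : Fin i → ι) : mapCochain g i z a = locMap (monomials a) g (z a) := rfl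

theorem augDiff_mapCochain (g : M →ₗ[MvPolynomial ι K] M') {i : ℕ} (z : AugCochains K ι M i) :
    augDiff i (mapCochain g i z) = mapCochain g (i + 1) (augDiff i z) := by
  funext b
  rw [mapCochain_apply, augDiff_apply, augDiff_apply, map_sum]
  refine Finset.sum_congr rfl fun j _ => ?_
  rw [map_smul, restrict, restrict, locMap_liftOfLE, mapCochain_apply]

theorem mapCochain_injective {g : M →ₗ[MvPolynomial ι K] M'} (hg : Function.Injective g) (i : ℕ) :
    Function.Injective (mapCochain g i) := fun z z' h => by
  funext a
  exact locMap_injective _ g hg (congrFun h a)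

/-- Short exact sequences of graded modules, where the first map increases degrees by `δ`. -/
structure IsGradedExact (𝓜' : ℕ → AddSubgroup M') (𝓜 : ℕ → AddSubgroup M)
    (𝓜'' : ℕ → AddSubgroup M'') (δ : ℕ) (f : M' →ₗ[MvPolynomial ι K] M)
    (g : M →ₗ[MvPolynomial ι K] M'') : Prop where
  graded' : IsGraded (K := K) (ι := ι) 𝓜'
  graded : IsGraded (K := K) (ι := ι) 𝓜
  graded'' : IsGraded (K := K) (ι := ι) 𝓜''
  injective : Function.Injective f
  map_mem : ∀ n, ∀ m ∈ 𝓜' n, f m ∈ 𝓜 (n + δ)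
  map_mem' : ∀ n, ∀ m ∈ 𝓜 n, g m ∈ 𝓜'' n
  comp : ∀ m, g (f m) = 0
  exact : ∀ n, ∀ m ∈ 𝓜 n, g m = 0 → m = 0 ∨ ∃ n', ∃ m' ∈ 𝓜' n', n' + δ = n ∧ f m' = m
  surjective : ∀ n, ∀ m ∈ 𝓜'' n, ∃ m' ∈ 𝓜 n, g m' = m

namespace IsGradedExact

variable {𝓜' : ℕ → AddSubgroup M'} {𝓜 : ℕ → AddSubgroup M} {𝓜'' : ℕ → AddSubgroup M''} {δ : ℕ}
  {f : M' →ₗ[MvPolynomial ι K] M} {g : M →ₗ[MvPolynomial ι K] M''}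

theorem mapCochain_comp (h : IsGradedExact 𝓜' 𝓜 𝓜'' δ f g) {i : ℕ} (z : AugCochains K ι M' i) :
    mapCochain g i (mapCochain f i z) = 0 := by
  funext a
  rw [mapCochain_apply, mapCochain_apply]
  induction z a using LocalizedModule.induction_on with
  | h m s => rw [locMap_mk, locMap_mk, h.comp, LocalizedModule.zero_mk, Pi.zero_apply]

theorem mapCochain_mem (h : IsGradedExact 𝓜' 𝓜 𝓜'' δ f g) {d : ℤ} {i : ℕ}
    {z : AugCochains K ι M' i} (hz : z ∈ augSections 𝓜' d i) :
    mapCochain f i z ∈ augSections 𝓜 (d + δ) i := by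
  rw [mem_augSections] at hz ⊢
  intro a
  rw [mapCochain_apply]
  obtain h0 | ⟨n, e, m, s, hm, hs, hd, h0⟩ := mem_twistedSections h.graded' (hz a)
  · rw [h0, map_zero]
    exact zero_mem _
  · rw [h0, locMap_mk]
    exact mk_mem_twistedSections (h.map_mem _ _ hm) hs (by push_cast; omega)

theorem mapCochain_mem' (h : IsGradedExact 𝓜' 𝓜 𝓜'' δ f g) {d : ℤ} {i : ℕ}
    {z : AugCochains K ι M i} (hz : z ∈ augSections 𝓜 d i) :
    mapCochain g i z ∈ augSections 𝓜'' d i := by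
  rw [mem_augSections] at hz ⊢
  intro a
  rw [mapCochain_apply]
  obtain h0 | ⟨n, e, m, s, hm, hs, hd, h0⟩ := mem_twistedSections h.graded (hz a)
  · rw [h0, map_zero]
    exact zero_mem _
  · rw [h0, locMap_mk]
    exact mk_mem_twistedSections (h.map_mem' _ _ hm) hs hd

theorem exists_lift (h : IsGradedExact 𝓜' 𝓜 𝓜'' δ f g) {d : ℤ} {i : ℕ}
    {z : AugCochains K ι M'' i} (hz : z ∈ augSections 𝓜'' d i) :
    ∃ w ∈ augSections 𝓜 d i, mapCochain g i w = z := by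
  rw [mem_augSections] at hz
  have key : ∀ a, ∃ w ∈ twistedSections 𝓜 d a, locMap (monomials a) g w = z a := by
    intro a
    obtain h0 | ⟨n, e, m, s, hm, hs, hd, h0⟩ := mem_twistedSections h.graded'' (hz a)
    · exact ⟨0, zero_mem _, by rw [h0, map_zero]⟩
    · obtain ⟨m', hm', rfl⟩ := h.surjective _ _ hm
      exact ⟨_, mk_mem_twistedSections hm' hs hd, by rw [h0, locMap_mk]⟩
  choose w hw hw' using key
  exact ⟨w, mem_augSections.2 hw, funext hw'⟩

theorem exists_of_mapCochain_eq_zero (h : IsGradedExact 𝓜' 𝓜 𝓜'' δ f g) {d : ℤ} {i : ℕ}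
    {z : AugCochains K ι M i} (hz : z ∈ augSections 𝓜 (d + δ) i) (hz' : mapCochain g i z = 0) :
    ∃ w ∈ augSections 𝓜' d i, mapCochain f i w = z := by
  rw [mem_augSections] at hz
  have key : ∀ a, ∃ w ∈ twistedSections 𝓜' d a, locMap (monomials a) f w = z a := by
    intro a
    have ha := congrFun hz' a
    rw [mapCochain_apply, Pi.zero_apply] at ha
    obtain h0 | ⟨n, e, m, s, hm, hs, hd, h0⟩ := mem_twistedSections h.graded (hz a)
    · exact ⟨0, zero_mem _, by rw [h0, map_zero]⟩
    · rw [h0, locMap_mk, mk_eq_zero_iff] at ha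
      obtain ⟨u, hu⟩ := ha
      obtain ⟨e', he'⟩ := exists_isHomogeneous_of_mem_monomials u.2
      rw [← map_smul] at hu
      -- Only a multiple `u • m` of the numerator is mapped to zero, so the fraction is first
      -- expanded by `u`.
      have hz1 : z a = LocalizedModule.mk (u • m) (u * s) := by
        rw [h0, LocalizedModule.mk_cancel_common_left]
      obtain h1 | ⟨n', m', hm', hn', h1⟩ := h.exact _ _ (h.graded _ _ _ _ he' hm) hu
      · refine ⟨0, zero_mem _, ?_⟩
        rw [hz1, Submonoid.smul_def, h1, LocalizedModule.zero_mk, map_zero]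
      · refine ⟨LocalizedModule.mk m' (u * s), mk_mem_twistedSections hm' (he'.mul hs) ?_, ?_⟩
        · push_cast
          omega
        · rw [locMap_mk, h1, hz1, Submonoid.smul_def]
  choose w hw hw' using key
  exact ⟨w, mem_augSections.2 hw, funext hw'⟩

/-- The kernel of `Hⁱ⁺¹(M') → Hⁱ⁺¹(M)` is the image of the connecting map from `Hⁱ(M'')`, which is
zero here. -/
theorem mem_augBoundaries_of_mapCochain (h : IsGradedExact 𝓜' 𝓜 𝓜'' δ f g) {d : ℤ} {i : ℕ}
    (h'' : Acyclic K ι 𝓜'' (d + δ) i) {z : AugCochains K ι M' (i + 1)}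
    (hz : mapCochain f (i + 1) z ∈ augBoundaries 𝓜 (d + δ) (i + 1)) :
    z ∈ augBoundaries 𝓜' d (i + 1) := by
  obtain ⟨w, hw, hwz⟩ := hz
  have hw'' := h'' _ (h.mapCochain_mem' hw) (by rw [augDiff_mapCochain, hwz, h.mapCochain_comp])
  -- A cocycle `v` of `M` with the same image as `w` in `M''` is subtracted, so that `w - v` comes
  -- from `M'`.
  obtain ⟨v, hv, hv', hvw⟩ : ∃ v ∈ augSections 𝓜 (d + δ) i, augDiff i v = 0 ∧
      mapCochain g i v = mapCochain g i w := by
    cases i with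
    | zero =>
      rw [augBoundaries, AddSubgroup.mem_bot] at hw''
      exact ⟨0, zero_mem _, map_zero _, by rw [hw'', map_zero]⟩
    | succ i =>
      obtain ⟨v'', hv'', hvw⟩ := hw''
      obtain ⟨v, hv, rfl⟩ := h.exists_lift hv''
      refine ⟨augDiff i v, augDiff_mem_augSections h.graded hv, augDiff_augDiff v, ?_⟩
      rw [← augDiff_mapCochain, hvw]
  obtain ⟨u, hu, hu'⟩ := h.exists_of_mapCochain_eq_zero (sub_mem hw hv)
    (by rw [map_sub, hvw, sub_self])
  refine ⟨u, hu, mapCochain_injective h.injective _ ?_⟩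
  rw [← augDiff_mapCochain, hu', map_sub, hv', sub_zero, hwz]

theorem acyclic_left (h : IsGradedExact 𝓜' 𝓜 𝓜'' δ f g) {d : ℤ} {i : ℕ}
    (h'' : Acyclic K ι 𝓜'' (d + δ) i) (hM : Acyclic K ι 𝓜 (d + δ) (i + 1)) :
    Acyclic K ι 𝓜' d (i + 1) := fun z hz hz' =>
  h.mem_augBoundaries_of_mapCochain h'' (hM _ (h.mapCochain_mem hz)
    (by rw [augDiff_mapCochain, hz', map_zero]))

/-- Exactness of `Hⁱ(M) → Hⁱ(M'') → Hⁱ⁺¹(M')`. -/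
theorem acyclic_right (h : IsGradedExact 𝓜' 𝓜 𝓜'' δ f g) {d : ℤ} {i : ℕ}
    (hM : Acyclic K ι 𝓜 (d + δ) i) (h' : Acyclic K ι 𝓜' d (i + 1)) :
    Acyclic K ι 𝓜'' (d + δ) i := by
  intro z hz hz'
  obtain ⟨w, hw, rfl⟩ := h.exists_lift hz
  rw [augDiff_mapCochain] at hz'
  obtain ⟨u, hu, hu'⟩ := h.exists_of_mapCochain_eq_zero (augDiff_mem_augSections h.graded hw) hz'
  obtain ⟨v, hv, rfl⟩ := h' u hu (mapCochain_injective h.injective _ (by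
    rw [← augDiff_mapCochain, hu', augDiff_augDiff, map_zero]))
  have hb := hM (w - mapCochain f i v) (sub_mem hw (h.mapCochain_mem hv))
    (by rw [map_sub, augDiff_mapCochain, hu', sub_self])
  have e : mapCochain g i w = mapCochain g i (w - mapCochain f i v) := by
    rw [map_sub, h.mapCochain_comp, sub_zero]
  rw [e]
  cases i with
  | zero =>
    rw [augBoundaries, AddSubgroup.mem_bot] at hb ⊢
    rw [hb, map_zero]
  | succ i =>
    obtain ⟨t, ht, ht'⟩ := hb
    rw [← ht', ← augDiff_mapCochain]
    exact ⟨_, h.mapCochain_mem' ht, rfl⟩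

theorem acyclic_middle (h : IsGradedExact 𝓜' 𝓜 𝓜'' δ f g) {d : ℤ} {i : ℕ}
    (h' : Acyclic K ι 𝓜' d i) (h'' : Acyclic K ι 𝓜'' (d + δ) i) :
    Acyclic K ι 𝓜 (d + δ) i := by
  intro z hz hz'
  have hb := h'' _ (h.mapCochain_mem' hz) (by rw [augDiff_mapCochain, hz', map_zero])
  obtain ⟨v, hv, hvz⟩ : ∃ v ∈ augBoundaries 𝓜 (d + δ) i, mapCochain g i v = mapCochain g i z := by
    cases i with
    | zero =>
      rw [augBoundaries, AddSubgroup.mem_bot] at hb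
      exact ⟨0, zero_mem _, by rw [hb, map_zero]⟩
    | succ i =>
      obtain ⟨v'', hv'', hvz⟩ := hb
      obtain ⟨v, hv, rfl⟩ := h.exists_lift hv''
      exact ⟨_, ⟨v, hv, rfl⟩, by rw [← augDiff_mapCochain, hvz]⟩
  have hv' : v ∈ augSections 𝓜 (d + δ) i := by
    cases i with
    | zero =>
      rw [augBoundaries, AddSubgroup.mem_bot] at hv
      rw [hv]
      exact zero_mem _
    | succ i =>
      obtain ⟨t, ht, rfl⟩ := hv
      exact augDiff_mem_augSections h.graded ht
  obtain ⟨u, hu, hu'⟩ := h.exists_of_mapCochain_eq_zero (sub_mem hz hv')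
    (by rw [map_sub, hvz, sub_self])
  have hub := h' u hu (mapCochain_injective h.injective _ (by
    rw [← augDiff_mapCochain, hu', map_sub, hz', augDiff_of_mem_augBoundaries hv, sub_zero,
      map_zero]))
  have hzv : z - v ∈ augBoundaries 𝓜 (d + δ) i := by
    rw [← hu']
    cases i with
    | zero =>
      rw [augBoundaries, AddSubgroup.mem_bot] at hub ⊢
      rw [hub, map_zero]
    | succ i =>
      obtain ⟨t, ht, rfl⟩ := hub
      rw [← augDiff_mapCochain]
      exact ⟨_, h.mapCochain_mem ht, rfl⟩
  simpa using add_mem hzv hv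

end IsGradedExact

end Exact

/-! ### Local cohomology of quotients with a regular sequence of linear forms -/

section Quotients

variable {K ι : Type*} [Field K]

open MvPolynomial

/-- Homogeneous ideals. -/
def IsHomogeneousIdeal (I : Ideal (MvPolynomial ι K)) : Prop :=
  ∀ f ∈ I, ∀ n, homogeneousComponent n f ∈ I

theorem mem_structureGrading {I : Ideal (MvPolynomial ι K)} {n : ℕ} {x : MvPolynomial ι K ⧸ I} :
    x ∈ structureGrading I n ↔ ∃ p : MvPolynomial ι K, p.IsHomogeneous n ∧
      Ideal.Quotient.mk I p = x := Iff.rfl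

theorem isGraded_structureGrading (I : Ideal (MvPolynomial ι K)) :
    IsGraded (K := K) (ι := ι) (structureGrading I) := by
  rintro e n f _ hf ⟨p, hp, rfl⟩
  refine mem_structureGrading.2 ⟨f * p, ?_, rfl⟩
  rw [add_comm]
  exact hf.mul hp

theorem IsHomogeneousIdeal.sup_span {I : Ideal (MvPolynomial ι K)} (hI : IsHomogeneousIdeal I)
    {l : MvPolynomial ι K} {k : ℕ} (hl : l.IsHomogeneous k) :
    IsHomogeneousIdeal (I ⊔ Ideal.span {l}) := by
  intro f hf n
  obtain ⟨g, hg, h, hh, rfl⟩ := Submodule.mem_sup.1 hf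
  obtain ⟨c, rfl⟩ := Ideal.mem_span_singleton.1 hh
  rw [map_add, homogeneousComponent_isHomogeneous_mul hl]
  refine add_mem (Ideal.mem_sup_left (hI g hg n)) (Ideal.mem_sup_right ?_)
  split_ifs
  · exact Ideal.mul_mem_right _ _ (Ideal.mem_span_singleton_self l)
  · exact zero_mem _

/-- The sequence `0 → (S/I)(-1) → S/I → S/(I + (l)) → 0`, with `l` a nonzerodivisor on `S/I`. -/
theorem isGradedExact_mul {I : Ideal (MvPolynomial ι K)} (hI : IsHomogeneousIdeal I)
    {l : MvPolynomial ι K} (hl : l.IsHomogeneous 1) (hreg : ∀ f, l * f ∈ I → f ∈ I) :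
    IsGradedExact (structureGrading I) (structureGrading I)
      (structureGrading (I ⊔ Ideal.span {l})) 1
      (LinearMap.lsmul (MvPolynomial ι K) (MvPolynomial ι K ⧸ I) l)
      (Submodule.factor (le_sup_left : I ≤ I ⊔ Ideal.span {l})) where
  graded' := isGraded_structureGrading _
  graded := isGraded_structureGrading _
  graded'' := isGraded_structureGrading _
  injective := by
    rw [injective_iff_map_eq_zero]
    intro x hx
    obtain ⟨p, rfl⟩ := Ideal.Quotient.mk_surjective x
    have hx : Ideal.Quotient.mk I (l * p) = 0 := hx
    rw [Ideal.Quotient.eq_zero_iff_mem] at hx ⊢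
    exact hreg _ hx
  map_mem := by
    rintro n m hm
    exact isGraded_structureGrading I 1 n l m hl hm
  map_mem' := by
    rintro n _ ⟨p, hp, rfl⟩
    exact ⟨p, hp, rfl⟩
  comp := by
    intro x
    obtain ⟨p, rfl⟩ := Ideal.Quotient.mk_surjective x
    have : Ideal.Quotient.mk (I ⊔ Ideal.span {l}) (l * p) = 0 := by
      rw [Ideal.Quotient.eq_zero_iff_mem]
      exact Ideal.mem_sup_right (Ideal.mul_mem_right _ _ (Ideal.mem_span_singleton_self l))
    exact this
  exact := by
    rintro n _ ⟨p, hp, rfl⟩ h0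
    have hp : p.IsHomogeneous n := hp
    have h0 : Ideal.Quotient.mk (I ⊔ Ideal.span {l}) p = 0 := h0
    rw [Ideal.Quotient.eq_zero_iff_mem] at h0
    obtain ⟨g, hg, h, hh, rfl⟩ := Submodule.mem_sup.1 h0
    obtain ⟨c, rfl⟩ := Ideal.mem_span_singleton.1 hh
    have e := congrArg (homogeneousComponent n) (rfl : g + l * c = g + l * c)
    nth_rw 1 [homogeneousComponent_eq_self hp, map_add,
      homogeneousComponent_isHomogeneous_mul hl] at e
    have hmk : Ideal.Quotient.mk I (homogeneousComponent n g) = 0 :=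
      Ideal.Quotient.eq_zero_iff_mem.2 (hI g hg n)
    split_ifs at e with hn
    · right
      refine ⟨n - 1, Ideal.Quotient.mk I (homogeneousComponent (n - 1) c),
        ⟨_, homogeneousComponent_isHomogeneous _ _, rfl⟩, Nat.sub_add_cancel hn, ?_⟩
      change Ideal.Quotient.mk I (l * homogeneousComponent (n - 1) c) =
        Ideal.Quotient.mk I (g + l * c)
      rw [e, map_add, hmk, zero_add]
    -- In degree `0` the multiple `l * c` has no component, so the element is already zero in `S/I`.
    -- This is the reason for the alternative `m = 0` in `IsGradedExact`.
    · left
      change Ideal.Quotient.mk I (g + l * c) = 0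
      rw [e, add_zero, hmk]
  surjective := by
    rintro n _ ⟨p, hp, rfl⟩
    exact ⟨Ideal.Quotient.mk I p, ⟨p, hp, rfl⟩, rfl⟩

theorem X_mem_monomials {r : ℕ} (a : Fin r → ι) (j : Fin r) :
    (X (a j) : MvPolynomial ι K) ∈ monomials a :=
  Submonoid.subset_closure (Set.mem_range_self j)

/-- The linear forms in the list form a regular sequence for `S / I`, and the quotient of `S / I`
by these linear forms is of degree `≤ e` and not `< e`. -/
def IsLinearSystem (e : ℕ) : List (MvPolynomial ι K) → Ideal (MvPolynomial ι K) → Prop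
  | [], I => (∀ n, e < n → ∀ p : MvPolynomial ι K, p.IsHomogeneous n → p ∈ I) ∧
      ∃ p : MvPolynomial ι K, p.IsHomogeneous e ∧ p ∉ I
  | l :: ls, I => l.IsHomogeneous 1 ∧ (∀ f, l * f ∈ I → f ∈ I) ∧
      IsLinearSystem e ls (I ⊔ Ideal.span {l})

/-- By the vanishing for `S/(I + (l))`, multiplication by `l` is injective on `Hⁱ(S/I)` in all
degrees `≥ d`. But every class is killed by a power of `l`. -/
theorem Acyclic.of_linearForm [Finite ι] {I : Ideal (MvPolynomial ι K)} (hI : IsHomogeneousIdeal I)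
    {l : MvPolynomial ι K} (hl : l.IsHomogeneous 1) (hreg : ∀ f, l * f ∈ I → f ∈ I)
    {i : ℕ} {d : ℤ} (h : ∀ j, i = j + 1 → ∀ d' > d,
      Acyclic K ι (structureGrading (I ⊔ Ideal.span {l})) d' j) :
    Acyclic K ι (structureGrading I) d i := by
  intro z hz hz'
  have hex := isGradedExact_mul hI hl hreg
  obtain ⟨k, hk⟩ := pow_smul_mem_augBoundaries hex.graded hz hz' hl
  have hlmap : ∀ y : AugCochains K ι (MvPolynomial ι K ⧸ I) i,
      mapCochain (LinearMap.lsmul (MvPolynomial ι K) (MvPolynomial ι K ⧸ I) l) i y = l • y := by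
    intro y
    funext a
    rw [mapCochain_apply, Pi.smul_apply]
    induction y a using LocalizedModule.induction_on with
    | h m s =>
      rw [locMap_mk, LocalizedModule.smul'_mk]
      rfl
  induction k with
  | zero => simpa using hk
  | succ k ih =>
    apply ih
    rw [pow_succ', mul_smul, ← hlmap] at hk
    cases i with
    | zero =>
      rw [augBoundaries, AddSubgroup.mem_bot] at hk ⊢
      exact mapCochain_injective hex.injective 0 (by rw [hk, map_zero])
    | succ i =>
      refine hex.mem_augBoundaries_of_mapCochain (h i rfl _ ?_) ?_
      · omega
      · push_cast at hk
        rwa [add_assoc]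

/-- Induction on the length `r`: adding a form raises the only cohomological index with nonzero
cohomology by one and lowers the top degree by one, starting from `S/I` of finite length, whose `H⁰`
is `S/I` itself. -/
theorem IsLinearSystem.acyclic [Finite ι] {e : ℕ} {ls : List (MvPolynomial ι K)}
    {I : Ideal (MvPolynomial ι K)} (hI : IsHomogeneousIdeal I) (h : IsLinearSystem e ls I)
    {i : ℕ} {d : ℤ} (hid : i ≠ ls.length ∨ (e : ℤ) - ls.length < d) :
    Acyclic K ι (structureGrading I) d i := by
  induction ls generalizing I i d with
  | nil =>
    obtain ⟨h, -⟩ := h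
    have hz0 : ∀ {r : ℕ} {a : Fin r → ι}
        {z : LocalizedModule (monomials (K := K) a) (MvPolynomial ι K ⧸ I)},
        z ∈ twistedSections (structureGrading I) d a → r ≠ 0 ∨ (e : ℤ) < d → z = 0 := by
      intro r a z hz hd
      obtain h0 | ⟨n, k, m, s, ⟨p, hp, rfl⟩, hs, hd', rfl⟩ :=
        mem_twistedSections (isGraded_structureGrading I) hz
      · exact h0
      have hp : p.IsHomogeneous n := hp
      -- If some variable is inverted, its power of exponent `e + 1` moves the numerator beyond
      -- degree `e`; otherwise `d > e` and the numerator itself has degree `> e`.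
      have hkill : ∃ t : monomials (K := K) a, ∃ k', t.1.IsHomogeneous k' ∧ e < k' + n := by
        obtain hr | hd := hd
        · have _ : NeZero r := ⟨hr⟩
          refine ⟨⟨X (a 0) ^ (e + 1), pow_mem (X_mem_monomials _ _) _⟩, e + 1,
            isHomogeneous_X_pow _ _, by omega⟩
        · exact ⟨1, 0, isHomogeneous_one _ _, by omega⟩
      obtain ⟨t, k', ht, hk'⟩ := hkill
      rw [mk_eq_zero_iff]
      exact ⟨t, (Ideal.Quotient.eq_zero_iff_mem (I := I)).2 (h _ hk' _ (ht.mul hp))⟩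
    intro z hz _
    rw [mem_augSections] at hz
    have : z = 0 := funext fun a => hz0 (hz a) (by simpa using hid)
    rw [this]
    exact zero_mem _
  | cons l ls ih =>
    obtain ⟨hl, hreg, h⟩ := h
    refine Acyclic.of_linearForm hI hl hreg ?_
    rintro j rfl d' hd'
    refine ih (hI.sup_span hl) h ?_
    simp only [List.length_cons, ne_eq, add_left_inj] at hid
    obtain hid | hid := hid
    · exact Or.inl hid
    · right
      push_cast at hid
      omega

/-- A nonzero element of top degree `e` survives in `H⁰` at the end of the sequence, and each
connecting map `Hⁱ(S/(I + (l))) → Hⁱ⁺¹(S/I)` is injective at the critical index, because `Hⁱ(S/I)`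
vanishes there. -/
theorem IsLinearSystem.not_acyclic [Finite ι] {e : ℕ} {ls : List (MvPolynomial ι K)}
    {I : Ideal (MvPolynomial ι K)} (hI : IsHomogeneousIdeal I) (h : IsLinearSystem e ls I) :
    ¬ Acyclic K ι (structureGrading I) ((e : ℤ) - ls.length) ls.length := by
  induction ls generalizing I with
  | nil =>
    obtain ⟨h, p, hp, hpI⟩ := h
    intro hac
    -- The constant cochain `p` is a cocycle, since `p` dies in every localization at a variable.
    have hac := hac (fun a => LocalizedModule.mk (Ideal.Quotient.mk I p) 1) ?_ ?_
    · have h0 := congrFun (AddSubgroup.mem_bot.1 hac) Fin.elim0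
      simp only [Pi.zero_apply] at h0
      rw [mk_eq_zero_iff] at h0
      obtain ⟨⟨u, hu⟩, h0⟩ := h0
      have hu1 : u = 1 := by
        simpa [monomials] using hu
      subst hu1
      rw [one_smul, Ideal.Quotient.eq_zero_iff_mem] at h0
      exact hpI h0
    · rw [mem_augSections]
      exact fun a => mk_mem_twistedSections (n := e) (e := 0) ⟨p, hp, rfl⟩
        (isHomogeneous_one _ _) (by simp)
    · funext b
      change augDiff 0 _ b = 0
      rw [augDiff_apply, Fin.sum_univ_one, Fin.val_zero, pow_zero, one_smul, restrict, liftOfLE_mk,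
        mk_eq_zero_iff]
      refine ⟨⟨X (b 0) ^ (e + 1), pow_mem (X_mem_monomials _ _) _⟩, ?_⟩
      refine Ideal.Quotient.eq_zero_iff_mem.2 (h (e + 1 + e) (by omega) _ ?_)
      exact (isHomogeneous_X_pow _ _).mul hp
  | cons l ls ih =>
    obtain ⟨hl, hreg, h⟩ := h
    intro hac
    have hex := isGradedExact_mul hI hl hreg
    refine ih (hI.sup_span hl) h ?_
    have e1 : (e : ℤ) - ls.length = (e : ℤ) - (l :: ls).length + (1 : ℕ) := by
      push_cast [List.length_cons]
      ring
    rw [e1]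
    refine hex.acyclic_right ?_ hac
    refine IsLinearSystem.acyclic hI (ls := l :: ls) ⟨hl, hreg, h⟩ (Or.inl ?_)
    simp

/-- For `r ≥ 1` multiplication by the first form `l` is surjective on `Hʳ(S/I)`, as `Hʳ(S/(I + (l)))
= 0`. So vanishing in degree `d` would propagate upwards to degree `e - r`. -/
theorem IsLinearSystem.not_acyclic_of_le [Finite ι] {e : ℕ} {ls : List (MvPolynomial ι K)}
    {I : Ideal (MvPolynomial ι K)} (hI : IsHomogeneousIdeal I) (h : IsLinearSystem e ls I)
    (hls : ls ≠ []) {d : ℤ} (hd : d ≤ (e : ℤ) - ls.length) :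
    ¬ Acyclic K ι (structureGrading I) d ls.length := by
  obtain ⟨k, hk⟩ := Int.le.dest hd
  induction k generalizing d with
  | zero =>
    rw [Nat.cast_zero, add_zero] at hk
    rw [hk]
    exact h.not_acyclic hI
  | succ k ih =>
    intro hac
    refine ih (d := d + 1) (by push_cast at hk; omega) (by push_cast at hk; omega) ?_
    obtain _ | ⟨l, ls⟩ := ls
    · exact absurd rfl hls
    obtain ⟨hl, hreg, h⟩ := h
    refine (isGradedExact_mul hI hl hreg).acyclic_middle hac ?_
    exact h.acyclic (hI.sup_span hl) (Or.inl (by simp))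

end Quotients

/-! ### Regularity of the structure sheaf and of the ideal sheaf -/

section Regularity

variable {K ι : Type*} [Field K]

open MvPolynomial

theorem span_X_image_sup (s : Set ι) (a : ι) :
    Ideal.span (X '' s : Set (MvPolynomial ι K)) ⊔ Ideal.span {X a} =
      Ideal.span (X '' insert a s) := by
  rw [← Ideal.span_union, Set.union_singleton, Set.image_insert_eq]

theorem mem_span_X_image_of_X_mul_mem {s : Set ι} {a : ι} (ha : a ∉ s) {f : MvPolynomial ι K}
    (hf : X a * f ∈ Ideal.span (X '' s : Set (MvPolynomial ι K))) :
    f ∈ Ideal.span (X '' s : Set (MvPolynomial ι K)) := by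
  rw [mem_ideal_span_X_image] at hf ⊢
  intro m hm
  obtain ⟨i, hi, him⟩ := hf (Finsupp.single a 1 + m) (by
    rw [mem_support_iff, coeff_X_mul]
    exact mem_support_iff.1 hm)
  refine ⟨i, hi, ?_⟩
  have hia : a ≠ i := fun h => ha (h ▸ hi)
  simpa [Finsupp.single_eq_of_ne hia.symm] using him

/-- With `s` empty this is the regular sequence of all variables, which yields the cohomology of `S`
as a special case of the preceding theory. -/
theorem isLinearSystem_X {ls : List ι} (hls : ls.Nodup) {s : Set ι} (hs : ∀ a ∈ ls, a ∉ s)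
    (hs' : ∀ a, a ∈ s ∨ a ∈ ls) :
    IsLinearSystem 0 (ls.map X) (Ideal.span (X '' s : Set (MvPolynomial ι K))) := by
  induction ls generalizing s with
  | nil =>
    refine ⟨fun n hn p hp => ?_, 1, isHomogeneous_one _ _, fun h => ?_⟩
    · rw [mem_ideal_span_X_image]
      intro m hm
      by_contra! h
      have hm0 : m = 0 := by
        ext i
        exact h i (by simpa using hs' i)
      have := hp (mem_support_iff.1 hm)
      simp [hm0] at this
      omega
    · rw [mem_ideal_span_X_image] at h
      obtain ⟨i, -, hi⟩ := h 0 (by simp)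
      exact hi rfl
  | cons a ls ih =>
    rw [List.nodup_cons] at hls
    refine ⟨isHomogeneous_X _ _, fun f => mem_span_X_image_of_X_mul_mem (hs a (by simp)), ?_⟩
    rw [span_X_image_sup]
    refine ih hls.2 (fun b hb => ?_) (fun b => ?_)
    · rw [Set.mem_insert_iff, not_or]
      exact ⟨fun h => hls.1 (h ▸ hb), hs b (by simp [hb])⟩
    · have := hs' b
      rw [List.mem_cons] at this
      rw [Set.mem_insert_iff]
      tauto

theorem isHomogeneousIdeal_bot : IsHomogeneousIdeal (⊥ : Ideal (MvPolynomial ι K)) := by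
  intro f hf n
  rw [Ideal.mem_bot] at hf ⊢
  rw [hf, map_zero]

theorem isGradedExact_ideal (I : Ideal (MvPolynomial ι K)) :
    IsGradedExact (idealGrading I) (structureGrading (⊥ : Ideal (MvPolynomial ι K)))
      (structureGrading I) 0 (Submodule.mkQ ⊥ ∘ₗ Submodule.subtype I)
      (Submodule.factor (bot_le : ⊥ ≤ I)) where
  graded' := by
    rintro e n f ⟨m, hm⟩ hf hmn
    have hmn : m.IsHomogeneous n := hmn
    have : (f * m).IsHomogeneous (n + e) := by
      rw [add_comm]
      exact hf.mul hmn
    exact this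
  graded := isGraded_structureGrading _
  graded'' := isGraded_structureGrading _
  injective := by
    rw [injective_iff_map_eq_zero]
    rintro ⟨p, hp⟩ h0
    have h0 : Ideal.Quotient.mk ⊥ p = 0 := h0
    rw [Ideal.Quotient.eq_zero_iff_mem, Ideal.mem_bot] at h0
    exact Subtype.ext h0
  map_mem := by
    rintro n ⟨p, hp⟩ hpn
    exact ⟨p, hpn, rfl⟩
  map_mem' := by
    rintro n _ ⟨p, hp, rfl⟩
    exact ⟨p, hp, rfl⟩
  comp := by
    rintro ⟨p, hp⟩
    exact Ideal.Quotient.eq_zero_iff_mem.2 hp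
  exact := by
    rintro n _ ⟨p, hp, rfl⟩ h0
    have h0 : Ideal.Quotient.mk I p = 0 := h0
    rw [Ideal.Quotient.eq_zero_iff_mem] at h0
    exact Or.inr ⟨n, ⟨p, h0⟩, hp, rfl, rfl⟩
  surjective := by
    rintro n _ ⟨p, hp, rfl⟩
    exact ⟨Ideal.Quotient.mk ⊥ p, ⟨p, hp, rfl⟩, rfl⟩

variable [Fintype ι]

theorem acyclic_bot {i : ℕ} {d : ℤ}
    (hid : i ≠ Fintype.card ι ∨ -(Fintype.card ι : ℤ) < d) :
    Acyclic K ι (structureGrading (⊥ : Ideal (MvPolynomial ι K))) d i := by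
  have h := isLinearSystem_X (K := K) (Finset.univ : Finset ι).nodup_toList (s := ∅) (by simp)
    (by simp)
  rw [Set.image_empty, Ideal.span_empty] at h
  refine h.acyclic isHomogeneousIdeal_bot ?_
  simpa using hid

/-- Only `Hʳ` of `S/I` is nonzero, i.e. `Hʳ⁻¹` of the sheaf, with top degree `e - r = (e - 1) - (r -
1)`. The condition `r ≥ 2` makes `r - 1` a positive index, which regularity takes into account. -/
theorem IsLinearSystem.hasRegularity {e : ℕ} {ls : List (MvPolynomial ι K)}
    {I : Ideal (MvPolynomial ι K)} (hI : IsHomogeneousIdeal I) (h : IsLinearSystem e ls I)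
    (hls : 2 ≤ ls.length) : HasRegularity K ι (structureGrading I) e := by
  have hne : ls ≠ [] := by
    rintro rfl
    simp at hls
  refine ⟨?_, fun m hm => ?_⟩
  · rw [Set.mem_ofPred_eq, isRegular_iff]
    intro p hp
    refine h.acyclic hI ?_
    by_cases hpk : p + 1 = ls.length
    · right
      rw [← hpk]
      push_cast
      omega
    · exact Or.inl hpk
  · rw [Set.mem_ofPred_eq, isRegular_iff] at hm
    by_contra! hlt
    have := hm (ls.length - 1) (by omega)
    rw [Nat.sub_add_cancel (by omega)] at this
    refine h.not_acyclic_of_le hI hne ?_ this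
    push_cast [Nat.cast_sub (by omega : 1 ≤ ls.length)]
    omega

/-- In `0 → I → S → S/I → 0` the cohomology of `S` sits only in index `card ι > r`, and too low to
matter for the upper bound. So `Hʳ(S/I)` reappears in `Hʳ⁺¹(I)`, which shifts the regularity by one.
-/
theorem IsLinearSystem.hasRegularity_ideal {e : ℕ} {ls : List (MvPolynomial ι K)}
    {I : Ideal (MvPolynomial ι K)} (hI : IsHomogeneousIdeal I) (h : IsLinearSystem e ls I)
    (hls : 1 ≤ ls.length) (hls' : ls.length < Fintype.card ι) :
    HasRegularity K ι (idealGrading I) (e + 1) := by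
  have hne : ls ≠ [] := by
    rintro rfl
    simp at hls
  have hex := isGradedExact_ideal I
  refine ⟨?_, fun m hm => ?_⟩
  · rw [Set.mem_ofPred_eq, isRegular_iff]
    intro p hp
    refine hex.acyclic_left (h.acyclic hI ?_) (acyclic_bot ?_)
    · by_cases hpk : p = ls.length
      · right
        rw [← hpk]
        push_cast
        omega
      · exact Or.inl hpk
    · by_cases hpk : p + 1 = Fintype.card ι
      · right
        rw [← hpk]
        push_cast
        omega
      · exact Or.inl hpk
  · rw [Set.mem_ofPred_eq, isRegular_iff] at hm
    by_contra! hlt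
    have := hex.acyclic_right (i := ls.length) (acyclic_bot (Or.inl hls'.ne)) (hm _ (by omega))
    refine h.not_acyclic_of_le hI hne ?_ this
    push_cast
    omega

end Regularity

/-! ### The invariants over commutative rings, in an explicit order -/

section Universal

variable {R : Type*} [CommRing R]

/-- The invariants of `x` over a commutative ring: the minor that is formed by the rows in `S`. -/
def cminor (x : Matrix (Fin 6) (Fin 3) R) (S : Finset (Fin 6)) : R :=
  if h : S.card = 3 then (x.submatrix (S.orderEmbOfFin h) id).det else 0

/-- The six quadratic monomials over a commutative ring. -/
def cmonomials (v : Fin 3 → R) : Fin 6 → R :=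
  ![v 0 ^ 2, v 1 ^ 2, v 2 ^ 2, v 0 * v 1, v 0 * v 2, v 1 * v 2]

/-- The invariant `d₂` over a commutative ring. -/
def cconic (x : Matrix (Fin 6) (Fin 3) R) : R :=
  (Matrix.of fun i => cmonomials (x i)).det

/-- The minor that is formed by three rows, in increasing order. -/
def rowMinor (x : Matrix (Fin 6) (Fin 3) R) (i j k : Fin 6) : R := cminor x {i, j, k}

/-- The invariant `(i₁i₂i₃)(i₄i₅i₆)`. -/
def tval (x : Matrix (Fin 6) (Fin 3) R) (a b c d e f : Fin 6) : R :=
  rowMinor x a b c * rowMinor x d e f * cconic x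

/-- The invariant `(i₁i₂)(i₃i₄)(i₅i₆)`. -/
def pval (x : Matrix (Fin 6) (Fin 3) R) (a b c d e f : Fin 6) : R :=
  rowMinor x a c d * rowMinor x b c d * rowMinor x c e f * rowMinor x d e f *
    rowMinor x e a b * rowMinor x f a b

/-- The forty invariants over a commutative ring. -/
def cgamma (x : Matrix (Fin 6) (Fin 3) R) : Symbols → R
  | .inl s => tval x (s.1 0) (s.1 1) (s.1 2) (s.1 3) (s.1 4) (s.1 5)
  | .inr s => pval x (s.1 0) (s.1 1) (s.1 2) (s.1 3) (s.1 4) (s.1 5)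

theorem cgamma_eq_gamma {L : Type*} [Field L] (x : Matrix (Fin 6) (Fin 3) L) :
    cgamma x = gamma x := by
  funext s
  cases s <;> rfl

/-- The forty invariants in lexicographical order. -/
def gammaList (x : Matrix (Fin 6) (Fin 3) R) : Fin 40 → R :=
  ![tval x 0 1 2 3 4 5, tval x 0 1 3 2 4 5, tval x 0 1 4 2 3 5, tval x 0 1 5 2 3 4,
    tval x 0 2 3 1 4 5, tval x 0 2 4 1 3 5, tval x 0 2 5 1 3 4, tval x 0 3 4 1 2 5,
    tval x 0 3 5 1 2 4, tval x 0 4 5 1 2 3, pval x 0 1 2 3 4 5, pval x 0 1 2 4 3 5,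
    pval x 0 1 2 5 3 4, pval x 0 1 3 4 2 5, pval x 0 1 3 5 2 4, pval x 0 1 4 5 2 3,
    pval x 0 2 1 3 4 5, pval x 0 2 1 4 3 5, pval x 0 2 1 5 3 4, pval x 0 2 3 4 1 5,
    pval x 0 2 3 5 1 4, pval x 0 2 4 5 1 3, pval x 0 3 1 2 4 5, pval x 0 3 1 4 2 5,
    pval x 0 3 1 5 2 4, pval x 0 3 2 4 1 5, pval x 0 3 2 5 1 4, pval x 0 3 4 5 1 2,
    pval x 0 4 1 2 3 5, pval x 0 4 1 3 2 5, pval x 0 4 1 5 2 3, pval x 0 4 2 3 1 5,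
    pval x 0 4 2 5 1 3, pval x 0 4 3 5 1 2, pval x 0 5 1 2 3 4, pval x 0 5 1 3 2 4,
    pval x 0 5 1 4 2 3, pval x 0 5 2 3 1 4, pval x 0 5 2 4 1 3, pval x 0 5 3 4 1 2]

/-- The inequality orients the rule: together with the next lemma it lets `simp` sort the indices of
every minor. -/
theorem rowMinor_swap_left (x : Matrix (Fin 6) (Fin 3) R) {i j k : Fin 6} (_h : j < i) :
    rowMinor x i j k = rowMinor x j i k := by
  rw [rowMinor, rowMinor, Finset.insert_comm]

theorem rowMinor_swap_right (x : Matrix (Fin 6) (Fin 3) R) {i j k : Fin 6} (_h : k < j) :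
    rowMinor x i j k = rowMinor x i k j := by
  rw [rowMinor, rowMinor, Finset.pair_comm]

theorem rowMinor_of_lt (x : Matrix (Fin 6) (Fin 3) R) {i j k : Fin 6} (h : i < j) (h' : j < k) :
    rowMinor x i j k = (x.submatrix ![i, j, k] id).det := by
  have hc : ({i, j, k} : Finset (Fin 6)).card = 3 :=
    Finset.card_eq_three.2 ⟨i, j, k, h.ne, (h.trans h').ne, h'.ne, rfl⟩
  rw [rowMinor, cminor, dif_pos hc]
  congr 2
  symm
  apply Finset.orderEmbOfFin_unique
  · intro l
    fin_cases l <;> simp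
  · rw [Fin.strictMono_iff_lt_succ]
    intro l
    fin_cases l
    · exact h
    · exact h'

theorem exists_cgamma_inl (s : TripleSymbol) : ∃ n : Fin 40,
    ∀ x : Matrix (Fin 6) (Fin 3) R, cgamma x (.inl s) = gammaList x n := by
  obtain ⟨s, h0, h1, h2, h3⟩ := s
  have key : ∀ b c : Fin 6, b < c → ∀ d e, d < e → ∀ f, e < f →
      [0, b, c, d, e, f].Nodup → (b, c, d, e, f) ∈
        [(1, 2, 3, 4, 5), (1, 3, 2, 4, 5), (1, 4, 2, 3, 5),
        (1, 5, 2, 3, 4), (2, 3, 1, 4, 5), (2, 4, 1, 3, 5),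
        (2, 5, 1, 3, 4), (3, 4, 1, 2, 5), (3, 5, 1, 2, 4),
        (4, 5, 1, 2, 3)] := by
    decide
  have h := key (s 1) (s 2) h1 (s 3) (s 4) h2 (s 5) h3 (by
    rw [← h0]
    simp [s.injective.eq_iff])
  simp only [List.mem_cons, Prod.mk.injEq, List.not_mem_nil, or_false] at h
  obtain ⟨h1, h2, h3, h4, h5⟩ | ⟨h1, h2, h3, h4, h5⟩ |
    ⟨h1, h2, h3, h4, h5⟩ | ⟨h1, h2, h3, h4, h5⟩ |
    ⟨h1, h2, h3, h4, h5⟩ | ⟨h1, h2, h3, h4, h5⟩ |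
    ⟨h1, h2, h3, h4, h5⟩ | ⟨h1, h2, h3, h4, h5⟩ |
    ⟨h1, h2, h3, h4, h5⟩ | ⟨h1, h2, h3, h4, h5⟩ := h
  · exact ⟨0, fun x => by simp only [cgamma, h0, h1, h2, h3, h4, h5]; rfl⟩
  · exact ⟨1, fun x => by simp only [cgamma, h0, h1, h2, h3, h4, h5]; rfl⟩
  · exact ⟨2, fun x => by simp only [cgamma, h0, h1, h2, h3, h4, h5]; rfl⟩
  · exact ⟨3, fun x => by simp only [cgamma, h0, h1, h2, h3, h4, h5]; rfl⟩
  · exact ⟨4, fun x => by simp only [cgamma, h0, h1, h2, h3, h4, h5]; rfl⟩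
  · exact ⟨5, fun x => by simp only [cgamma, h0, h1, h2, h3, h4, h5]; rfl⟩
  · exact ⟨6, fun x => by simp only [cgamma, h0, h1, h2, h3, h4, h5]; rfl⟩
  · exact ⟨7, fun x => by simp only [cgamma, h0, h1, h2, h3, h4, h5]; rfl⟩
  · exact ⟨8, fun x => by simp only [cgamma, h0, h1, h2, h3, h4, h5]; rfl⟩
  · exact ⟨9, fun x => by simp only [cgamma, h0, h1, h2, h3, h4, h5]; rfl⟩

theorem exists_cgamma_inr (s : PairSymbol) : ∃ n : Fin 40,
    ∀ x : Matrix (Fin 6) (Fin 3) R, cgamma x (.inr s) = gammaList x n := by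
  obtain ⟨s, h0, h1, h2⟩ := s
  have key : ∀ c d : Fin 6, c < d → ∀ e f, e < f → ∀ b,
      [0, b, c, d, e, f].Nodup → (b, c, d, e, f) ∈
        [(1, 2, 3, 4, 5), (1, 2, 4, 3, 5), (1, 2, 5, 3, 4),
        (1, 3, 4, 2, 5), (1, 3, 5, 2, 4), (1, 4, 5, 2, 3),
        (2, 1, 3, 4, 5), (2, 1, 4, 3, 5), (2, 1, 5, 3, 4),
        (2, 3, 4, 1, 5), (2, 3, 5, 1, 4), (2, 4, 5, 1, 3),
        (3, 1, 2, 4, 5), (3, 1, 4, 2, 5), (3, 1, 5, 2, 4),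
        (3, 2, 4, 1, 5), (3, 2, 5, 1, 4), (3, 4, 5, 1, 2),
        (4, 1, 2, 3, 5), (4, 1, 3, 2, 5), (4, 1, 5, 2, 3),
        (4, 2, 3, 1, 5), (4, 2, 5, 1, 3), (4, 3, 5, 1, 2),
        (5, 1, 2, 3, 4), (5, 1, 3, 2, 4), (5, 1, 4, 2, 3),
        (5, 2, 3, 1, 4), (5, 2, 4, 1, 3), (5, 3, 4, 1, 2)] := by
    decide
  have h := key (s 2) (s 3) h1 (s 4) (s 5) h2 (s 1) (by
    rw [← h0]
    simp [s.injective.eq_iff])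
  simp only [List.mem_cons, Prod.mk.injEq, List.not_mem_nil, or_false] at h
  obtain ⟨h1, h2, h3, h4, h5⟩ | ⟨h1, h2, h3, h4, h5⟩ |
    ⟨h1, h2, h3, h4, h5⟩ | ⟨h1, h2, h3, h4, h5⟩ |
    ⟨h1, h2, h3, h4, h5⟩ | ⟨h1, h2, h3, h4, h5⟩ |
    ⟨h1, h2, h3, h4, h5⟩ | ⟨h1, h2, h3, h4, h5⟩ |
    ⟨h1, h2, h3, h4, h5⟩ | ⟨h1, h2, h3, h4, h5⟩ |
    ⟨h1, h2, h3, h4, h5⟩ | ⟨h1, h2, h3, h4, h5⟩ |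
    ⟨h1, h2, h3, h4, h5⟩ | ⟨h1, h2, h3, h4, h5⟩ |
    ⟨h1, h2, h3, h4, h5⟩ | ⟨h1, h2, h3, h4, h5⟩ |
    ⟨h1, h2, h3, h4, h5⟩ | ⟨h1, h2, h3, h4, h5⟩ |
    ⟨h1, h2, h3, h4, h5⟩ | ⟨h1, h2, h3, h4, h5⟩ |
    ⟨h1, h2, h3, h4, h5⟩ | ⟨h1, h2, h3, h4, h5⟩ |
    ⟨h1, h2, h3, h4, h5⟩ | ⟨h1, h2, h3, h4, h5⟩ |
    ⟨h1, h2, h3, h4, h5⟩ | ⟨h1, h2, h3, h4, h5⟩ |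
    ⟨h1, h2, h3, h4, h5⟩ | ⟨h1, h2, h3, h4, h5⟩ |
    ⟨h1, h2, h3, h4, h5⟩ | ⟨h1, h2, h3, h4, h5⟩ := h
  · exact ⟨10, fun x => by simp only [cgamma, h0, h1, h2, h3, h4, h5]; rfl⟩
  · exact ⟨11, fun x => by simp only [cgamma, h0, h1, h2, h3, h4, h5]; rfl⟩
  · exact ⟨12, fun x => by simp only [cgamma, h0, h1, h2, h3, h4, h5]; rfl⟩
  · exact ⟨13, fun x => by simp only [cgamma, h0, h1, h2, h3, h4, h5]; rfl⟩
  · exact ⟨14, fun x => by simp only [cgamma, h0, h1, h2, h3, h4, h5]; rfl⟩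
  · exact ⟨15, fun x => by simp only [cgamma, h0, h1, h2, h3, h4, h5]; rfl⟩
  · exact ⟨16, fun x => by simp only [cgamma, h0, h1, h2, h3, h4, h5]; rfl⟩
  · exact ⟨17, fun x => by simp only [cgamma, h0, h1, h2, h3, h4, h5]; rfl⟩
  · exact ⟨18, fun x => by simp only [cgamma, h0, h1, h2, h3, h4, h5]; rfl⟩
  · exact ⟨19, fun x => by simp only [cgamma, h0, h1, h2, h3, h4, h5]; rfl⟩
  · exact ⟨20, fun x => by simp only [cgamma, h0, h1, h2, h3, h4, h5]; rfl⟩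
  · exact ⟨21, fun x => by simp only [cgamma, h0, h1, h2, h3, h4, h5]; rfl⟩
  · exact ⟨22, fun x => by simp only [cgamma, h0, h1, h2, h3, h4, h5]; rfl⟩
  · exact ⟨23, fun x => by simp only [cgamma, h0, h1, h2, h3, h4, h5]; rfl⟩
  · exact ⟨24, fun x => by simp only [cgamma, h0, h1, h2, h3, h4, h5]; rfl⟩
  · exact ⟨25, fun x => by simp only [cgamma, h0, h1, h2, h3, h4, h5]; rfl⟩
  · exact ⟨26, fun x => by simp only [cgamma, h0, h1, h2, h3, h4, h5]; rfl⟩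
  · exact ⟨27, fun x => by simp only [cgamma, h0, h1, h2, h3, h4, h5]; rfl⟩
  · exact ⟨28, fun x => by simp only [cgamma, h0, h1, h2, h3, h4, h5]; rfl⟩
  · exact ⟨29, fun x => by simp only [cgamma, h0, h1, h2, h3, h4, h5]; rfl⟩
  · exact ⟨30, fun x => by simp only [cgamma, h0, h1, h2, h3, h4, h5]; rfl⟩
  · exact ⟨31, fun x => by simp only [cgamma, h0, h1, h2, h3, h4, h5]; rfl⟩
  · exact ⟨32, fun x => by simp only [cgamma, h0, h1, h2, h3, h4, h5]; rfl⟩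
  · exact ⟨33, fun x => by simp only [cgamma, h0, h1, h2, h3, h4, h5]; rfl⟩
  · exact ⟨34, fun x => by simp only [cgamma, h0, h1, h2, h3, h4, h5]; rfl⟩
  · exact ⟨35, fun x => by simp only [cgamma, h0, h1, h2, h3, h4, h5]; rfl⟩
  · exact ⟨36, fun x => by simp only [cgamma, h0, h1, h2, h3, h4, h5]; rfl⟩
  · exact ⟨37, fun x => by simp only [cgamma, h0, h1, h2, h3, h4, h5]; rfl⟩
  · exact ⟨38, fun x => by simp only [cgamma, h0, h1, h2, h3, h4, h5]; rfl⟩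
  · exact ⟨39, fun x => by simp only [cgamma, h0, h1, h2, h3, h4, h5]; rfl⟩

theorem exists_tripleSymbol {a b c d e f : Fin 6} (h0 : a = 0) (h1 : b < c) (h2 : d < e)
    (h3 : e < f) (hi : Function.Injective ![a, b, c, d, e, f]) : ∃ s : Symbols,
    ∀ x : Matrix (Fin 6) (Fin 3) R, cgamma x s = tval x a b c d e f :=
  ⟨.inl ⟨Equiv.ofBijective _ (Finite.injective_iff_bijective.1 hi), h0, h1, h2, h3⟩, fun _ => rfl⟩

theorem exists_pairSymbol {a b c d e f : Fin 6} (h0 : a = 0) (h1 : c < d) (h2 : e < f)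
    (hi : Function.Injective ![a, b, c, d, e, f]) : ∃ s : Symbols,
    ∀ x : Matrix (Fin 6) (Fin 3) R, cgamma x s = pval x a b c d e f :=
  ⟨.inr ⟨Equiv.ofBijective _ (Finite.injective_iff_bijective.1 hi), h0, h1, h2⟩, fun _ => rfl⟩

/-- Together with `exists_gammaList` this identifies the set of values at the symbols with the
explicit list of forty. -/
theorem exists_symbol (n : Fin 40) : ∃ s : Symbols,
    ∀ x : Matrix (Fin 6) (Fin 3) R, cgamma x s = gammaList x n := by
  fin_cases n
  iterate 10
    · refine exists_tripleSymbol ?_ ?_ ?_ ?_ ?_ <;> decide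
  all_goals refine exists_pairSymbol ?_ ?_ ?_ ?_ <;> decide

theorem exists_gammaList (s : Symbols) : ∃ n : Fin 40,
    ∀ x : Matrix (Fin 6) (Fin 3) R, cgamma x s = gammaList x n := by
  cases s with
  | inl s => exact exists_cgamma_inl s
  | inr s => exact exists_cgamma_inr s

end Universal

/-! ### The invariants of a normalised sextuple and their linear relations -/

section Chart

variable {R : Type*} [CommRing R]

theorem det_submatrix_rows (x : Matrix (Fin 6) (Fin 3) R) (i j k : Fin 6) :
    (x.submatrix ![i, j, k] id).det =
      x i 0 * x j 1 * x k 2 - x i 0 * x j 2 * x k 1 - x i 1 * x j 0 * x k 2 +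
        x i 1 * x j 2 * x k 0 + x i 2 * x j 0 * x k 1 - x i 2 * x j 1 * x k 0 := by
  rw [Matrix.det_fin_three]
  rfl

/-- The sextuple that consists of the standard projective frame and of two further points. -/
def chart (v : Fin 6 → R) : Matrix (Fin 6) (Fin 3) R :=
  ![![1, 0, 0], ![0, 1, 0], ![0, 0, 1], ![1, 1, 1], ![v 0, v 1, v 2], ![v 3, v 4, v 5]]

/-- The minor of the last three rows of `chart v`. -/
def chartMinor (v : Fin 6 → R) : R :=
  v 1 * v 5 - v 2 * v 4 - (v 0 * v 5 - v 2 * v 3) + (v 0 * v 4 - v 1 * v 3)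

/-- The invariant `d₂` of the sextuple `chart v`. -/
def chartConic (v : Fin 6 → R) : R :=
  (v 0 * v 2 - v 0 * v 1) * (v 4 * v 5 - v 3 * v 4) -
    (v 1 * v 2 - v 0 * v 1) * (v 3 * v 5 - v 3 * v 4)

/-- Four generators of the ring of invariants that are products of minors, and a fifth one: together
they will form a system of parameters. -/
def params (g : Fin 40 → R) : Fin 5 → R :=
  ![g 6, g 15, g 24, g 33, g 0 + g 7 + g 20 - g 37]

/-- Five linear combinations that span, together with `params g`, all of the invariants. -/
def coords (g : Fin 40 → R) : Fin 5 → R :=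
  ![g 36 - g 12, -g 19 - g 35, g 36 + g 12, g 17 + g 32, -g 14 - g 31]

/-- The coefficients of the invariants with respect to `params`, multiplied by four. -/
def paramCoeff : Fin 40 → Fin 5 → ℤ :=
  ![![-2, 1, 2, 1, 1], ![-2, -3, 2, -3, 1], ![0, 0, 0, -4, 0], ![0, 4, 0, 0, 0],
    ![-2, -1, 2, -1, -1], ![0, 0, 4, 0, 0], ![4, 0, 0, 0, 0], ![2, -3, 2, 1, 1],
    ![2, -1, 2, 3, -1], ![-2, 3, 2, 3, -1], ![0, 0, 0, -4, 0], ![-2, 1, 2, -3, 1],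
    ![0, 0, 0, 0, 0], ![-2, -3, 2, 1, 1], ![0, 0, 0, 0, 0], ![0, 4, 0, 0, 0],
    ![-4, 0, 0, 0, 0], ![0, 0, 0, 0, 0], ![2, 1, 2, 1, 1], ![0, 0, 0, 0, 0],
    ![-2, 1, -2, 1, 1], ![0, 0, -4, 0, 0], ![-2, -3, -2, 1, 1], ![0, 0, 0, 4, 0],
    ![0, 0, 4, 0, 0], ![0, 4, 0, 0, 0], ![-4, 0, 0, 0, 0], ![-2, -1, -2, 3, -1],
    ![0, 0, -4, 0, 0], ![-2, 3, -2, 3, -1], ![-2, 3, 2, -1, -1], ![0, 0, 0, 0, 0],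
    ![0, 0, 0, 0, 0], ![0, 0, 0, 4, 0], ![0, 4, 0, 0, 0], ![0, 0, 0, 0, 0], ![0, 0, 0, 0, 0],
    ![-2, -1, 2, 3, -1], ![2, 3, 2, 3, -1], ![4, 0, 0, 0, 0]]

/-- The invariants modulo `params`, as linear forms in `coords`, multiplied by four. -/
def coordForm (y : Fin 5 → R) : Fin 40 → R :=
  ![y 0 + y 1 + y 2 - y 3 + y 4, y 0 + y 1 - y 2 + y 3 + y 4, 2 * y 3 + 2 * y 4,
    2 * y 2 + 2 * y 4, -y 0 + y 1 - y 2 + y 3 + y 4, 2 * y 1 + 2 * y 4, 0,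
    y 0 + y 1 - y 2 - y 3 - y 4, -y 0 + y 1 - y 2 - y 3 - y 4, -y 0 + y 1 + y 2 - y 3 + y 4,
    -2 * y 2 + 2 * y 3, -y 0 + y 1 + y 2 + y 3 + y 4, -2 * y 0 + 2 * y 2,
    -y 0 + y 1 + y 2 - y 3 - y 4, -2 * y 0 - 2 * y 4, 0, 2 * y 1 + 2 * y 3, -2 * y 0 + 2 * y 3,
    -y 0 - y 1 + y 2 - y 3 + y 4, -2 * y 0 - 2 * y 1, -y 0 - y 1 + y 2 + y 3 - y 4,
    2 * y 3 - 2 * y 4, y 0 + y 1 + y 2 + y 3 - y 4, 2 * y 2 - 2 * y 4, 0, -2 * y 1 + 2 * y 2,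
    2 * y 2 + 2 * y 3, -y 0 + y 1 + y 2 + y 3 - y 4, -2 * y 1 + 2 * y 3,
    y 0 - y 1 + y 2 + y 3 - y 4, y 0 + y 1 + y 2 + y 3 + y 4, 2 * y 0 - 2 * y 4,
    2 * y 0 + 2 * y 3, 0, -2 * y 1 + 2 * y 4, 2 * y 0 - 2 * y 1, 2 * y 0 + 2 * y 2,
    y 0 + y 1 + y 2 - y 3 - y 4, y 0 - y 1 + y 2 - y 3 + y 4, -2 * y 1 - 2 * y 2]

variable (v : Fin 6 → R)

theorem rowMinor_chart_012 : rowMinor (chart v) 0 1 2 = 1 := by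
  rw [rowMinor_of_lt _ (by decide) (by decide), det_submatrix_rows]
  simp [chart]

theorem rowMinor_chart_013 : rowMinor (chart v) 0 1 3 = 1 := by
  rw [rowMinor_of_lt _ (by decide) (by decide), det_submatrix_rows]
  simp [chart]

theorem rowMinor_chart_014 : rowMinor (chart v) 0 1 4 = v 2 := by
  rw [rowMinor_of_lt _ (by decide) (by decide), det_submatrix_rows]
  simp [chart]

theorem rowMinor_chart_015 : rowMinor (chart v) 0 1 5 = v 5 := by
  rw [rowMinor_of_lt _ (by decide) (by decide), det_submatrix_rows]
  simp [chart]

theorem rowMinor_chart_023 : rowMinor (chart v) 0 2 3 = -1 := by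
  rw [rowMinor_of_lt _ (by decide) (by decide), det_submatrix_rows]
  simp [chart]

theorem rowMinor_chart_024 : rowMinor (chart v) 0 2 4 = -v 1 := by
  rw [rowMinor_of_lt _ (by decide) (by decide), det_submatrix_rows]
  simp [chart]

theorem rowMinor_chart_025 : rowMinor (chart v) 0 2 5 = -v 4 := by
  rw [rowMinor_of_lt _ (by decide) (by decide), det_submatrix_rows]
  simp [chart]

theorem rowMinor_chart_034 : rowMinor (chart v) 0 3 4 = v 2 - v 1 := by
  rw [rowMinor_of_lt _ (by decide) (by decide), det_submatrix_rows]
  simp [chart]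

theorem rowMinor_chart_035 : rowMinor (chart v) 0 3 5 = v 5 - v 4 := by
  rw [rowMinor_of_lt _ (by decide) (by decide), det_submatrix_rows]
  simp [chart]

theorem rowMinor_chart_045 : rowMinor (chart v) 0 4 5 = v 1 * v 5 - v 2 * v 4 := by
  rw [rowMinor_of_lt _ (by decide) (by decide), det_submatrix_rows]
  simp [chart]

theorem rowMinor_chart_123 : rowMinor (chart v) 1 2 3 = 1 := by
  rw [rowMinor_of_lt _ (by decide) (by decide), det_submatrix_rows]
  simp [chart]

theorem rowMinor_chart_124 : rowMinor (chart v) 1 2 4 = v 0 := by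
  rw [rowMinor_of_lt _ (by decide) (by decide), det_submatrix_rows]
  simp [chart]

theorem rowMinor_chart_125 : rowMinor (chart v) 1 2 5 = v 3 := by
  rw [rowMinor_of_lt _ (by decide) (by decide), det_submatrix_rows]
  simp [chart]

theorem rowMinor_chart_134 : rowMinor (chart v) 1 3 4 = v 0 - v 2 := by
  rw [rowMinor_of_lt _ (by decide) (by decide), det_submatrix_rows]
  simp [chart]
  ring

theorem rowMinor_chart_135 : rowMinor (chart v) 1 3 5 = v 3 - v 5 := by
  rw [rowMinor_of_lt _ (by decide) (by decide), det_submatrix_rows]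
  simp [chart]
  ring

theorem rowMinor_chart_145 : rowMinor (chart v) 1 4 5 = v 2 * v 3 - v 0 * v 5 := by
  rw [rowMinor_of_lt _ (by decide) (by decide), det_submatrix_rows]
  simp [chart]
  ring

theorem rowMinor_chart_234 : rowMinor (chart v) 2 3 4 = v 1 - v 0 := by
  rw [rowMinor_of_lt _ (by decide) (by decide), det_submatrix_rows]
  simp [chart]

theorem rowMinor_chart_235 : rowMinor (chart v) 2 3 5 = v 4 - v 3 := by
  rw [rowMinor_of_lt _ (by decide) (by decide), det_submatrix_rows]
  simp [chart]

theorem rowMinor_chart_245 : rowMinor (chart v) 2 4 5 = v 0 * v 4 - v 1 * v 3 := by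
  rw [rowMinor_of_lt _ (by decide) (by decide), det_submatrix_rows]
  simp [chart]

theorem rowMinor_chart_345 : rowMinor (chart v) 3 4 5 = chartMinor v := by
  rw [rowMinor_of_lt _ (by decide) (by decide), det_submatrix_rows]
  simp [chart, chartMinor]
  ring

theorem cconic_chart : cconic (chart v) = chartConic v := by
  rw [cconic, chartConic]
  simp [Matrix.det_succ_row_zero, Fin.sum_univ_succ, chart, cmonomials, Fin.succAbove]
  ring

theorem gammaList_chart : gammaList (chart v) = ![
    1 * chartMinor v * chartConic v,
    1 * (v 0 * v 4 - v 1 * v 3) * chartConic v,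
    v 2 * (v 4 - v 3) * chartConic v,
    v 5 * (v 1 - v 0) * chartConic v,
    (-1) * (v 2 * v 3 - v 0 * v 5) * chartConic v,
    (-v 1) * (v 3 - v 5) * chartConic v,
    (-v 4) * (v 0 - v 2) * chartConic v,
    (v 2 - v 1) * v 3 * chartConic v,
    (v 5 - v 4) * v 0 * chartConic v,
    (v 1 * v 5 - v 2 * v 4) * 1 * chartConic v,
    (-1) * 1 * (v 0 * v 4 - v 1 * v 3) * chartMinor v * v 2 * v 5,
    (-v 1) * v 0 * (v 4 - v 3) * chartMinor v * 1 * v 5,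
    (-v 4) * v 3 * (v 1 - v 0) * chartMinor v * 1 * v 2,
    (v 2 - v 1) * (v 0 - v 2) * (v 4 - v 3) * (v 0 * v 4 - v 1 * v 3) * 1 * v 5,
    (v 5 - v 4) * (v 3 - v 5) * (v 1 - v 0) * (v 0 * v 4 - v 1 * v 3) * 1 * v 2,
    (v 1 * v 5 - v 2 * v 4) * (v 2 * v 3 - v 0 * v 5) * (v 1 - v 0) * (v 4 - v 3) * 1 * 1,
    1 * 1 * (v 2 * v 3 - v 0 * v 5) * chartMinor v * (-v 1) * (-v 4),
    v 2 * v 0 * (v 3 - v 5) * chartMinor v * (-1) * (-v 4),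
    v 5 * v 3 * (v 0 - v 2) * chartMinor v * (-1) * (-v 1),
    (v 2 - v 1) * (v 1 - v 0) * (v 3 - v 5) * (v 2 * v 3 - v 0 * v 5) * 1 * (-v 4),
    (v 5 - v 4) * (v 4 - v 3) * (v 0 - v 2) * (v 2 * v 3 - v 0 * v 5) * 1 * (-v 1),
    (v 1 * v 5 - v 2 * v 4) * (v 0 * v 4 - v 1 * v 3) * (v 0 - v 2) * (v 3 - v 5) * 1 * (-1),
    1 * 1 * (v 2 * v 3 - v 0 * v 5) * (v 0 * v 4 - v 1 * v 3) * (v 2 - v 1) * (v 5 - v 4),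
    v 2 * (v 0 - v 2) * v 3 * (v 0 * v 4 - v 1 * v 3) * (-1) * (v 5 - v 4),
    v 5 * (v 3 - v 5) * v 0 * (v 0 * v 4 - v 1 * v 3) * (-1) * (v 2 - v 1),
    (-v 1) * (v 1 - v 0) * v 3 * (v 2 * v 3 - v 0 * v 5) * 1 * (v 5 - v 4),
    (-v 4) * (v 4 - v 3) * v 0 * (v 2 * v 3 - v 0 * v 5) * 1 * (v 2 - v 1),
    (v 1 * v 5 - v 2 * v 4) * chartMinor v * v 0 * v 3 * 1 * (-1),
    1 * v 0 * (v 3 - v 5) * (v 4 - v 3) * (v 2 - v 1) * (v 1 * v 5 - v 2 * v 4),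
    1 * (v 0 - v 2) * v 3 * (v 4 - v 3) * (-v 1) * (v 1 * v 5 - v 2 * v 4),
    v 5 * (v 2 * v 3 - v 0 * v 5) * 1 * (v 4 - v 3) * (-v 1) * (v 2 - v 1),
    (-1) * (v 1 - v 0) * v 3 * (v 3 - v 5) * v 2 * (v 1 * v 5 - v 2 * v 4),
    (-v 4) * (v 0 * v 4 - v 1 * v 3) * 1 * (v 3 - v 5) * v 2 * (v 2 - v 1),
    (v 5 - v 4) * chartMinor v * 1 * v 3 * v 2 * (-v 1),
    1 * v 3 * (v 0 - v 2) * (v 1 - v 0) * (v 5 - v 4) * (v 1 * v 5 - v 2 * v 4),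
    1 * (v 3 - v 5) * v 0 * (v 1 - v 0) * (-v 4) * (v 1 * v 5 - v 2 * v 4),
    v 2 * (v 2 * v 3 - v 0 * v 5) * 1 * (v 1 - v 0) * (-v 4) * (v 5 - v 4),
    (-1) * (v 4 - v 3) * v 0 * (v 0 - v 2) * v 5 * (v 1 * v 5 - v 2 * v 4),
    (-v 1) * (v 0 * v 4 - v 1 * v 3) * 1 * (v 0 - v 2) * v 5 * (v 5 - v 4),
    (v 2 - v 1) * chartMinor v * 1 * v 0 * v 5 * (-v 4)] := by
  simp only [gammaList, tval, pval, rowMinor_swap_left, rowMinor_swap_right, Fin.reduceLT,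
    Fin.isValue, rowMinor_chart_012, rowMinor_chart_013, rowMinor_chart_014, rowMinor_chart_015,
    rowMinor_chart_023, rowMinor_chart_024, rowMinor_chart_025, rowMinor_chart_034,
    rowMinor_chart_035, rowMinor_chart_045, rowMinor_chart_123, rowMinor_chart_124,
    rowMinor_chart_125, rowMinor_chart_134, rowMinor_chart_135, rowMinor_chart_145,
    rowMinor_chart_234, rowMinor_chart_235, rowMinor_chart_245, rowMinor_chart_345, cconic_chart]

-- The linear relations between the invariants: ten combinations span all forty. On the chart they
-- are polynomial identities in six variables; the factor `4` makes the coefficients integral, and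
-- is a unit in characteristic `≠ 2`.
set_option maxHeartbeats 4000000 in
theorem four_mul_gammaList_chart (n : Fin 40) :
    4 * gammaList (chart v) n =
      ∑ i, (paramCoeff n i : R) * params (gammaList (chart v)) i +
        coordForm (coords (gammaList (chart v))) n := by
  rw [gammaList_chart]
  fin_cases n <;>
    simp only [Fin.sum_univ_five, paramCoeff, coordForm, params, coords, chartConic, chartMinor,
      Matrix.cons_val, Fin.zero_eta, Fin.mk_one, Fin.reduceFinMk, Int.cast_neg, Int.cast_ofNat,
      Int.cast_one, Int.cast_zero] <;>
    ring

end Chart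

/-! ### Cubic relations modulo the parameters -/

section Relations

theorem mem_of_two_pow_mul_mem {K R : Type*} [Field K] [CommRing R] [Algebra K R]
    (hK : (2 : K) ≠ 0) (N : Submodule K R) (n : ℕ) {x y : R} (hy : y ∈ N) (h : 2 ^ n * x = y) :
    x ∈ N := by
  have e : x = ((2 : K) ^ n)⁻¹ • y := by
    rw [eq_inv_smul_iff₀ (pow_ne_zero _ hK), ← h, Algebra.smul_def]
    simp only [map_pow, map_ofNat]
  rw [e]
  exact N.smul_mem _ hy

/-- The values of the forty invariants at `chart v`, with an additional common factor. -/
def scaledGamma {R : Type*} [CommRing R] (t : R) (v : Fin 6 → R) (n : Fin 40) : R :=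
  t * gammaList (chart v) n

theorem four_mul_scaledGamma {R : Type*} [CommRing R] (t : R) (v : Fin 6 → R) (n : Fin 40) :
    4 * scaledGamma t v n = ∑ i, (paramCoeff n i : R) * params (scaledGamma t v) i +
      coordForm (coords (scaledGamma t v)) n := by
  have hp : ∀ i, params (scaledGamma t v) i = t * params (gammaList (chart v)) i := by
    intro i
    fin_cases i <;> simp [params, scaledGamma]
    ring
  have hc : ∀ i, coords (scaledGamma t v) i = t * coords (gammaList (chart v)) i := by
    intro i
    fin_cases i <;> simp [coords, scaledGamma] <;> ring
  have hf : ∀ n, coordForm (coords (scaledGamma t v)) n =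
      t * coordForm (coords (gammaList (chart v))) n := by
    intro n
    simp only [coordForm, hc]
    fin_cases n <;> simp <;> ring
  rw [hf, scaledGamma, mul_left_comm, four_mul_gammaList_chart, mul_add, Finset.mul_sum]
  simp only [hp, mul_left_comm]

variable (K : Type*) {R : Type*} [Field K] [CommRing R] [Algebra K R]

/-- The span of the parameters. -/
def paramSpan (g : Fin 40 → R) : Submodule K R := Submodule.span K (Set.range (params g))

/-- The span of the additional coordinates. -/
def coordSpan (g : Fin 40 → R) : Submodule K R := Submodule.span K (Set.range (coords g))

/-- The span of all invariants. -/
def fullSpan (g : Fin 40 → R) : Submodule K R := paramSpan K g ⊔ coordSpan K g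

variable {K}

theorem intCast_mul_mem (N : Submodule K R) {x : R} (hx : x ∈ N) (n : ℤ) : (n : R) * x ∈ N := by
  rw [← zsmul_eq_mul]
  exact zsmul_mem hx n

theorem coordForm_mem {N : Submodule K R} {y : Fin 5 → R} (hy : ∀ i, y i ∈ N) (n : Fin 40) :
    coordForm y n ∈ N := by
  fin_cases n <;>
    simp only [coordForm, Matrix.cons_val, Fin.zero_eta, Fin.mk_one, Fin.reduceFinMk, two_mul,
      neg_mul] <;>
    repeat' first
      | exact hy _
      | exact zero_mem _
      | apply add_mem
      | apply sub_mem
      | apply neg_mem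

/-- Each invariant is, up to the factor `4`, a combination of parameters plus a linear form in
`coords`. Expanding both triple products, every other term contains a parameter. -/
theorem mul_mul_sub_mem {t : R} {v : Fin 6 → R} {a b c d e f : Fin 40}
    (h : scaledGamma t v a * scaledGamma t v b * scaledGamma t v c =
      scaledGamma t v d * scaledGamma t v e * scaledGamma t v f) :
    coordForm (coords (scaledGamma t v)) a * coordForm (coords (scaledGamma t v)) b *
        coordForm (coords (scaledGamma t v)) c -
      coordForm (coords (scaledGamma t v)) d * coordForm (coords (scaledGamma t v)) e *
        coordForm (coords (scaledGamma t v)) f ∈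
      paramSpan K (scaledGamma t v) * fullSpan K (scaledGamma t v) ^ 2 := by
  set L := paramSpan K (scaledGamma t v)
  set Z := fullSpan K (scaledGamma t v)
  have hY : ∀ n, coordForm (coords (scaledGamma t v)) n ∈ Z := fun n =>
    coordForm_mem (fun i => Submodule.mem_sup_right
      (Submodule.subset_span (Set.mem_range_self i))) n
  have hl : ∀ n, ∑ i, (paramCoeff n i : R) * params (scaledGamma t v) i ∈ L := fun n =>
    sum_mem fun i _ => intCast_mul_mem L (Submodule.subset_span ⟨i, rfl⟩) _
  have hLZ : ∀ {x}, x ∈ L → x ∈ Z := fun hx => Submodule.mem_sup_left hx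
  have expand : ∀ {x y z p q r : R}, p ∈ L → q ∈ L → r ∈ L → x ∈ Z → y ∈ Z → z ∈ Z →
      (p + x) * (q + y) * (r + z) - x * y * z ∈ L * Z ^ 2 := by
    intro x y z p q r hp hq hr hx hy hz
    have e : (p + x) * (q + y) * (r + z) - x * y * z =
        p * ((q + y) * (r + z)) + q * (x * (r + z)) + r * (x * y) := by ring
    rw [e, pow_two]
    exact add_mem (add_mem
      (Submodule.mul_mem_mul hp (Submodule.mul_mem_mul (add_mem (hLZ hq) hy) (add_mem (hLZ hr) hz)))
      (Submodule.mul_mem_mul hq (Submodule.mul_mem_mul hx (add_mem (hLZ hr) hz))))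
      (Submodule.mul_mem_mul hr (Submodule.mul_mem_mul hx hy))
  have h1 := expand (hl a) (hl b) (hl c) (hY a) (hY b) (hY c)
  have h2 := expand (hl d) (hl e) (hl f) (hY d) (hY e) (hY f)
  rw [← four_mul_scaledGamma, ← four_mul_scaledGamma, ← four_mul_scaledGamma] at h1 h2
  convert sub_mem h2 h1 using 1
  -- The factor is `4 ^ 3`, one `4` for each of the three factors.
  linear_combination 64 * h

/-- The triples of invariants on the left hand sides of the relations. -/
def leftTriple : Fin 30 → Fin 40 × Fin 40 × Fin 40 :=
  ![(0, 32, 37), (1, 20, 31), (1, 18, 36), (7, 14, 37), (1, 17, 30), (12, 22, 37), (0, 31, 38),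
    (7, 20, 35), (0, 30, 35), (7, 11, 36), (2, 16, 24), (3, 16, 23), (2, 21, 25), (2, 24, 34),
    (5, 26, 34), (0, 23, 35), (0, 24, 36), (2, 18, 35), (12, 21, 30), (3, 17, 29), (3, 16, 28),
    (3, 21, 33), (2, 21, 39), (1, 17, 34), (5, 12, 37), (0, 23, 30), (2, 18, 22), (4, 13, 33),
    (6, 14, 27), (0, 24, 29)]

/-- The triples of invariants on the right hand sides of the relations. -/
def rightTriple : Fin 30 → Fin 40 × Fin 40 × Fin 40 :=
  ![(9, 13, 17), (4, 14, 29), (4, 12, 38), (8, 13, 31), (4, 11, 32), (13, 27, 36), (9, 14, 18),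
    (8, 19, 29), (9, 11, 19), (8, 12, 30), (5, 10, 26), (6, 10, 25), (5, 15, 23), (3, 23, 28),
    (6, 25, 28), (6, 14, 27), (3, 17, 22), (6, 11, 31), (15, 18, 32), (6, 11, 31), (5, 15, 39),
    (5, 10, 34), (6, 10, 28), (6, 14, 27), (6, 11, 31), (4, 13, 33), (4, 13, 33), (7, 10, 20),
    (8, 12, 21), (1, 18, 28)]

-- Once the indices are sorted, both sides are the same monomial in the minors and `d₂`.
set_option maxHeartbeats 4000000 in
theorem gammaList_binomial (x : Matrix (Fin 6) (Fin 3) R) (k : Fin 30) :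
    gammaList x (leftTriple k).1 * gammaList x (leftTriple k).2.1 *
        gammaList x (leftTriple k).2.2 =
      gammaList x (rightTriple k).1 * gammaList x (rightTriple k).2.1 *
        gammaList x (rightTriple k).2.2 := by
  fin_cases k
  all_goals
    simp only [leftTriple, rightTriple, gammaList, Matrix.cons_val, Fin.zero_eta, Fin.mk_one,
      Fin.reduceFinMk]
    simp only [tval, pval, rowMinor_swap_left, rowMinor_swap_right, Fin.reduceLT, Fin.isValue]
    ring

/-- For every index another one. -/
def partner : Fin 5 → Fin 5 := ![1, 0, 0, 0, 0]

-- The `35` cubic monomials in `y` reduce to a span of at most five elements, as the thirty binomial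
-- relations are equivalent over `ℤ[1/2]` to ten relations `yᵢyⱼyₖ = 0`, five `yᵢ³ = 0` and fifteen
-- `yᵢyⱼ² = yᵢyₖ²`, modulo the parameters.
set_option maxHeartbeats 4000000 in
theorem coords_cubic (hK : (2 : K) ≠ 0) (t : R) (v : Fin 6 → R) :
    (∀ i j k, i < j → j < k → coords (scaledGamma t v) i * coords (scaledGamma t v) j *
      coords (scaledGamma t v) k ∈
        paramSpan K (scaledGamma t v) * fullSpan K (scaledGamma t v) ^ 2) ∧
    (∀ i, coords (scaledGamma t v) i ^ 3 ∈
      paramSpan K (scaledGamma t v) * fullSpan K (scaledGamma t v) ^ 2) ∧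
    ∀ i j, i ≠ j → coords (scaledGamma t v) i * coords (scaledGamma t v) j ^ 2 -
        coords (scaledGamma t v) i * coords (scaledGamma t v) (partner i) ^ 2 ∈
      paramSpan K (scaledGamma t v) * fullSpan K (scaledGamma t v) ^ 2 := by
  have r : ∀ k, _ := fun k => mul_mul_sub_mem (K := K) (t := t) (v := v) (a := (leftTriple k).1)
    (b := (leftTriple k).2.1) (c := (leftTriple k).2.2) (d := (rightTriple k).1)
    (e := (rightTriple k).2.1) (f := (rightTriple k).2.2) (by
      simp only [scaledGamma]
      linear_combination t ^ 3 * gammaList_binomial (chart v) k)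
  generalize paramSpan K (scaledGamma t v) * fullSpan K (scaledGamma t v) ^ 2 = N at r ⊢
  generalize coords (scaledGamma t v) = y at r ⊢
  -- The relations with the linear forms of `coordForm` written out. The factors `0` belong to the
  -- invariants `6`, `15`, `24` and `33`, which are parameters themselves.
  have r0 :
    (y 0 + y 1 + y 2 - y 3 + y 4) * (2 * y 0 + 2 * y 3) * (y 0 + y 1 + y 2 - y 3 - y 4) -
      (-y 0 + y 1 + y 2 - y 3 + y 4) * (-y 0 + y 1 + y 2 - y 3 - y 4) * (-2 * y 0 + 2 * y 3) ∈ N :=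
    r 0
  have r1 :
    (y 0 + y 1 - y 2 + y 3 + y 4) * (-y 0 - y 1 + y 2 + y 3 - y 4) * (2 * y 0 - 2 * y 4) -
      (-y 0 + y 1 - y 2 + y 3 + y 4) * (-2 * y 0 - 2 * y 4) * (y 0 - y 1 + y 2 + y 3 - y 4) ∈ N :=
    r 1
  have r2 :
    (y 0 + y 1 - y 2 + y 3 + y 4) * (-y 0 - y 1 + y 2 - y 3 + y 4) * (2 * y 0 + 2 * y 2) -
      (-y 0 + y 1 - y 2 + y 3 + y 4) * (-2 * y 0 + 2 * y 2) * (y 0 - y 1 + y 2 - y 3 + y 4) ∈ N :=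
    r 2
  have r3 :
    (y 0 + y 1 - y 2 - y 3 - y 4) * (-2 * y 0 - 2 * y 4) * (y 0 + y 1 + y 2 - y 3 - y 4) -
      (-y 0 + y 1 - y 2 - y 3 - y 4) * (-y 0 + y 1 + y 2 - y 3 - y 4) * (2 * y 0 - 2 * y 4) ∈ N :=
    r 3
  have r4 :
    (y 0 + y 1 - y 2 + y 3 + y 4) * (-2 * y 0 + 2 * y 3) * (y 0 + y 1 + y 2 + y 3 + y 4) -
      (-y 0 + y 1 - y 2 + y 3 + y 4) * (-y 0 + y 1 + y 2 + y 3 + y 4) * (2 * y 0 + 2 * y 3) ∈ N :=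
    r 4
  have r5 :
    (-2 * y 0 + 2 * y 2) * (y 0 + y 1 + y 2 + y 3 - y 4) * (y 0 + y 1 + y 2 - y 3 - y 4) -
      (-y 0 + y 1 + y 2 - y 3 - y 4) * (-y 0 + y 1 + y 2 + y 3 - y 4) * (2 * y 0 + 2 * y 2) ∈ N :=
    r 5
  have r6 :
    (y 0 + y 1 + y 2 - y 3 + y 4) * (2 * y 0 - 2 * y 4) * (y 0 - y 1 + y 2 - y 3 + y 4) -
      (-y 0 + y 1 + y 2 - y 3 + y 4) * (-2 * y 0 - 2 * y 4) * (-y 0 - y 1 + y 2 - y 3 + y 4) ∈ N :=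
    r 6
  have r7 :
    (y 0 + y 1 - y 2 - y 3 - y 4) * (-y 0 - y 1 + y 2 + y 3 - y 4) * (2 * y 0 - 2 * y 1) -
      (-y 0 + y 1 - y 2 - y 3 - y 4) * (-2 * y 0 - 2 * y 1) * (y 0 - y 1 + y 2 + y 3 - y 4) ∈ N :=
    r 7
  have r8 :
    (y 0 + y 1 + y 2 - y 3 + y 4) * (y 0 + y 1 + y 2 + y 3 + y 4) * (2 * y 0 - 2 * y 1) -
      (-y 0 + y 1 + y 2 - y 3 + y 4) * (-y 0 + y 1 + y 2 + y 3 + y 4) * (-2 * y 0 - 2 * y 1) ∈ N :=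
    r 8
  have r9 :
    (y 0 + y 1 - y 2 - y 3 - y 4) * (-y 0 + y 1 + y 2 + y 3 + y 4) * (2 * y 0 + 2 * y 2) -
      (-y 0 + y 1 - y 2 - y 3 - y 4) * (-2 * y 0 + 2 * y 2) * (y 0 + y 1 + y 2 + y 3 + y 4) ∈ N :=
    r 9
  have r10 :
    (2 * y 3 + 2 * y 4) * (2 * y 1 + 2 * y 3) * 0 -
      (2 * y 1 + 2 * y 4) * (-2 * y 2 + 2 * y 3) * (2 * y 2 + 2 * y 3) ∈ N :=
    r 10
  have r11 :
    (2 * y 2 + 2 * y 4) * (2 * y 1 + 2 * y 3) * (2 * y 2 - 2 * y 4) -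
      0 * (-2 * y 2 + 2 * y 3) * (-2 * y 1 + 2 * y 2) ∈ N :=
    r 11
  have r12 :
    (2 * y 3 + 2 * y 4) * (2 * y 3 - 2 * y 4) * (-2 * y 1 + 2 * y 2) -
      (2 * y 1 + 2 * y 4) * 0 * (2 * y 2 - 2 * y 4) ∈ N :=
    r 12
  have r13 :
    (2 * y 3 + 2 * y 4) * 0 * (-2 * y 1 + 2 * y 4) -
      (2 * y 2 + 2 * y 4) * (2 * y 2 - 2 * y 4) * (-2 * y 1 + 2 * y 3) ∈ N :=
    r 13
  have r14 :
    (2 * y 1 + 2 * y 4) * (2 * y 2 + 2 * y 3) * (-2 * y 1 + 2 * y 4) -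
      0 * (-2 * y 1 + 2 * y 2) * (-2 * y 1 + 2 * y 3) ∈ N :=
    r 14
  have r15 :
    (y 0 + y 1 + y 2 - y 3 + y 4) * (2 * y 2 - 2 * y 4) * (2 * y 0 - 2 * y 1) -
      0 * (-2 * y 0 - 2 * y 4) * (-y 0 + y 1 + y 2 + y 3 - y 4) ∈ N :=
    r 15
  have r16 :
    (y 0 + y 1 + y 2 - y 3 + y 4) * 0 * (2 * y 0 + 2 * y 2) -
      (2 * y 2 + 2 * y 4) * (-2 * y 0 + 2 * y 3) * (y 0 + y 1 + y 2 + y 3 - y 4) ∈ N :=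
    r 16
  have r17 :
    (2 * y 3 + 2 * y 4) * (-y 0 - y 1 + y 2 - y 3 + y 4) * (2 * y 0 - 2 * y 1) -
      0 * (-y 0 + y 1 + y 2 + y 3 + y 4) * (2 * y 0 - 2 * y 4) ∈ N :=
    r 17
  have r18 :
    (-2 * y 0 + 2 * y 2) * (2 * y 3 - 2 * y 4) * (y 0 + y 1 + y 2 + y 3 + y 4) -
      0 * (-y 0 - y 1 + y 2 - y 3 + y 4) * (2 * y 0 + 2 * y 3) ∈ N :=
    r 18
  have r19 :
    (2 * y 2 + 2 * y 4) * (-2 * y 0 + 2 * y 3) * (y 0 - y 1 + y 2 + y 3 - y 4) -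
      0 * (-y 0 + y 1 + y 2 + y 3 + y 4) * (2 * y 0 - 2 * y 4) ∈ N :=
    r 19
  have r20 :
    (2 * y 2 + 2 * y 4) * (2 * y 1 + 2 * y 3) * (-2 * y 1 + 2 * y 3) -
      (2 * y 1 + 2 * y 4) * 0 * (-2 * y 1 - 2 * y 2) ∈ N :=
    r 20
  have r21 :
    (2 * y 2 + 2 * y 4) * (2 * y 3 - 2 * y 4) * 0 -
      (2 * y 1 + 2 * y 4) * (-2 * y 2 + 2 * y 3) * (-2 * y 1 + 2 * y 4) ∈ N :=
    r 21
  have r22 :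
    (2 * y 3 + 2 * y 4) * (2 * y 3 - 2 * y 4) * (-2 * y 1 - 2 * y 2) -
      0 * (-2 * y 2 + 2 * y 3) * (-2 * y 1 + 2 * y 3) ∈ N :=
    r 22
  have r23 :
    (y 0 + y 1 - y 2 + y 3 + y 4) * (-2 * y 0 + 2 * y 3) * (-2 * y 1 + 2 * y 4) -
      0 * (-2 * y 0 - 2 * y 4) * (-y 0 + y 1 + y 2 + y 3 - y 4) ∈ N :=
    r 23
  have r24 :
    (2 * y 1 + 2 * y 4) * (-2 * y 0 + 2 * y 2) * (y 0 + y 1 + y 2 - y 3 - y 4) -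
      0 * (-y 0 + y 1 + y 2 + y 3 + y 4) * (2 * y 0 - 2 * y 4) ∈ N :=
    r 24
  have r25 :
    (y 0 + y 1 + y 2 - y 3 + y 4) * (2 * y 2 - 2 * y 4) * (y 0 + y 1 + y 2 + y 3 + y 4) -
      (-y 0 + y 1 - y 2 + y 3 + y 4) * (-y 0 + y 1 + y 2 - y 3 - y 4) * 0 ∈ N :=
    r 25
  have r26 :
    (2 * y 3 + 2 * y 4) * (-y 0 - y 1 + y 2 - y 3 + y 4) * (y 0 + y 1 + y 2 + y 3 - y 4) -
      (-y 0 + y 1 - y 2 + y 3 + y 4) * (-y 0 + y 1 + y 2 - y 3 - y 4) * 0 ∈ N :=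
    r 26
  have r27 :
    (-y 0 + y 1 - y 2 + y 3 + y 4) * (-y 0 + y 1 + y 2 - y 3 - y 4) * 0 -
      (y 0 + y 1 - y 2 - y 3 - y 4) * (-2 * y 2 + 2 * y 3) * (-y 0 - y 1 + y 2 + y 3 - y 4) ∈ N :=
    r 27
  have r28 :
    0 * (-2 * y 0 - 2 * y 4) * (-y 0 + y 1 + y 2 + y 3 - y 4) -
      (-y 0 + y 1 - y 2 - y 3 - y 4) * (-2 * y 0 + 2 * y 2) * (2 * y 3 - 2 * y 4) ∈ N :=
    r 28
  have r29 :
    (y 0 + y 1 + y 2 - y 3 + y 4) * 0 * (y 0 - y 1 + y 2 + y 3 - y 4) -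
      (y 0 + y 1 - y 2 + y 3 + y 4) * (-y 0 - y 1 + y 2 - y 3 + y 4) * (-2 * y 1 + 2 * y 3) ∈ N :=
    r 29
  -- Elimination: a power of two times each target is an integral combination of the `r`'s and of
  -- targets obtained before. The names `s`, `c` and `q` stand for squarefree monomials, cubes and
  -- differences.
  have s012 : y 0 * y 1 * y 2 ∈ N := mem_of_two_pow_mul_mem hK N 4
    (add_mem (zsmul_mem r0 (1)) (zsmul_mem r1 (1)))
    (by simp only [zsmul_eq_mul]; push_cast; ring)
  have s013 : y 0 * y 1 * y 3 ∈ N := mem_of_two_pow_mul_mem hK N 4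
    (add_mem (zsmul_mem r2 (-1)) (zsmul_mem r3 (1)))
    (by simp only [zsmul_eq_mul]; push_cast; ring)
  have s014 : y 0 * y 1 * y 4 ∈ N := mem_of_two_pow_mul_mem hK N 4
    (add_mem (zsmul_mem r4 (-1)) (zsmul_mem r5 (1)))
    (by simp only [zsmul_eq_mul]; push_cast; ring)
  have s023 : y 0 * y 2 * y 3 ∈ N := mem_of_two_pow_mul_mem hK N 4
    (add_mem (zsmul_mem r6 (-1)) (zsmul_mem r7 (-1)))
    (by simp only [zsmul_eq_mul]; push_cast; ring)
  have c0 : y 0 ^ 3 ∈ N := mem_of_two_pow_mul_mem hK N 3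
    (add_mem (add_mem (add_mem (zsmul_mem s014 (-8)) (zsmul_mem s023 (8))) (zsmul_mem r6 (1)))
      (zsmul_mem r4 (-1)))
    (by simp only [zsmul_eq_mul]; push_cast; ring)
  have s024 : y 0 * y 2 * y 4 ∈ N := mem_of_two_pow_mul_mem hK N 3
    (add_mem (add_mem (add_mem (zsmul_mem s013 (-8)) (zsmul_mem c0 (-8))) (zsmul_mem r8 (1)))
      (zsmul_mem r2 (-1)))
    (by simp only [zsmul_eq_mul]; push_cast; ring)
  have s034 : y 0 * y 3 * y 4 ∈ N := mem_of_two_pow_mul_mem hK N 3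
    (add_mem (add_mem (add_mem (zsmul_mem s012 (-8)) (zsmul_mem c0 (-8))) (zsmul_mem r0 (1)))
      (zsmul_mem r9 (-1)))
    (by simp only [zsmul_eq_mul]; push_cast; ring)
  have q03 : y 0 * y 3 ^ 2 - y 0 * y 1 ^ 2 ∈ N := mem_of_two_pow_mul_mem hK N 3
    (add_mem (add_mem (add_mem (zsmul_mem s012 (8)) (zsmul_mem s023 (8))) (zsmul_mem r6 (1)))
      (zsmul_mem r0 (-1)))
    (by simp only [zsmul_eq_mul]; push_cast; ring)
  have q02 : y 0 * y 2 ^ 2 - y 0 * y 1 ^ 2 ∈ N := mem_of_two_pow_mul_mem hK N 3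
    (add_mem (add_mem (add_mem (add_mem (zsmul_mem s023 (8)) (zsmul_mem c0 (-8))) (zsmul_mem s024
      (-8))) (zsmul_mem r8 (1))) (zsmul_mem r6 (1)))
    (by simp only [zsmul_eq_mul]; push_cast; ring)
  have q04 : y 0 * y 4 ^ 2 - y 0 * y 1 ^ 2 ∈ N := mem_of_two_pow_mul_mem hK N 2
    (add_mem (add_mem (add_mem (add_mem (zsmul_mem c0 (-4)) (zsmul_mem s024 (-8))) (zsmul_mem q03
      (4))) (zsmul_mem q02 (-4))) (zsmul_mem r8 (1)))
    (by simp only [zsmul_eq_mul]; push_cast; ring)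
  have s123 : y 1 * y 2 * y 3 ∈ N := mem_of_two_pow_mul_mem hK N 5
    (add_mem (add_mem (add_mem (add_mem (add_mem (add_mem (add_mem (add_mem (add_mem (add_mem
      (add_mem (add_mem (add_mem (zsmul_mem s012 (8)) (zsmul_mem s013 (8))) (zsmul_mem s023
      (16))) (zsmul_mem s024 (8))) (zsmul_mem s034 (-8))) (zsmul_mem r10 (1))) (zsmul_mem r11
      (-1))) (zsmul_mem r12 (-2))) (zsmul_mem r13 (1))) (zsmul_mem r14 (-1))) (zsmul_mem r15
      (2))) (zsmul_mem r16 (-2))) (zsmul_mem r17 (-2))) (zsmul_mem r18 (2)))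
    (by simp only [zsmul_eq_mul]; push_cast; ring)
  have s134 : y 1 * y 3 * y 4 ∈ N := mem_of_two_pow_mul_mem hK N 3
    (add_mem (add_mem (add_mem (add_mem (zsmul_mem s012 (8)) (zsmul_mem s014 (8))) (zsmul_mem
      s123 (-8))) (zsmul_mem r16 (-1))) (zsmul_mem r19 (-1)))
    (by simp only [zsmul_eq_mul]; push_cast; ring)
  have q41 : y 4 * y 1 ^ 2 - y 4 * y 0 ^ 2 ∈ N := mem_of_two_pow_mul_mem hK N 4
    (add_mem (add_mem (add_mem (add_mem (add_mem (add_mem (add_mem (add_mem (zsmul_mem s012 (8))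
      (zsmul_mem s014 (8))) (zsmul_mem s023 (8))) (zsmul_mem s034 (-8))) (zsmul_mem s123 (-16)))
      (zsmul_mem r20 (-1))) (zsmul_mem r13 (1))) (zsmul_mem r15 (2))) (zsmul_mem r16 (-2)))
    (by simp only [zsmul_eq_mul]; push_cast; ring)
  have q43 : y 4 * y 3 ^ 2 - y 4 * y 0 ^ 2 ∈ N := mem_of_two_pow_mul_mem hK N 4
    (add_mem (add_mem (add_mem (add_mem (add_mem (zsmul_mem q41 (16)) (zsmul_mem r20 (2)))
      (zsmul_mem r21 (-1))) (zsmul_mem r22 (1))) (zsmul_mem r12 (-1))) (zsmul_mem r14 (-1)))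
    (by simp only [zsmul_eq_mul]; push_cast; ring)
  have q42 : y 4 * y 2 ^ 2 - y 4 * y 0 ^ 2 ∈ N := mem_of_two_pow_mul_mem hK N 4
    (add_mem (add_mem (add_mem (add_mem (add_mem (zsmul_mem q43 (16)) (zsmul_mem r22 (-1)))
      (zsmul_mem r10 (2))) (zsmul_mem r11 (-1))) (zsmul_mem r12 (-1))) (zsmul_mem r13 (-1)))
    (by simp only [zsmul_eq_mul]; push_cast; ring)
  have s234 : y 2 * y 3 * y 4 ∈ N := mem_of_two_pow_mul_mem hK N 4
    (add_mem (add_mem (add_mem (add_mem (add_mem (add_mem (add_mem (add_mem (zsmul_mem s012 (-8))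
      (zsmul_mem s013 (8))) (zsmul_mem s024 (8))) (zsmul_mem s034 (8))) (zsmul_mem q43 (16)))
      (zsmul_mem r21 (-1))) (zsmul_mem r10 (1))) (zsmul_mem r23 (-2))) (zsmul_mem r24 (-2)))
    (by simp only [zsmul_eq_mul]; push_cast; ring)
  have c4 : y 4 ^ 3 ∈ N := mem_of_two_pow_mul_mem hK N 2
    (add_mem (add_mem (add_mem (add_mem (add_mem (add_mem (add_mem (add_mem (add_mem (zsmul_mem
      s014 (-8)) (zsmul_mem q03 (-8))) (zsmul_mem q02 (8))) (zsmul_mem q41 (-4))) (zsmul_mem q43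
      (12))) (zsmul_mem q42 (-4))) (zsmul_mem r10 (1))) (zsmul_mem r25 (-1))) (zsmul_mem r26
      (-1))) (zsmul_mem r27 (-1)))
    (by simp only [zsmul_eq_mul]; push_cast; ring)
  have q14 : y 1 * y 4 ^ 2 - y 1 * y 0 ^ 2 ∈ N := mem_of_two_pow_mul_mem hK N 3
    (add_mem (add_mem (add_mem (add_mem (add_mem (add_mem (add_mem (add_mem (add_mem (zsmul_mem
      s012 (-8)) (zsmul_mem s024 (8))) (zsmul_mem q04 (-8))) (zsmul_mem s123 (8))) (zsmul_mem
      q41 (8))) (zsmul_mem s234 (-8))) (zsmul_mem r20 (1))) (zsmul_mem r21 (-1))) (zsmul_mem r22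
      (1))) (zsmul_mem r23 (-2)))
    (by simp only [zsmul_eq_mul]; push_cast; ring)
  have q13 : y 1 * y 3 ^ 2 - y 1 * y 0 ^ 2 ∈ N := mem_of_two_pow_mul_mem hK N 4
    (add_mem (add_mem (zsmul_mem q14 (16)) (zsmul_mem r22 (-1))) (zsmul_mem r12 (-1)))
    (by simp only [zsmul_eq_mul]; push_cast; ring)
  have q12 : y 1 * y 2 ^ 2 - y 1 * y 0 ^ 2 ∈ N := mem_of_two_pow_mul_mem hK N 3
    (add_mem (add_mem (add_mem (zsmul_mem q43 (8)) (zsmul_mem q42 (-8))) (zsmul_mem q13 (8)))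
      (zsmul_mem r10 (1)))
    (by simp only [zsmul_eq_mul]; push_cast; ring)
  have q21 : y 2 * y 1 ^ 2 - y 2 * y 0 ^ 2 ∈ N := mem_of_two_pow_mul_mem hK N 2
    (add_mem (add_mem (add_mem (add_mem (add_mem (add_mem (add_mem (add_mem (add_mem (zsmul_mem
      s023 (-4)) (zsmul_mem s034 (4))) (zsmul_mem q02 (4))) (zsmul_mem q04 (-4))) (zsmul_mem
      s123 (4))) (zsmul_mem s134 (-4))) (zsmul_mem q41 (4))) (zsmul_mem q14 (4))) (zsmul_mem q12
      (-4))) (zsmul_mem r15 (-1)))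
    (by simp only [zsmul_eq_mul]; push_cast; ring)
  have q23 : y 2 * y 3 ^ 2 - y 2 * y 0 ^ 2 ∈ N := mem_of_two_pow_mul_mem hK N 3
    (add_mem (add_mem (add_mem (zsmul_mem q41 (8)) (zsmul_mem q43 (-8))) (zsmul_mem q21 (8)))
      (zsmul_mem r20 (1)))
    (by simp only [zsmul_eq_mul]; push_cast; ring)
  have q24 : y 2 * y 4 ^ 2 - y 2 * y 0 ^ 2 ∈ N := mem_of_two_pow_mul_mem hK N 3
    (add_mem (add_mem (add_mem (zsmul_mem q14 (-8)) (zsmul_mem q13 (8))) (zsmul_mem q23 (8)))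
      (zsmul_mem r22 (1)))
    (by simp only [zsmul_eq_mul]; push_cast; ring)
  have c2 : y 2 ^ 3 ∈ N := mem_of_two_pow_mul_mem hK N 1
    (add_mem (add_mem (add_mem (add_mem (add_mem (add_mem (add_mem (add_mem (add_mem (add_mem
      (add_mem (add_mem (add_mem (zsmul_mem s012 (-4)) (zsmul_mem s014 (4))) (zsmul_mem q02
      (-4))) (zsmul_mem q04 (4))) (zsmul_mem q41 (2))) (zsmul_mem q43 (-2))) (zsmul_mem q42
      (-2))) (zsmul_mem c4 (2))) (zsmul_mem q14 (4))) (zsmul_mem q12 (-4))) (zsmul_mem q21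
      (-2))) (zsmul_mem q23 (2))) (zsmul_mem q24 (2))) (zsmul_mem r25 (1)))
    (by simp only [zsmul_eq_mul]; push_cast; ring)
  have s124 : y 1 * y 2 * y 4 ∈ N := mem_of_two_pow_mul_mem hK N 4
    (add_mem (add_mem (add_mem (add_mem (add_mem (add_mem (add_mem (add_mem (add_mem (add_mem
      (add_mem (add_mem (add_mem (add_mem (zsmul_mem s013 (-8)) (zsmul_mem s014 (8))) (zsmul_mem
      s023 (8))) (zsmul_mem s024 (8))) (zsmul_mem q41 (8))) (zsmul_mem q42 (8))) (zsmul_mem q14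
      (-16))) (zsmul_mem q13 (8))) (zsmul_mem q12 (8))) (zsmul_mem q21 (8))) (zsmul_mem q23
      (-8))) (zsmul_mem r21 (1))) (zsmul_mem r11 (-1))) (zsmul_mem r28 (2))) (zsmul_mem r17
      (-2)))
    (by simp only [zsmul_eq_mul]; push_cast; ring)
  have q32 : y 3 * y 2 ^ 2 - y 3 * y 0 ^ 2 ∈ N := mem_of_two_pow_mul_mem hK N 2
    (add_mem (add_mem (add_mem (add_mem (add_mem (add_mem (add_mem (add_mem (add_mem (zsmul_mem
      s013 (-4)) (zsmul_mem s014 (4))) (zsmul_mem q03 (4))) (zsmul_mem q04 (-4))) (zsmul_mem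
      s123 (4))) (zsmul_mem q42 (4))) (zsmul_mem q23 (-4))) (zsmul_mem q24 (4))) (zsmul_mem s124
      (-4))) (zsmul_mem r28 (1)))
    (by simp only [zsmul_eq_mul]; push_cast; ring)
  have q34 : y 3 * y 4 ^ 2 - y 3 * y 0 ^ 2 ∈ N := mem_of_two_pow_mul_mem hK N 3
    (add_mem (add_mem (add_mem (zsmul_mem q14 (-8)) (zsmul_mem q12 (8))) (zsmul_mem q32 (8)))
      (zsmul_mem r11 (-1)))
    (by simp only [zsmul_eq_mul]; push_cast; ring)
  have q31 : y 3 * y 1 ^ 2 - y 3 * y 0 ^ 2 ∈ N := mem_of_two_pow_mul_mem hK N 3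
    (add_mem (add_mem (add_mem (zsmul_mem q21 (8)) (zsmul_mem q24 (-8))) (zsmul_mem q34 (8)))
      (zsmul_mem r21 (1)))
    (by simp only [zsmul_eq_mul]; push_cast; ring)
  have c3 : y 3 ^ 3 ∈ N := mem_of_two_pow_mul_mem hK N 1
    (add_mem (add_mem (add_mem (add_mem (add_mem (add_mem (add_mem (add_mem (add_mem (add_mem
      (add_mem (add_mem (add_mem (zsmul_mem s013 (-4)) (zsmul_mem s014 (-4))) (zsmul_mem q03
      (-4))) (zsmul_mem q04 (4))) (zsmul_mem q41 (-2))) (zsmul_mem q43 (2))) (zsmul_mem q42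
      (2))) (zsmul_mem c4 (-2))) (zsmul_mem q14 (4))) (zsmul_mem q13 (-4))) (zsmul_mem q32 (2)))
      (zsmul_mem q34 (2))) (zsmul_mem q31 (-2))) (zsmul_mem r26 (-1)))
    (by simp only [zsmul_eq_mul]; push_cast; ring)
  have c1 : y 1 ^ 3 ∈ N := mem_of_two_pow_mul_mem hK N 1
    (add_mem (add_mem (add_mem (add_mem (add_mem (add_mem (add_mem (add_mem (add_mem (add_mem
      (add_mem (add_mem (zsmul_mem s012 (4)) (zsmul_mem s023 (-4))) (zsmul_mem q03 (4)))
      (zsmul_mem q14 (2))) (zsmul_mem q13 (2))) (zsmul_mem q12 (-2))) (zsmul_mem q21 (4)))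
      (zsmul_mem q23 (-4))) (zsmul_mem q32 (2))) (zsmul_mem q34 (-2))) (zsmul_mem q31 (-2)))
      (zsmul_mem c3 (2))) (zsmul_mem r29 (-1)))
    (by simp only [zsmul_eq_mul]; push_cast; ring)
  refine ⟨fun i j k hij hjk => ?_, fun i => ?_, fun i j hij => ?_⟩
  · have key : ∀ i j k : Fin 5, i < j → j < k → (i, j, k) ∈
        [(0, 1, 2), (0, 1, 3), (0, 1, 4), (0, 2, 3), (0, 2, 4), (0, 3, 4), (1, 2, 3), (1, 2, 4),
        (1, 3, 4), (2, 3, 4)] := by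
      decide
    have h := key i j k hij hjk
    simp only [List.mem_cons, List.not_mem_nil, or_false, Prod.mk.injEq] at h
    rcases h with ⟨rfl, rfl, rfl⟩ | ⟨rfl, rfl, rfl⟩ | ⟨rfl, rfl, rfl⟩ | ⟨rfl, rfl, rfl⟩ |
      ⟨rfl, rfl, rfl⟩ | ⟨rfl, rfl, rfl⟩ | ⟨rfl, rfl, rfl⟩ | ⟨rfl, rfl, rfl⟩ | ⟨rfl, rfl, rfl⟩ |
      ⟨rfl, rfl, rfl⟩
    exacts [s012, s013, s014, s023, s024, s034, s123, s124, s134, s234]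
  · fin_cases i
    exacts [c0, c1, c2, c3, c4]
  · have key : ∀ i j : Fin 5, i ≠ j → (i, j) ∈
        [(0, 1), (0, 2), (0, 3), (0, 4), (1, 0), (1, 2), (1, 3), (1, 4), (2, 0), (2, 1), (2, 3),
        (2, 4), (3, 0), (3, 1), (3, 2), (3, 4), (4, 0), (4, 1), (4, 2), (4, 3)] := by
      decide
    have d : ∀ i, y i * y (partner i) ^ 2 - y i * y (partner i) ^ 2 ∈ N := fun i => by
      rw [sub_self]
      exact N.zero_mem
    have h := key i j hij
    simp only [List.mem_cons, List.not_mem_nil, or_false, Prod.mk.injEq] at h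
    rcases h with ⟨rfl, rfl⟩ | ⟨rfl, rfl⟩ | ⟨rfl, rfl⟩ | ⟨rfl, rfl⟩ | ⟨rfl, rfl⟩ | ⟨rfl, rfl⟩ |
      ⟨rfl, rfl⟩ | ⟨rfl, rfl⟩ | ⟨rfl, rfl⟩ | ⟨rfl, rfl⟩ | ⟨rfl, rfl⟩ | ⟨rfl, rfl⟩ | ⟨rfl, rfl⟩ |
      ⟨rfl, rfl⟩ | ⟨rfl, rfl⟩ | ⟨rfl, rfl⟩ | ⟨rfl, rfl⟩ | ⟨rfl, rfl⟩ | ⟨rfl, rfl⟩ | ⟨rfl, rfl⟩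
    exacts [d 0, q02, q03, q04, d 1, q12, q13, q14, d 2, q21, q23, q24, d 3, q31, q32, q34, d 4,
      q41, q42, q43]

end Relations

/-! ### Twenty-seven generators modulo the parameters -/

section Spanning

variable {K R : Type*} [Field K] [CommRing R] [Algebra K R]

/-- The spans of representatives of a basis of the ring of invariants modulo the parameters. -/
def basisSpan (K : Type*) {R : Type*} [Field K] [CommRing R] [Algebra K R] (y : Fin 5 → R) :
    ℕ → Submodule K R
  | 0 => 1
  | 1 => Submodule.span K (Set.range y)
  | 2 => Submodule.span K (Set.range y) * Submodule.span K (Set.range y)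
  | 3 => Submodule.span K (Set.range fun i => y i * y (partner i) ^ 2)
  | 4 => Submodule.span K {y 0 ^ 2 * y 1 ^ 2}
  | _ => ⊥

variable {y : Fin 5 → R} {L Z : Submodule K R}

theorem mul_mem_mul_pow_succ {n : ℕ} {x z : R} (hx : x ∈ L * Z ^ n) (hz : z ∈ Z) :
    x * z ∈ L * Z ^ (n + 1) := by
  rw [pow_succ, ← mul_assoc]
  exact Submodule.mul_mem_mul hx hz

theorem mul_mul_mem_of_ne (h1 : ∀ i j k, i < j → j < k → y i * y j * y k ∈ L * Z ^ 2)
    {i j k : Fin 5} (hij : i ≠ j) (hjk : j ≠ k) (hik : i ≠ k) :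
    y i * y j * y k ∈ L * Z ^ 2 := by
  rcases lt_or_gt_of_ne hij with h | h <;> rcases lt_or_gt_of_ne hjk with h' | h' <;>
    rcases lt_or_gt_of_ne hik with h'' | h''
  · exact h1 i j k h h'
  · exact absurd (h.trans h') h''.not_gt
  · rw [mul_right_comm]
    exact h1 i k j h'' h'
  · rw [mul_comm _ (y k), ← mul_assoc]
    exact h1 k i j h'' h
  · rw [mul_comm (y i)]
    exact h1 j i k h h''
  · rw [mul_comm (y i), mul_right_comm]
    exact h1 j k i h' h''
  · exact absurd (h'.trans h) h''.not_gt
  · rw [mul_comm (y i), mul_comm _ (y k), ← mul_assoc]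
    exact h1 k j i h' h

theorem mul_sq_sub_mul_sq_mem
    (h3 : ∀ i j, i ≠ j → y i * y j ^ 2 - y i * y (partner i) ^ 2 ∈ L * Z ^ 2)
    {i j k : Fin 5} (hij : i ≠ j) (hik : i ≠ k) :
    y i * y j ^ 2 - y i * y k ^ 2 ∈ L * Z ^ 2 := by
  have h := sub_mem (h3 i j hij) (h3 i k hik)
  rwa [sub_sub_sub_cancel_right] at h

theorem ne_partner (i : Fin 5) : i ≠ partner i := by
  revert i
  decide

theorem mul_sq_mem (h2 : ∀ i, y i ^ 3 ∈ L * Z ^ 2)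
    (h3 : ∀ i j, i ≠ j → y i * y j ^ 2 - y i * y (partner i) ^ 2 ∈ L * Z ^ 2)
    (i j : Fin 5) : y i * y j ^ 2 ∈ L * Z ^ 2 ⊔ basisSpan K y 3 := by
  rcases eq_or_ne i j with rfl | hij
  · have h := h2 i
    rw [pow_succ' (y i)] at h
    exact Submodule.mem_sup_left h
  · rw [← sub_add_cancel (y i * y j ^ 2) (y i * y (partner i) ^ 2)]
    exact Submodule.add_mem_sup (h3 i j hij) (Submodule.subset_span ⟨i, rfl⟩)

theorem mul_mul_mem (h1 : ∀ i j k, i < j → j < k → y i * y j * y k ∈ L * Z ^ 2)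
    (h2 : ∀ i, y i ^ 3 ∈ L * Z ^ 2)
    (h3 : ∀ i j, i ≠ j → y i * y j ^ 2 - y i * y (partner i) ^ 2 ∈ L * Z ^ 2)
    (i j k : Fin 5) : y i * (y j * y k) ∈ L * Z ^ 2 ⊔ basisSpan K y 3 := by
  by_cases hjk : j = k
  · subst hjk
    rw [← pow_two]
    exact mul_sq_mem h2 h3 i j
  by_cases hij : i = j
  · subst hij
    rw [← mul_assoc, ← pow_two, mul_comm _ (y k)]
    exact mul_sq_mem h2 h3 k i
  by_cases hik : i = k
  · subst hik
    rw [mul_left_comm, ← pow_two]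
    exact mul_sq_mem h2 h3 j i
  rw [← mul_assoc]
  exact Submodule.mem_sup_left (mul_mul_mem_of_ne h1 hij hjk hik)

/-- Multiplied by `yᵢ`, the relations `yᵢyⱼ² = yᵢyₖ²` identify, modulo parameters, all products
`yᵢ²yⱼ²` with `i ≠ j`; a single quartic remains. -/
theorem sq_mul_sq_sub_mem (hy : ∀ i, y i ∈ Z)
    (h3 : ∀ i j, i ≠ j → y i * y j ^ 2 - y i * y (partner i) ^ 2 ∈ L * Z ^ 2)
    {i j k : Fin 5} (hij : i ≠ j) (hik : i ≠ k) :
    y i ^ 2 * y j ^ 2 - y i ^ 2 * y k ^ 2 ∈ L * Z ^ 3 := by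
  have h := mul_mem_mul_pow_succ (mul_sq_sub_mul_sq_mem h3 hij hik) (hy i)
  convert h using 1
  ring

theorem sq_mul_sq_mem (hy : ∀ i, y i ∈ Z)
    (h3 : ∀ i j, i ≠ j → y i * y j ^ 2 - y i * y (partner i) ^ 2 ∈ L * Z ^ 2)
    {i j : Fin 5} (hij : i ≠ j) :
    y i ^ 2 * y j ^ 2 ∈ L * Z ^ 3 ⊔ basisSpan K y 4 := by
  have key : ∀ {k : Fin 5}, 0 ≠ k → y 0 ^ 2 * y k ^ 2 ∈ L * Z ^ 3 ⊔ basisSpan K y 4 := by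
    intro k hk
    rw [← sub_add_cancel (y 0 ^ 2 * y k ^ 2) (y 0 ^ 2 * y 1 ^ 2)]
    exact Submodule.add_mem_sup (sq_mul_sq_sub_mem hy h3 hk (by decide))
      (Submodule.subset_span rfl)
  by_cases hi : 0 = i
  · subst hi
    exact key hij
  · rw [← sub_add_cancel (y i ^ 2 * y j ^ 2) (y i ^ 2 * y 0 ^ 2), mul_comm _ (y 0 ^ 2)]
    refine add_mem (Submodule.mem_sup_left ?_) (key hi)
    rw [mul_comm (y 0 ^ 2)]
    exact sq_mul_sq_sub_mem hy h3 hij (Ne.symm hi)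

theorem mul_mul_sq_mem (hy : ∀ i, y i ∈ Z)
    (h1 : ∀ i j k, i < j → j < k → y i * y j * y k ∈ L * Z ^ 2)
    (h3 : ∀ i j, i ≠ j → y i * y j ^ 2 - y i * y (partner i) ^ 2 ∈ L * Z ^ 2)
    (i j : Fin 5) :
    y i * (y j * y (partner j) ^ 2) ∈ L * Z ^ 3 ⊔ basisSpan K y 4 := by
  by_cases hij : i = j
  · subst hij
    have h := sq_mul_sq_mem hy h3 (ne_partner i)
    rwa [pow_two (y i), mul_assoc] at h
  -- The square of the partner may be exchanged for the square of an index `m` different from both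
  -- `i` and `j`, which produces a squarefree cubic factor.
  · obtain ⟨m, hm⟩ : ∃ m, i ≠ m ∧ j ≠ m := by
      revert i j
      decide
    apply Submodule.mem_sup_left
    have e : y i * (y j * y (partner j) ^ 2) = y i * y j * y m * y m -
        (y j * y m ^ 2 - y j * y (partner j) ^ 2) * y i := by
      ring
    rw [e]
    exact sub_mem (mul_mem_mul_pow_succ (mul_mul_mem_of_ne h1 hij hm.2 hm.1) (hy m))
      (mul_mem_mul_pow_succ (h3 j m hm.2) (hy i))

/-- In degree five nothing remains: `yᵢy₀²y₁²` contains the cube of `y₀` or `y₁`, or the squarefree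
product `yᵢy₀y₁`. -/
theorem mul_sq_mul_sq_mem (hy : ∀ i, y i ∈ Z)
    (h1 : ∀ i j k, i < j → j < k → y i * y j * y k ∈ L * Z ^ 2) (h2 : ∀ i, y i ^ 3 ∈ L * Z ^ 2)
    (i : Fin 5) : y i * (y 0 ^ 2 * y 1 ^ 2) ∈ L * Z ^ 4 := by
  by_cases h0 : i = 0
  · subst h0
    have h := mul_mem_mul_pow_succ (mul_mem_mul_pow_succ (h2 0) (hy 1)) (hy 1)
    convert h using 1
    ring
  by_cases h4 : i = 1
  · subst h4
    have h := mul_mem_mul_pow_succ (mul_mem_mul_pow_succ (h2 1) (hy 0)) (hy 0)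
    convert h using 1
    ring
  have h := mul_mem_mul_pow_succ (mul_mem_mul_pow_succ
    (mul_mul_mem_of_ne h1 h0 (by decide) h4) (hy 0)) (hy 1)
  convert h using 1
  ring

theorem span_mul_basisSpan_le (hy : ∀ i, y i ∈ Z)
    (h1 : ∀ i j k, i < j → j < k → y i * y j * y k ∈ L * Z ^ 2) (h2 : ∀ i, y i ^ 3 ∈ L * Z ^ 2)
    (h3 : ∀ i j, i ≠ j → y i * y j ^ 2 - y i * y (partner i) ^ 2 ∈ L * Z ^ 2)
    (n : ℕ) :
    Submodule.span K (Set.range y) * basisSpan K y n ≤ L * Z ^ n ⊔ basisSpan K y (n + 1) := by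
  match n with
  | 0 =>
    rw [basisSpan, mul_one]
    exact le_sup_right
  | 1 => exact le_sup_right
  | 2 =>
    rw [basisSpan, Submodule.span_mul_span, Submodule.span_mul_span, Submodule.span_le]
    rintro _ ⟨_, ⟨i, rfl⟩, _, ⟨_, ⟨j, rfl⟩, _, ⟨k, rfl⟩, rfl⟩, rfl⟩
    exact mul_mul_mem h1 h2 h3 i j k
  | 3 =>
    rw [basisSpan, Submodule.span_mul_span, Submodule.span_le]
    rintro _ ⟨_, ⟨i, rfl⟩, _, ⟨j, rfl⟩, rfl⟩
    exact mul_mul_sq_mem hy h1 h3 i j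
  | 4 =>
    rw [basisSpan, Submodule.span_mul_span, Submodule.span_le]
    rintro _ ⟨_, ⟨i, rfl⟩, _, rfl, rfl⟩
    exact Submodule.mem_sup_left (mul_sq_mul_sq_mem hy h1 h2 i)
  | n + 5 =>
    rw [basisSpan, Submodule.mul_bot]
    · exact bot_le
    all_goals simp

/-- Induction on the degree: multiply a product of lower degree by `L` or by a coordinate. In the
second case a term in `L` stays in `L`, and `span_mul_basisSpan_le` treats the representatives. -/
theorem pow_succ_le (hy : ∀ i, y i ∈ Z)
    (h1 : ∀ i j k, i < j → j < k → y i * y j * y k ∈ L * Z ^ 2) (h2 : ∀ i, y i ^ 3 ∈ L * Z ^ 2)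
    (h3 : ∀ i j, i ≠ j → y i * y j ^ 2 - y i * y (partner i) ^ 2 ∈ L * Z ^ 2)
    (hLZ : Z = L ⊔ Submodule.span K (Set.range y)) (n : ℕ) :
    Z ^ (n + 1) ≤ L * Z ^ n ⊔ basisSpan K y (n + 1) := by
  induction n with
  | zero =>
    rw [pow_zero, zero_add, pow_one, mul_one, basisSpan, ← hLZ]
  | succ n ih =>
    have hL : L ≤ Z := hLZ ▸ le_sup_left
    calc Z ^ (n + 1 + 1) = L * Z ^ (n + 1) ⊔ Submodule.span K (Set.range y) * Z ^ (n + 1) := by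
          rw [pow_succ', ← Submodule.sup_mul, ← hLZ]
      _ ≤ L * Z ^ (n + 1) ⊔ Submodule.span K (Set.range y) *
            (L * Z ^ n ⊔ basisSpan K y (n + 1)) :=
          sup_le_sup_left (mul_le_mul_right ih _) _
      _ = L * Z ^ (n + 1) ⊔ (L * (Submodule.span K (Set.range y) * Z ^ n) ⊔
            Submodule.span K (Set.range y) * basisSpan K y (n + 1)) := by
          rw [Submodule.mul_sup, mul_left_comm]
      _ ≤ L * Z ^ (n + 1) ⊔ (L * Z ^ (n + 1) ⊔
            (L * Z ^ (n + 1) ⊔ basisSpan K y (n + 1 + 1))) := by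
          refine sup_le_sup_left (sup_le_sup ?_ (span_mul_basisSpan_le hy h1 h2 h3 (n + 1))) _
          rw [pow_succ']
          exact mul_le_mul_right (mul_le_mul_left (hLZ ▸ le_sup_right) _) _
      _ = L * Z ^ (n + 1) ⊔ basisSpan K y (n + 1 + 1) := by
          simp only [sup_left_idem]

end Spanning

/-! ### The ring of invariants as a graded module over the parameters -/

section GradedCoefficients

variable {K R : Type*} [Field K] [CommRing R] [Algebra K R]

theorem map_aeval_homogeneousSubmodule {σ : Type*} (g : σ → R) (n : ℕ) :
    (MvPolynomial.homogeneousSubmodule σ K n).map (MvPolynomial.aeval g).toLinearMap =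
      Submodule.span K (Set.range g) ^ n := by
  rw [← MvPolynomial.homogeneousSubmodule_one_pow, Submodule.map_pow,
    MvPolynomial.homogeneousSubmodule_one_eq_span_X, Submodule.map_span, ← Set.range_comp]
  congr 3
  funext i
  simp

/-- Representatives of a basis of the ring of invariants modulo the parameters. -/
def quotBasis (y : Fin 5 → R) : Fin 27 → R :=
  ![1, y 0, y 1, y 2, y 3, y 4, y 0 ^ 2, y 1 ^ 2, y 2 ^ 2, y 3 ^ 2, y 4 ^ 2, y 0 * y 1, y 0 * y 2,
    y 0 * y 3, y 0 * y 4, y 1 * y 2, y 1 * y 3, y 1 * y 4, y 2 * y 3, y 2 * y 4, y 3 * y 4,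
    y 0 * y (partner 0) ^ 2, y 1 * y (partner 1) ^ 2, y 2 * y (partner 2) ^ 2,
    y 3 * y (partner 3) ^ 2, y 4 * y (partner 4) ^ 2, y 0 ^ 2 * y 1 ^ 2]

/-- The degrees of the elements of `quotBasis y`. -/
def quotDegree : Fin 27 → ℕ :=
  ![0, 1, 1, 1, 1, 1, 2, 2, 2, 2, 2, 2, 2, 2, 2, 2, 2, 2, 2, 2, 2, 3, 3, 3, 3, 3, 4]

/-- The linear combination of `quotBasis y` with the given polynomials in `l` as coefficients. -/
def combination (l y : Fin 5 → R) : (Fin 27 → MvPolynomial (Fin 5) K) →ₗ[K] R :=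
  ∑ i, (LinearMap.mulRight K (quotBasis y i)).comp
    ((MvPolynomial.aeval l).toLinearMap.comp (LinearMap.proj i))

theorem combination_apply (l y : Fin 5 → R) (p : Fin 27 → MvPolynomial (Fin 5) K) :
    combination l y p = ∑ i, MvPolynomial.aeval l (p i) * quotBasis y i := by
  simp [combination]

variable (K) in
/-- The families of coefficients for which the linear combination is homogeneous of degree `n`. -/
def gradedCoeff (n : ℕ) : Submodule K (Fin 27 → MvPolynomial (Fin 5) K) :=
  Submodule.pi Set.univ fun i =>
    if quotDegree i ≤ n then MvPolynomial.homogeneousSubmodule (Fin 5) K (n - quotDegree i) else ⊥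

theorem mem_gradedCoeff {n : ℕ} {p : Fin 27 → MvPolynomial (Fin 5) K} :
    p ∈ gradedCoeff K n ↔ ∀ i, (quotDegree i ≤ n → (p i).IsHomogeneous (n - quotDegree i)) ∧
      (n < quotDegree i → p i = 0) := by
  simp only [gradedCoeff, Submodule.mem_pi, Set.mem_univ, true_imp_iff]
  refine forall_congr' fun i => ?_
  split_ifs with h
  · simp [h, h.not_gt]
  · simp [h, not_le.1 h]

theorem quotBasis_mem (y : Fin 5 → R) (i : Fin 27) :
    quotBasis y i ∈ Submodule.span K (Set.range y) ^ quotDegree i := by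
  have h : ∀ i, y i ∈ Submodule.span K (Set.range y) := fun i =>
    Submodule.subset_span (Set.mem_range_self i)
  have h2 : ∀ i j, y i * y j ∈ Submodule.span K (Set.range y) ^ 2 := fun i j => by
    rw [pow_two]
    exact Submodule.mul_mem_mul (h i) (h j)
  have hs : ∀ i, y i ^ 2 ∈ Submodule.span K (Set.range y) ^ 2 := fun i =>
    Submodule.pow_mem_pow _ (h i) 2
  have h3 : ∀ i j, y i * y j ^ 2 ∈ Submodule.span K (Set.range y) ^ 3 := fun i j => by
    rw [pow_succ', pow_two (y j)]
    exact Submodule.mul_mem_mul (h i) (h2 j j)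
  fin_cases i
  · exact Submodule.one_le.1 (pow_zero (Submodule.span K (Set.range y))).ge
  iterate 5
    · exact (pow_one (Submodule.span K (Set.range y))).ge (h _)
  iterate 5
    · exact hs _
  iterate 10
    · exact h2 _ _
  iterate 5
    · exact h3 _ _
  · have e : y 0 ^ 2 * y 1 ^ 2 = y 0 * (y 0 * y 1 ^ 2) := by ring
    change y 0 ^ 2 * y 1 ^ 2 ∈ Submodule.span K (Set.range y) ^ 4
    rw [e, pow_succ']
    exact Submodule.mul_mem_mul (h 0) (h3 0 1)

theorem quotBasis_mem_map (l y : Fin 5 → R) (i : Fin 27) :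
    quotBasis y i ∈ (gradedCoeff K (quotDegree i)).map (combination l y) := by
  classical
  refine ⟨Pi.single i 1, mem_gradedCoeff.2 fun j => ?_, ?_⟩
  · rcases eq_or_ne j i with rfl | h
    · simp [MvPolynomial.isHomogeneous_one]
    · simp [h, MvPolynomial.isHomogeneous_zero]
  · rw [combination_apply, Finset.sum_eq_single i]
    · simp
    · intro j _ h
      simp [h]
    · simp

/-- The position of a product of two coordinates in `quotBasis y`. -/
def pairIndex : Fin 5 → Fin 5 → Fin 27 :=
  ![![6, 11, 12, 13, 14], ![11, 7, 15, 16, 17], ![12, 15, 8, 18, 19], ![13, 16, 18, 9, 20],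
    ![14, 17, 19, 20, 10]]

theorem basisSpan_le (l y : Fin 5 → R) (n : ℕ) :
    basisSpan K y n ≤ (gradedCoeff K n).map (combination l y) := by
  match n with
  | 0 =>
    rw [basisSpan, Submodule.one_le]
    exact quotBasis_mem_map l y 0
  | 1 =>
    rw [basisSpan, Submodule.span_le]
    rintro _ ⟨i, rfl⟩
    fin_cases i
    exacts [quotBasis_mem_map l y 1, quotBasis_mem_map l y 2, quotBasis_mem_map l y 3,
      quotBasis_mem_map l y 4, quotBasis_mem_map l y 5]
  | 2 =>
    rw [basisSpan, Submodule.span_mul_span, Submodule.span_le]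
    rintro _ ⟨_, ⟨i, rfl⟩, _, ⟨j, rfl⟩, rfl⟩
    have h := quotBasis_mem_map (K := K) l y (pairIndex i j)
    have e : quotBasis y (pairIndex i j) = y i * y j := by
      fin_cases i <;> fin_cases j <;> simp [quotBasis, pairIndex] <;> ring
    have d : quotDegree (pairIndex i j) = 2 := by
      clear h e
      revert i j
      decide
    rwa [e, d] at h
  | 3 =>
    rw [basisSpan, Submodule.span_le]
    rintro _ ⟨i, rfl⟩
    fin_cases i
    exacts [quotBasis_mem_map l y 21, quotBasis_mem_map l y 22, quotBasis_mem_map l y 23,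
      quotBasis_mem_map l y 24, quotBasis_mem_map l y 25]
  | 4 =>
    rw [basisSpan, Submodule.span_le, Set.singleton_subset_iff]
    exact quotBasis_mem_map l y 26
  | n + 5 =>
    rw [basisSpan]
    · exact bot_le
    all_goals simp

theorem span_mul_map_combination_le (l y : Fin 5 → R) (n : ℕ) :
    Submodule.span K (Set.range l) * (gradedCoeff K n).map (combination l y) ≤
      (gradedCoeff K (n + 1)).map (combination l y) := by
  rw [Submodule.mul_le]
  rintro a ha _ ⟨p, hp, rfl⟩
  induction ha using Submodule.span_induction with
  | mem a ha =>
    obtain ⟨j, rfl⟩ := ha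
    refine ⟨fun i => MvPolynomial.X j * p i, mem_gradedCoeff.2 fun i => ⟨fun h => ?_, fun h => ?_⟩,
      ?_⟩
    · rcases Nat.lt_or_ge n (quotDegree i) with h' | h'
      · rw [((mem_gradedCoeff.1 hp) i).2 h', mul_zero]
        exact MvPolynomial.isHomogeneous_zero _ _ _
      · rw [Nat.sub_add_comm h', add_comm]
        exact (MvPolynomial.isHomogeneous_X K j).mul (((mem_gradedCoeff.1 hp) i).1 h')
    · rw [((mem_gradedCoeff.1 hp) i).2 (by omega), mul_zero]
    · simp only [combination_apply, map_mul, MvPolynomial.aeval_X, Finset.mul_sum, mul_assoc]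
  | zero => simp
  | add a b _ _ ha hb =>
    rw [add_mul]
    exact add_mem ha hb
  | smul c a _ ha =>
    rw [Algebra.smul_mul_assoc]
    exact Submodule.smul_mem _ _ ha

theorem map_combination_le (l y : Fin 5 → R) (n : ℕ) :
    (gradedCoeff K n).map (combination l y) ≤
      (Submodule.span K (Set.range l) ⊔ Submodule.span K (Set.range y)) ^ n := by
  rintro _ ⟨p, hp, rfl⟩
  rw [combination_apply]
  refine sum_mem fun i _ => ?_
  rcases Nat.lt_or_ge n (quotDegree i) with h | h
  · rw [((mem_gradedCoeff.1 hp) i).2 h, map_zero, zero_mul]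
    exact zero_mem _
  · rw [← Nat.sub_add_cancel h, pow_add]
    refine Submodule.mul_mem_mul ?_ ?_
    · refine pow_le_pow_left' (le_sup_left : Submodule.span K (Set.range l) ≤ _) _ ?_
      rw [← map_aeval_homogeneousSubmodule]
      exact ⟨p i, ((mem_gradedCoeff.1 hp) i).1 h, rfl⟩
    · exact pow_le_pow_left' (le_sup_right : Submodule.span K (Set.range y) ≤ _) _
        (quotBasis_mem y i)

/-- Iterating `pow_succ_le` replaces the factor `Zⁿ` by combinations with polynomial coefficients in
the parameters, so the `27` elements generate the ring of invariants degree by degree. -/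
theorem fullSpan_pow (hK : (2 : K) ≠ 0) (t : R) (v : Fin 6 → R) (n : ℕ) :
    fullSpan K (scaledGamma t v) ^ n = (gradedCoeff K n).map
      (combination (params (scaledGamma t v)) (coords (scaledGamma t v))) := by
  obtain ⟨h1, h2, h3⟩ := coords_cubic hK t v
  refine le_antisymm ?_ (map_combination_le _ _ n)
  cases n with
  | zero =>
    rw [pow_zero]
    exact basisSpan_le _ _ 0
  | succ n =>
    induction n with
    | zero =>
      refine (pow_succ_le (fun i => ?_) h1 h2 h3 rfl 0).trans ?_
      · exact Submodule.mem_sup_right (Submodule.subset_span (Set.mem_range_self i))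
      refine sup_le ?_ (basisSpan_le _ _ _)
      rw [pow_zero]
      exact (mul_le_mul_right (basisSpan_le _ _ 0) _).trans (span_mul_map_combination_le _ _ 0)
    | succ n ih =>
      refine (pow_succ_le (fun i => ?_) h1 h2 h3 rfl (n + 1)).trans ?_
      · exact Submodule.mem_sup_right (Submodule.subset_span (Set.mem_range_self i))
      exact sup_le ((mul_le_mul_right ih _).trans (span_mul_map_combination_le _ _ _))
        (basisSpan_le _ _ _)

theorem scaledGamma_mem_fullSpan (hK : (2 : K) ≠ 0) (t : R) (v : Fin 6 → R) (n : Fin 40) :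
    scaledGamma t v n ∈ fullSpan K (scaledGamma t v) := by
  refine mem_of_two_pow_mul_mem hK _ 2 ?_
    ((by norm_num : (2 : R) ^ 2 * _ = 4 * _).trans (four_mul_scaledGamma t v n))
  refine add_mem (sum_mem fun i _ => intCast_mul_mem _ ?_ _) (coordForm_mem (fun i => ?_) n)
  · exact Submodule.mem_sup_left (Submodule.subset_span (Set.mem_range_self i))
  · exact Submodule.mem_sup_right (Submodule.subset_span (Set.mem_range_self i))

theorem span_scaledGamma (hK : (2 : K) ≠ 0) (t : R) (v : Fin 6 → R) :
    Submodule.span K (Set.range (scaledGamma t v)) = fullSpan K (scaledGamma t v) := by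
  have h : ∀ n, scaledGamma t v n ∈ Submodule.span K (Set.range (scaledGamma t v)) := fun n =>
    Submodule.subset_span (Set.mem_range_self n)
  refine le_antisymm (Submodule.span_le.2 ?_) (sup_le (Submodule.span_le.2 ?_)
    (Submodule.span_le.2 ?_))
  · rintro _ ⟨n, rfl⟩
    exact scaledGamma_mem_fullSpan hK t v n
  · rintro _ ⟨i, rfl⟩
    fin_cases i
    · exact h 6
    · exact h 15
    · exact h 24
    · exact h 33
    · exact sub_mem (add_mem (add_mem (h 0) (h 7)) (h 20)) (h 37)
  · rintro _ ⟨i, rfl⟩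
    fin_cases i
    · exact sub_mem (h 36) (h 12)
    · exact sub_mem (neg_mem (h 19)) (h 35)
    · exact add_mem (h 36) (h 12)
    · exact add_mem (h 17) (h 32)
    · exact sub_mem (neg_mem (h 14)) (h 31)

end GradedCoefficients

/-! ### Algebraic independence of the parameters -/

section AlgebraicIndependence

/-- In a relation, viewed as a polynomial in `l 0`, the map `τ` annihilates all but the constant
coefficient, which therefore vanishes by independence of the images. Then `l 0` can be cancelled,
and the degree in `l 0` drops. -/
theorem algebraicIndependent_succ_of_algHom {K A B : Type*} [Field K] [CommRing A] [IsDomain A]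
    [CommRing B] [Algebra K A] [Algebra K B] {n : ℕ} {l : Fin (n + 1) → A} (τ : A →ₐ[K] B)
    (h0 : l 0 ≠ 0) (hτ : τ (l 0) = 0) (h : AlgebraicIndependent K fun i => τ (l (Fin.succ i))) :
    AlgebraicIndependent K l := by
  rw [algebraicIndependent_iff_injective_aeval, injective_iff_map_eq_zero] at h ⊢
  have key : ∀ (m : ℕ) (p : Polynomial (MvPolynomial (Fin n) K)), p.natDegree < m →
      Polynomial.eval₂ (MvPolynomial.aeval fun i => l (Fin.succ i)).toRingHom (l 0) p = 0 →
        p = 0 := by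
    intro m
    induction m with
    | zero => intro p hp; omega
    | succ m ih =>
      intro p hp h'
      have hc : p.coeff 0 = 0 := by
        apply h
        have e := congrArg τ h'
        rw [map_zero, ← AlgHom.coe_toRingHom, Polynomial.hom_eval₂, AlgHom.coe_toRingHom, hτ,
          Polynomial.eval₂_at_zero] at e
        rw [← e]
        change _ = τ (MvPolynomial.aeval _ _)
        rw [← AlgHom.comp_apply, MvPolynomial.comp_aeval]
      rw [← Polynomial.divX_mul_X_add p, hc, map_zero, add_zero] at h' ⊢
      rw [Polynomial.eval₂_mul, Polynomial.eval₂_X] at h'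
      rcases Nat.eq_zero_or_pos p.natDegree with hd | hd
      · rw [Polynomial.divX_eq_zero_iff.2 (Polynomial.eq_C_of_natDegree_eq_zero hd ), zero_mul]
      · rw [ih p.divX (by rw [Polynomial.natDegree_divX_eq_natDegree_tsub_one]; omega)
          ((mul_eq_zero.1 h').resolve_right h0), zero_mul]
  intro p hp
  rw [← (MvPolynomial.finSuccEquiv K n).map_eq_zero_iff]
  refine key _ _ (Nat.lt_succ_self _) ?_
  rw [← hp]
  have e : (Polynomial.eval₂RingHom (MvPolynomial.aeval fun i => l (Fin.succ i)).toRingHom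
      (l 0)).comp (MvPolynomial.finSuccEquiv K n).toRingEquiv.toRingHom =
        (MvPolynomial.aeval l).toRingHom := by
    apply MvPolynomial.ringHom_ext
    · intro c
      simp [MvPolynomial.finSuccEquiv_apply]
    · intro i
      refine Fin.cases ?_ (fun i => ?_) i <;> simp [MvPolynomial.finSuccEquiv_apply]
  exact congrArg (fun f => f p) e

variable {R S : Type*} [CommRing R] [CommRing S]

theorem map_rowMinor (φ : R →+* S) (x : Matrix (Fin 6) (Fin 3) R) (i j k : Fin 6) :
    φ (rowMinor x i j k) = rowMinor (x.map φ) i j k := by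
  rw [rowMinor, rowMinor, cminor, cminor]
  split_ifs with h
  · rw [RingHom.map_det]
    rfl
  · exact map_zero φ

theorem map_cconic (φ : R →+* S) (x : Matrix (Fin 6) (Fin 3) R) :
    φ (cconic x) = cconic (x.map φ) := by
  rw [cconic, cconic, RingHom.map_det]
  congr 1
  ext i j
  fin_cases j <;> simp [cmonomials]

theorem map_tval (φ : R →+* S) (x : Matrix (Fin 6) (Fin 3) R) (a b c d e f : Fin 6) :
    φ (tval x a b c d e f) = tval (x.map φ) a b c d e f := by
  simp only [tval, map_mul, map_rowMinor, map_cconic]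

theorem map_pval (φ : R →+* S) (x : Matrix (Fin 6) (Fin 3) R) (a b c d e f : Fin 6) :
    φ (pval x a b c d e f) = pval (x.map φ) a b c d e f := by
  simp only [pval, map_mul, map_rowMinor]

theorem map_gammaList (φ : R →+* S) (x : Matrix (Fin 6) (Fin 3) R) (n : Fin 40) :
    φ (gammaList x n) = gammaList (x.map φ) n := by
  fin_cases n
  iterate 10
    · exact map_tval φ x _ _ _ _ _ _
  all_goals exact map_pval φ x _ _ _ _ _ _

theorem map_chart (φ : R →+* S) (v : Fin 6 → R) :
    (chart v).map φ = chart fun i => φ (v i) := by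
  ext i j
  rw [Matrix.map_apply]
  fin_cases i <;> fin_cases j <;> simp [chart]

theorem map_scaledGamma (φ : R →+* S) (t : R) (v : Fin 6 → R) (n : Fin 40) :
    φ (scaledGamma t v n) = scaledGamma (φ t) (fun i => φ (v i)) n := by
  rw [scaledGamma, scaledGamma, map_mul, map_gammaList, map_chart]

theorem map_params (φ : R →+* S) (t : R) (v : Fin 6 → R) (i : Fin 5) :
    φ (params (scaledGamma t v) i) = params (scaledGamma (φ t) fun i => φ (v i)) i := by
  fin_cases i <;> simp [params, map_scaledGamma]

theorem map_coords (φ : R →+* S) (t : R) (v : Fin 6 → R) (i : Fin 5) :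
    φ (coords (scaledGamma t v) i) = coords (scaledGamma (φ t) fun i => φ (v i)) i := by
  fin_cases i <;> simp [coords, map_scaledGamma]

/-- The generic values of the invariants. -/
def genericGamma (K : Type*) [Field K] : Fin 40 → MvPolynomial (Fin 7) K :=
  scaledGamma (MvPolynomial.X (Fin.last 6)) fun i => MvPolynomial.X i.castSucc

theorem aeval_params_genericGamma {K : Type*} [Field K] [Algebra K R] (w : Fin 7 → R)
    (i : Fin 5) : MvPolynomial.aeval w (params (genericGamma K) i) =
      params (scaledGamma (w (Fin.last 6)) fun i => w i.castSucc) i := by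
  have h := map_params (MvPolynomial.aeval (R := K) w).toRingHom (MvPolynomial.X (Fin.last 6))
    (fun i => MvPolynomial.X i.castSucc) i
  simpa [genericGamma] using h

theorem aeval_coords_genericGamma {K : Type*} [Field K] [Algebra K R] (w : Fin 7 → R)
    (i : Fin 5) : MvPolynomial.aeval w (coords (genericGamma K) i) =
      coords (scaledGamma (w (Fin.last 6)) fun i => w i.castSucc) i := by
  have h := map_coords (MvPolynomial.aeval (R := K) w).toRingHom (MvPolynomial.X (Fin.last 6))
    (fun i => MvPolynomial.X i.castSucc) i
  simpa [genericGamma] using h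

theorem params_zero (v : Fin 6 → R) (i : Fin 5) : params (scaledGamma 0 v) i = 0 := by
  fin_cases i <;> simp [params, scaledGamma]

theorem params_scaledGamma (t : R) (v : Fin 6 → R) (i : Fin 5) :
    params (scaledGamma t v) i = t * params (gammaList (chart v)) i := by
  fin_cases i <;> simp [params, scaledGamma]
  ring

theorem coords_scaledGamma (t : R) (v : Fin 6 → R) (i : Fin 5) :
    coords (scaledGamma t v) i = t * coords (gammaList (chart v)) i := by
  fin_cases i <;> simp [coords, scaledGamma] <;> ring

theorem params_scaledGamma_ne_zero {K : Type*} [Field K] {v : Fin 6 → MvPolynomial (Fin 7) K}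
    (w : Fin 7 → K) {i : Fin 5}
    (h : params (gammaList (chart fun j => MvPolynomial.aeval w (v j))) i ≠ 0)
    (hw : w (Fin.last 6) = 1) :
    params (scaledGamma (MvPolynomial.X (Fin.last 6)) v) i ≠ 0 := by
  intro h'
  apply h
  have e := congrArg (MvPolynomial.aeval w).toRingHom h'
  rw [map_params, map_zero, params_scaledGamma] at e
  rw [← (mul_eq_zero.1 e).resolve_left (by simp [show w 6 = 1 from hw])]
  rfl

theorem aeval_params {K : Type*} [Field K] (v : Fin 6 → MvPolynomial (Fin 7) K)
    (w : Fin 7 → MvPolynomial (Fin 7) K) (i : Fin 5) :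
    MvPolynomial.aeval w (params (scaledGamma (MvPolynomial.X (Fin.last 6)) v) i) =
      params (scaledGamma (w (Fin.last 6)) (fun j => MvPolynomial.aeval w (v j))) i := by
  have h := map_params (MvPolynomial.aeval (R := K) w).toRingHom (MvPolynomial.X (Fin.last 6)) v i
  simpa using h

/-- One specialisation step: `w` turns the sextuple `V` into `V'` and kills the first remaining
parameter, which is nonzero at `V` because of the test point `u`. -/
theorem algebraicIndependent_params_succ {K : Type*} [Field K] {n : ℕ} {ρ : Fin (n + 1) → Fin 5}
    {V : Fin 6 → MvPolynomial (Fin 7) K} (V' : Fin 6 → MvPolynomial (Fin 7) K)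
    (w : Fin 7 → MvPolynomial (Fin 7) K) (hV : ∀ j, MvPolynomial.aeval w (V j) = V' j)
    (hw : w (Fin.last 6) = MvPolynomial.X (Fin.last 6)) (u : Fin 7 → K)
    (h0 : params (gammaList (chart fun j => MvPolynomial.aeval u (V j))) (ρ 0) ≠ 0)
    (hu : u (Fin.last 6) = 1) (hz : params (gammaList (chart V')) (ρ 0) = 0)
    (ih : AlgebraicIndependent K fun i : Fin n =>
      params (scaledGamma (MvPolynomial.X (Fin.last 6)) V') (ρ i.succ)) :
    AlgebraicIndependent K fun i =>
      params (scaledGamma (MvPolynomial.X (Fin.last 6)) V) (ρ i) := by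
  have e : ∀ i, MvPolynomial.aeval w
      (params (scaledGamma (MvPolynomial.X (Fin.last 6)) V) i) =
        params (scaledGamma (MvPolynomial.X (Fin.last 6)) V') i := by
    intro i
    rw [aeval_params, hw, funext hV]
  apply algebraicIndependent_succ_of_algHom (MvPolynomial.aeval w)
  · exact params_scaledGamma_ne_zero u h0 hu
  · rw [e, params_scaledGamma, hz, mul_zero]
  · simpa only [e] using ih

open MvPolynomial in
theorem algebraicIndependent_params {K : Type*} [Field K] (hK : (2 : K) ≠ 0) :
    AlgebraicIndependent K (params (genericGamma K)) := by
  have e0 : (fun i : Fin 6 => (X i.castSucc : MvPolynomial (Fin 7) K)) =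
      ![X 0, X 1, X 2, X 3, X 4, X 5] := by
    funext i
    fin_cases i <;> rfl
  rw [genericGamma, e0]
  -- The substitutions `v₄ = 0`, `v₁ = v₀`, `v₅ = v₃`, `v₂ = 0` make factors of the first four
  -- parameters vanish in turn; the common factor `X 6` is set to zero for the last one. The
  -- numerical vectors are points where the parameter in question is `± 1`, `± 2` or `± 4`.
  refine algebraicIndependent_params_succ (ρ := fun i => i) ![X 0, X 1, X 2, X 3, 0, X 5]
    ![X 0, X 1, X 2, X 3, 0, X 5, X 6] ?_ rfl ![-1, -1, 0, 0, -1, -1, 1] ?_ rfl ?_ ?_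
  · intro j
    fin_cases j <;> simp
  · simp [params, gammaList_chart, chartConic]
  · simp [params, gammaList_chart, chartConic]
  refine algebraicIndependent_params_succ (ρ := fun i => i.succ) ![X 0, X 0, X 2, X 3, 0, X 5]
    ![X 0, X 0, X 2, X 3, 0, X 5, X 6] ?_ rfl ![0, -1, -1, -1, 0, -1, 1] ?_ rfl ?_ ?_
  · intro j
    fin_cases j <;> simp
  · simp [params, gammaList_chart, chartConic]
  · simp [params, gammaList_chart, chartConic]
  refine algebraicIndependent_params_succ (ρ := fun i => i.succ.succ)
    ![X 0, X 0, X 2, X 3, 0, X 3]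
    ![X 0, X 0, X 2, X 3, 0, X 3, X 6] ?_ rfl ![-1, -1, 0, -1, 0, 1, 1] ?_ rfl ?_ ?_
  · intro j
    fin_cases j <;> simp
  · simp [params, gammaList_chart, chartConic]
    rwa [one_add_one_eq_two]
  · simp [params, gammaList_chart, chartConic]
  refine algebraicIndependent_params_succ (ρ := fun i => i.succ.succ.succ)
    ![X 0, X 0, 0, X 3, 0, X 3]
    ![X 0, X 0, 0, X 3, 0, X 3, X 6] ?_ rfl ![-1, -1, 1, -1, 0, -1, 1] ?_ rfl ?_ ?_
  · intro j
    fin_cases j <;> simp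
  · simp [params, gammaList_chart, chartConic, chartMinor]
    intro h
    exact hK (by linear_combination -h)
  · simp [params, gammaList_chart, chartConic, chartMinor]
  apply algebraicIndependent_succ_of_algHom (B := MvPolynomial (Fin 7) K)
    (aeval ![X 0, X 1, X 2, X 3, X 4, X 5, 0])
  · apply params_scaledGamma_ne_zero ![-1, -1, 0, -1, 0, -1, 1]
    · simp [params, gammaList_chart, chartConic, chartMinor]
      intro h
      exact mul_ne_zero hK hK (by linear_combination -h)
    · rfl
  · rw [aeval_params]
    exact params_zero _ _
  exact algebraicIndependent_empty_type_iff.2 (algebraMap K _).injective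

end AlgebraicIndependence

/-! ### Twenty-seven limit points over one point of the parameter space -/

section LimitPoints

/-- The coordinates of twenty-seven points in the closure of the image of the gamma map, at which
all parameters but the last one vanish. -/
def limitPoint : Fin 27 → Fin 5 → ℤ :=
  ![![-1, -1, -1, -1, 1], ![-1, -1, -1, 1, -1], ![-1, -1, 1, -1, -1], ![-1, -1, 1, 1, 1],
    ![-1, 0, 0, 0, 0], ![-1, 1, -1, -1, -1], ![-1, 1, -1, 1, 1], ![-1, 1, 1, -1, 1],
    ![-1, 1, 1, 1, -1], ![0, -1, 0, 0, 0], ![0, 0, -1, 0, 0], ![0, 0, 0, -1, 0],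
    ![0, 0, 0, 0, -1], ![0, 0, 0, 0, 0], ![0, 0, 0, 0, 1], ![0, 0, 0, 1, 0], ![0, 0, 1, 0, 0],
    ![0, 1, 0, 0, 0], ![1, -1, -1, -1, -1], ![1, -1, -1, 1, 1], ![1, -1, 1, -1, 1],
    ![1, -1, 1, 1, -1], ![1, 0, 0, 0, 0], ![1, 1, -1, -1, 1], ![1, 1, -1, 1, -1],
    ![1, 1, 1, -1, -1], ![1, 1, 1, 1, 1]]

theorem params_chart {R : Type*} [CommRing R] (v : Fin 6 → R) : params (gammaList (chart v)) =
    ![-v 4 * (v 0 - v 2) * ((v 0 * v 2 - v 0 * v 1) * (v 4 * v 5 - v 3 * v 4) - (v 1 * v 2 - v 0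
        * v 1) * (v 3 * v 5 - v 3 * v 4)),
      (v 1 - v 0) * (v 4 - v 3) * (v 1 * v 5 - v 2 * v 4) * (v 2 * v 3 - v 0 * v 5),
      -v 5 * v 0 * (v 3 - v 5) * (v 2 - v 1) * (v 0 * v 4 - v 1 * v 3),
      -v 3 * v 2 * v 1 * (v 5 - v 4) * (v 1 * v 5 - v 2 * v 4 - (v 0 * v 5 - v 2 * v 3) + (v 0 *
        v 4 - v 1 * v 3)),
      (v 1 * v 5 - v 2 * v 4 - (v 0 * v 5 - v 2 * v 3) + (v 0 * v 4 - v 1 * v 3)) * ((v 0 * v 2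
        - v 0 * v 1) * (v 4 * v 5 - v 3 * v 4) - (v 1 * v 2 - v 0 * v 1) * (v 3 * v 5 - v 3 * v
        4)) + v 3 * (v 2 - v 1) * ((v 0 * v 2 - v 0 * v 1) * (v 4 * v 5 - v 3 * v 4) - (v 1 * v 2
        - v 0 * v 1) * (v 3 * v 5 - v 3 * v 4)) - v 1 * (v 5 - v 4) * (v 4 - v 3) * (v 0 - v 2) *
        (v 2 * v 3 - v 0 * v 5) +
        v 0 * v 5 * (v 4 - v 3) * (v 0 - v 2) * (v 1 * v 5 - v 2 * v 4)] := by
  rw [gammaList_chart]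
  funext i
  fin_cases i <;> simp [params, chartConic, chartMinor] <;> ring

theorem coords_chart {R : Type*} [CommRing R] (v : Fin 6 → R) : coords (gammaList (chart v)) =
    ![-v 2 * v 4 * (v 1 - v 0) * (v 5 - v 4) * (v 2 * v 3 - v 0 * v 5) + v 4 * v 3 * v 2 * (v 1
        - v 0) * (v 1 * v 5 - v 2 * v 4 - (v 0 * v 5 - v 2 * v 3) + (v 0 * v 4 - v 1 * v 3)),
      v 4 * (v 2 - v 1) * (v 1 - v 0) * (v 3 - v 5) * (v 2 * v 3 - v 0 * v 5) + v 0 * v 4 * (v 3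
        - v 5) * (v 1 - v 0) * (v 1 * v 5 - v 2 * v 4),
      -v 2 * v 4 * (v 1 - v 0) * (v 5 - v 4) * (v 2 * v 3 - v 0 * v 5) - v 4 * v 3 * v 2 * (v 1
        - v 0) * (v 1 * v 5 - v 2 * v 4 - (v 0 * v 5 - v 2 * v 3) + (v 0 * v 4 - v 1 * v 3)),
      v 2 * v 0 * v 4 * (v 3 - v 5) * (v 1 * v 5 - v 2 * v 4 - (v 0 * v 5 - v 2 * v 3) + (v 0 *
        v 4 - v 1 * v 3)) - v 4 * v 2 * (v 3 - v 5) * (v 2 - v 1) * (v 0 * v 4 - v 1 * v 3),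
      -v 2 * (v 5 - v 4) * (v 3 - v 5) * (v 1 - v 0) * (v 0 * v 4 - v 1 * v 3) + v 3 * v 2 * (v
        1 - v 0) * (v 3 - v 5) * (v 1 * v 5 - v 2 * v 4)] := by
  rw [gammaList_chart]
  funext i
  fin_cases i <;> simp [coords, chartConic, chartMinor] <;> ring

-- Curves `w` in the chart along which all invariants vanish to order at least `m`; after division
-- by `u * s ^ m` the parameters tend to `(0,0,0,0,1)` and the coordinates to the limit point as `s
-- → 0`. The leading coefficient `u` is a unit up to powers of two. The remainders `p` and `q` are
-- recorded so that the claims are polynomial identities, valid over every ring.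
set_option maxHeartbeats 10000000 in
theorem exists_curve {R : Type*} [CommRing R] (s : R) (k : Fin 27) :
    ∃ (w : Fin 6 → R) (m : ℕ) (u : ℤ) (p q : Fin 5 → R), u ∈ [1, -1, 2, -2, -4] ∧
      (∀ i, params (gammaList (chart w)) i =
        s ^ m * (u * (![0, 0, 0, 0, 1] : Fin 5 → R) i + s * p i)) ∧
      ∀ i, coords (gammaList (chart w)) i = s ^ m * (u * limitPoint k i + s * q i) := by
  fin_cases k
  · refine ⟨![s, s + s ^ 2, 1, 1, 1 + s ^ 2, 1 + s], 3, 1,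
      ![1 - 3 * s + 2 * s ^ 2 - 2 * s ^ 3 + s ^ 4 + s ^ 5,
      -1 + 2 * s + s ^ 2 - s ^ 3 - 2 * s ^ 4 - s ^ 5, -1 + s + 2 * s ^ 2 - s ^ 3 - s ^ 4,
      1 - 2 * s - s ^ 2 + 2 * s ^ 3, 1 - 7 * s - 2 * s ^ 2 + 11 * s ^ 3 - s ^ 4 - 3 * s ^ 5],
      ![1 + s + 2 * s ^ 3 - s ^ 4, 3 - s - 2 * s ^ 3 - 3 * s ^ 4 - 2 * s ^ 5,
      3 - 3 * s + 2 * s ^ 2 - 2 * s ^ 3 - s ^ 4, 3 - 3 * s + 2 * s ^ 2 - 2 * s ^ 3 - s ^ 4,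
      -1 - s - 2 * s ^ 2 + 2 * s ^ 3 - s ^ 4],
      by simp, fun i => ?_, fun i => ?_⟩
    · rw [params_chart]
      fin_cases i <;>
        (simp only [Matrix.cons_val, Fin.zero_eta, Fin.mk_one, Fin.reduceFinMk]; push_cast; ring)
    · rw [coords_chart]
      fin_cases i <;>
        (simp only [limitPoint, Matrix.cons_val, Fin.zero_eta, Fin.mk_one, Fin.reduceFinMk]
         push_cast
         ring)
  · refine ⟨![s ^ 2, s, 1, 0, s ^ 2, 1], 5, -1,
      ![1 - s - s ^ 2 + s ^ 3, -1 + 2 * s - s ^ 2, 1 - s, 0, -2 + 5 * s - 2 * s ^ 3],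
      ![-1 - s + s ^ 2, -3 + 3 * s - s ^ 2, -1 - s + s ^ 2, 3 - s - s ^ 2, -1 - s + s ^ 2],
      by simp, fun i => ?_, fun i => ?_⟩
    · rw [params_chart]
      fin_cases i <;>
        (simp only [Matrix.cons_val, Fin.zero_eta, Fin.mk_one, Fin.reduceFinMk]; push_cast; ring)
    · rw [coords_chart]
      fin_cases i <;>
        (simp only [limitPoint, Matrix.cons_val, Fin.zero_eta, Fin.mk_one, Fin.reduceFinMk]
         push_cast
         ring)
  · refine ⟨![0, 1, 1 + s, 1, s, s + s ^ 2], 2, -1,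
      ![-1 - 2 * s - s ^ 2, 0, 0, -1 - s, -3 - s + s ^ 2],
      ![-2 * s - s ^ 2, -2 * s - s ^ 2, -2 - 2 * s - s ^ 2, -2 * s - s ^ 2, -2 * s - s ^ 2],
      by simp, fun i => ?_, fun i => ?_⟩
    · rw [params_chart]
      fin_cases i <;>
        (simp only [Matrix.cons_val, Fin.zero_eta, Fin.mk_one, Fin.reduceFinMk]; push_cast; ring)
    · rw [coords_chart]
      fin_cases i <;>
        (simp only [limitPoint, Matrix.cons_val, Fin.zero_eta, Fin.mk_one, Fin.reduceFinMk]
         push_cast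
         ring)
  · refine ⟨![1, s ^ 2, s, 1, s ^ 2, s + s ^ 2], 5, -1,
      ![-1 + s + s ^ 2 - s ^ 3, -1 + 2 * s ^ 2 - s ^ 4, 0, 1 - s ^ 2,
      -1 + 2 * s + 2 * s ^ 2 - s ^ 3 - s ^ 4],
      ![-1 - 2 * s + s ^ 2 + s ^ 3, -3 + 5 * s ^ 2 - s ^ 3 - 2 * s ^ 4,
      -1 + 2 * s + s ^ 2 - s ^ 3, 1 + 2 * s - s ^ 2 - s ^ 3, 1 + 2 * s - s ^ 2 - s ^ 3],
      by simp, fun i => ?_, fun i => ?_⟩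
    · rw [params_chart]
      fin_cases i <;>
        (simp only [Matrix.cons_val, Fin.zero_eta, Fin.mk_one, Fin.reduceFinMk]; push_cast; ring)
    · rw [coords_chart]
      fin_cases i <;>
        (simp only [limitPoint, Matrix.cons_val, Fin.zero_eta, Fin.mk_one, Fin.reduceFinMk]
         push_cast
         ring)
  · refine ⟨![s + s ^ 2, 1, 1 + s, s - s ^ 2, 1 - s, 1], 3, -2,
      ![1 - s - 2 * s ^ 2 + 2 * s ^ 3 + s ^ 4 - s ^ 5, -1 + 2 * s + s ^ 2 - 3 * s ^ 3 + s ^ 5,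
      1 - s + s ^ 3 - s ^ 4, -1 + 2 * s + s ^ 2 - 2 * s ^ 3,
      2 + 4 * s - 2 * s ^ 2 - 5 * s ^ 3 + 3 * s ^ 5],
      ![-4 + 4 * s ^ 2 - 4 * s ^ 3 + 2 * s ^ 5, 0,
      4 - 6 * s - 6 * s ^ 2 + 8 * s ^ 3 + 2 * s ^ 4 - 2 * s ^ 5,
      2 * s - 2 * s ^ 2 + 2 * s ^ 4 - 2 * s ^ 5, 0],
      by simp, fun i => ?_, fun i => ?_⟩
    · rw [params_chart]
      fin_cases i <;>
        (simp only [Matrix.cons_val, Fin.zero_eta, Fin.mk_one, Fin.reduceFinMk]; push_cast; ring)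
    · rw [coords_chart]
      fin_cases i <;>
        (simp only [limitPoint, Matrix.cons_val, Fin.zero_eta, Fin.mk_one, Fin.reduceFinMk]
         push_cast
         ring)
  · refine ⟨![s, 1, s + s ^ 2, s - s ^ 2, 1, s], 5, 1,
      ![-1 + 2 * s, 1 - 2 * s + 2 * s ^ 2 - s ^ 3, -1 + s + s ^ 2, -1 + s + s ^ 2 - s ^ 3,
      -2 + s + 5 * s ^ 2 - 5 * s ^ 3],
      ![2 * s - s ^ 3, -2 + 2 * s - s ^ 3, 2 - 2 * s ^ 2 + s ^ 3, 2 * s + 2 * s ^ 2 + s ^ 3,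
      2 - 2 * s ^ 2 + s ^ 3],
      by simp, fun i => ?_, fun i => ?_⟩
    · rw [params_chart]
      fin_cases i <;>
        (simp only [Matrix.cons_val, Fin.zero_eta, Fin.mk_one, Fin.reduceFinMk]; push_cast; ring)
    · rw [coords_chart]
      fin_cases i <;>
        (simp only [limitPoint, Matrix.cons_val, Fin.zero_eta, Fin.mk_one, Fin.reduceFinMk]
         push_cast
         ring)
  · refine ⟨![1 + s ^ 2, 1, 1, 1 + s, 1, 1 + s ^ 2], 5, -1,
      ![-1 - s, 1 - 2 * s - s ^ 3, 0, 1 + s, 1 - 4 * s - s ^ 2 - 3 * s ^ 3],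
      ![-1 + s - s ^ 2, 1 - s + s ^ 2, -3 - s - s ^ 2, 1 - s + s ^ 2, -1 + 3 * s - s ^ 2],
      by simp, fun i => ?_, fun i => ?_⟩
    · rw [params_chart]
      fin_cases i <;>
        (simp only [Matrix.cons_val, Fin.zero_eta, Fin.mk_one, Fin.reduceFinMk]; push_cast; ring)
    · rw [coords_chart]
      fin_cases i <;>
        (simp only [limitPoint, Matrix.cons_val, Fin.zero_eta, Fin.mk_one, Fin.reduceFinMk]
         push_cast
         ring)
  · refine ⟨![s ^ 2, 1, s, s, 1, 1], 2, -1,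
      ![-1 + 3 * s - 3 * s ^ 2 + s ^ 3, 0, 1 - 3 * s + 3 * s ^ 2 - s ^ 3, 0,
      4 - 6 * s + 4 * s ^ 2 - s ^ 3],
      ![-2 + 2 * s ^ 2 - s ^ 3, 2 - 2 * s ^ 2 + s ^ 3, 2 - 2 * s ^ 2 + s ^ 3,
      -4 + 6 * s - 4 * s ^ 2 + s ^ 3, 2 - 2 * s ^ 2 + s ^ 3],
      by simp, fun i => ?_, fun i => ?_⟩
    · rw [params_chart]
      fin_cases i <;>
        (simp only [Matrix.cons_val, Fin.zero_eta, Fin.mk_one, Fin.reduceFinMk]; push_cast; ring)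
    · rw [coords_chart]
      fin_cases i <;>
        (simp only [limitPoint, Matrix.cons_val, Fin.zero_eta, Fin.mk_one, Fin.reduceFinMk]
         push_cast
         ring)
  · refine ⟨![1, s, s ^ 2, s, 1, -s ^ 2], 3, 1,
      ![1 - 2 * s ^ 2 + s ^ 4, 1 - 2 * s ^ 2 + s ^ 4, -1 + 2 * s ^ 2 - s ^ 4, 1 - s ^ 4,
      -s + s ^ 2 - 2 * s ^ 3 - s ^ 4 + 2 * s ^ 5],
      ![s - s ^ 2 + s ^ 4, 2 - s - 3 * s ^ 2 + s ^ 4, -2 - s + s ^ 2 + s ^ 4,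
      2 - s - 3 * s ^ 2 + s ^ 4, s + s ^ 2 + 2 * s ^ 3 - s ^ 4 - 2 * s ^ 5],
      by simp, fun i => ?_, fun i => ?_⟩
    · rw [params_chart]
      fin_cases i <;>
        (simp only [Matrix.cons_val, Fin.zero_eta, Fin.mk_one, Fin.reduceFinMk]; push_cast; ring)
    · rw [coords_chart]
      fin_cases i <;>
        (simp only [limitPoint, Matrix.cons_val, Fin.zero_eta, Fin.mk_one, Fin.reduceFinMk]
         push_cast
         ring)
  · refine ⟨![1, 1 + s, 0, s, s + s ^ 2, 1], 2, 2,
      ![1 + 2 * s + s ^ 2, -1 - s, 0, 0, 1 - s],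
      ![0, -2 + 2 * s + 2 * s ^ 2, 0, 0, 0],
      by simp, fun i => ?_, fun i => ?_⟩
    · rw [params_chart]
      fin_cases i <;>
        (simp only [Matrix.cons_val, Fin.zero_eta, Fin.mk_one, Fin.reduceFinMk]; push_cast; ring)
    · rw [coords_chart]
      fin_cases i <;>
        (simp only [limitPoint, Matrix.cons_val, Fin.zero_eta, Fin.mk_one, Fin.reduceFinMk]
         push_cast
         ring)
  · refine ⟨![1, 1 + s, 1 + s ^ 2, 1, 1 + s ^ 2, 1], 5, -2,
      ![1 + s + s ^ 2 + s ^ 3, 1 - 2 * s - s ^ 3, 0, -1 - s - s ^ 2 - s ^ 3,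
      2 + s - s ^ 2 - 2 * s ^ 3],
      ![0, 0, 4 * s + 2 * s ^ 3, 0, 0],
      by simp, fun i => ?_, fun i => ?_⟩
    · rw [params_chart]
      fin_cases i <;>
        (simp only [Matrix.cons_val, Fin.zero_eta, Fin.mk_one, Fin.reduceFinMk]; push_cast; ring)
    · rw [coords_chart]
      fin_cases i <;>
        (simp only [limitPoint, Matrix.cons_val, Fin.zero_eta, Fin.mk_one, Fin.reduceFinMk]
         push_cast
         ring)
  · refine ⟨![s, s, 1, 1, s, s], 2, -2,
      ![-1 + 3 * s - 3 * s ^ 2 + s ^ 3, 0, 1 - 3 * s + 3 * s ^ 2 - s ^ 3, 0, 6 - 6 * s + 2 * s ^ 2],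
      ![0, 0, 0, -6 + 6 * s - 2 * s ^ 2, 0],
      by simp, fun i => ?_, fun i => ?_⟩
    · rw [params_chart]
      fin_cases i <;>
        (simp only [Matrix.cons_val, Fin.zero_eta, Fin.mk_one, Fin.reduceFinMk]; push_cast; ring)
    · rw [coords_chart]
      fin_cases i <;>
        (simp only [limitPoint, Matrix.cons_val, Fin.zero_eta, Fin.mk_one, Fin.reduceFinMk]
         push_cast
         ring)
  · refine ⟨![0, s, 1, s, 0, -1], 3, 2,
      ![0, 1, 0, -1, -2],
      ![0, 0, 0, 0, -2],
      by simp, fun i => ?_, fun i => ?_⟩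
    · rw [params_chart]
      fin_cases i <;>
        (simp only [Matrix.cons_val, Fin.zero_eta, Fin.mk_one, Fin.reduceFinMk]; push_cast; ring)
    · rw [coords_chart]
      fin_cases i <;>
        (simp only [limitPoint, Matrix.cons_val, Fin.zero_eta, Fin.mk_one, Fin.reduceFinMk]
         push_cast
         ring)
  · refine ⟨![1, 1, 0, 1, 0, 1], 0, -4,
      ![0, 0, 0, 0, 0],
      ![0, 0, 0, 0, 0],
      by simp, fun i => ?_, fun i => ?_⟩
    · rw [params_chart]
      fin_cases i <;>
        (simp only [Matrix.cons_val, Fin.zero_eta, Fin.mk_one, Fin.reduceFinMk]; push_cast; ring)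
    · rw [coords_chart]
      fin_cases i <;>
        (simp only [limitPoint, Matrix.cons_val, Fin.zero_eta, Fin.mk_one, Fin.reduceFinMk]
         push_cast
         ring)
  · refine ⟨![1, s, s, 1, 0, s], 3, -2,
      ![0, 0, 0, 1 - s, 3 - s],
      ![0, 0, 0, 0, 4 - 2 * s],
      by simp, fun i => ?_, fun i => ?_⟩
    · rw [params_chart]
      fin_cases i <;>
        (simp only [Matrix.cons_val, Fin.zero_eta, Fin.mk_one, Fin.reduceFinMk]; push_cast; ring)
    · rw [coords_chart]
      fin_cases i <;>
        (simp only [limitPoint, Matrix.cons_val, Fin.zero_eta, Fin.mk_one, Fin.reduceFinMk]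
         push_cast
         ring)
  · refine ⟨![1, 1, 1 + s, 0, 1, s], 2, 2,
      ![1, 0, 1, 0, -2],
      ![0, 0, 0, 2, 0],
      by simp, fun i => ?_, fun i => ?_⟩
    · rw [params_chart]
      fin_cases i <;>
        (simp only [Matrix.cons_val, Fin.zero_eta, Fin.mk_one, Fin.reduceFinMk]; push_cast; ring)
    · rw [coords_chart]
      fin_cases i <;>
        (simp only [limitPoint, Matrix.cons_val, Fin.zero_eta, Fin.mk_one, Fin.reduceFinMk]
         push_cast
         ring)
  · refine ⟨![1, s ^ 2, s, 1, s, 1], 2, -2,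
      ![-1 + 3 * s - 3 * s ^ 2 + s ^ 3, 0, 0, 1 - 3 * s + 3 * s ^ 2 - s ^ 3,
      9 - 15 * s + 11 * s ^ 2 - 3 * s ^ 3],
      ![0, 0, 4 - 4 * s ^ 2 + 2 * s ^ 3, 0, 0],
      by simp, fun i => ?_, fun i => ?_⟩
    · rw [params_chart]
      fin_cases i <;>
        (simp only [Matrix.cons_val, Fin.zero_eta, Fin.mk_one, Fin.reduceFinMk]; push_cast; ring)
    · rw [coords_chart]
      fin_cases i <;>
        (simp only [limitPoint, Matrix.cons_val, Fin.zero_eta, Fin.mk_one, Fin.reduceFinMk]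
         push_cast
         ring)
  · refine ⟨![s ^ 2, 1, 0, s, 1, s ^ 2], 5, 2,
      ![1 - s, -1 + s + s ^ 2 - s ^ 3, -1 + 2 * s - s ^ 2, 0, -5 + 3 * s + 3 * s ^ 2 - 3 * s ^ 3],
      ![0, -2 - 2 * s + 2 * s ^ 2, 0, 0, 0],
      by simp, fun i => ?_, fun i => ?_⟩
    · rw [params_chart]
      fin_cases i <;>
        (simp only [Matrix.cons_val, Fin.zero_eta, Fin.mk_one, Fin.reduceFinMk]; push_cast; ring)
    · rw [coords_chart]
      fin_cases i <;>
        (simp only [limitPoint, Matrix.cons_val, Fin.zero_eta, Fin.mk_one, Fin.reduceFinMk]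
         push_cast
         ring)
  · refine ⟨![1, 1 + s, 1, 1 - s, 1, 1], 3, 1,
      ![0, -1, -1, 0, -2],
      ![-1, -1, 1, -1, 1],
      by simp, fun i => ?_, fun i => ?_⟩
    · rw [params_chart]
      fin_cases i <;>
        (simp only [Matrix.cons_val, Fin.zero_eta, Fin.mk_one, Fin.reduceFinMk]; push_cast; ring)
    · rw [coords_chart]
      fin_cases i <;>
        (simp only [limitPoint, Matrix.cons_val, Fin.zero_eta, Fin.mk_one, Fin.reduceFinMk]
         push_cast
         ring)
  · refine ⟨![1, 0, 1 + s, s, 1, s + s ^ 2], 2, 1,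
      ![1 + s, 0, 1 + 2 * s + s ^ 2, 0, 1],
      ![1, -1, -1, 3 + 2 * s, -1 - 4 * s - 2 * s ^ 2],
      by simp, fun i => ?_, fun i => ?_⟩
    · rw [params_chart]
      fin_cases i <;>
        (simp only [Matrix.cons_val, Fin.zero_eta, Fin.mk_one, Fin.reduceFinMk]; push_cast; ring)
    · rw [coords_chart]
      fin_cases i <;>
        (simp only [limitPoint, Matrix.cons_val, Fin.zero_eta, Fin.mk_one, Fin.reduceFinMk]
         push_cast
         ring)
  · refine ⟨![1, s, s, s, s, 1], 2, -1,
      ![-1 + 3 * s - 3 * s ^ 2 + s ^ 3, 0, 0, 1 - 3 * s + 3 * s ^ 2 - s ^ 3,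
      4 - 6 * s + 4 * s ^ 2 - s ^ 3],
      ![3 - 3 * s + s ^ 2, -3 + 3 * s - s ^ 2, 1 + 3 * s - 5 * s ^ 2 + 2 * s ^ 3,
      -3 + 3 * s - s ^ 2, 5 - 9 * s + 7 * s ^ 2 - 2 * s ^ 3],
      by simp, fun i => ?_, fun i => ?_⟩
    · rw [params_chart]
      fin_cases i <;>
        (simp only [Matrix.cons_val, Fin.zero_eta, Fin.mk_one, Fin.reduceFinMk]; push_cast; ring)
    · rw [coords_chart]
      fin_cases i <;>
        (simp only [limitPoint, Matrix.cons_val, Fin.zero_eta, Fin.mk_one, Fin.reduceFinMk]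
         push_cast
         ring)
  · refine ⟨![1, 1 + s ^ 2, 1 + s, 1, 1 - s, 0], 2, 1,
      ![1 - s - s ^ 2 + s ^ 3, 1 + s - s ^ 2 - s ^ 3, 0, 0, 1 - s - s ^ 2],
      ![-2 * s + s ^ 3, 2 - 2 * s ^ 2 + s ^ 3, -2 * s + s ^ 3, -2 * s + s ^ 3,
      -2 + 2 * s ^ 2 + s ^ 3],
      by simp, fun i => ?_, fun i => ?_⟩
    · rw [params_chart]
      fin_cases i <;>
        (simp only [Matrix.cons_val, Fin.zero_eta, Fin.mk_one, Fin.reduceFinMk]; push_cast; ring)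
    · rw [coords_chart]
      fin_cases i <;>
        (simp only [limitPoint, Matrix.cons_val, Fin.zero_eta, Fin.mk_one, Fin.reduceFinMk]
         push_cast
         ring)
  · refine ⟨![1, 0, 1, 1, 1, 0], 0, -2,
      ![0, 0, 0, 0, 0],
      ![0, 0, 0, 0, 0],
      by simp, fun i => ?_, fun i => ?_⟩
    · rw [params_chart]
      fin_cases i <;>
        (simp only [Matrix.cons_val, Fin.zero_eta, Fin.mk_one, Fin.reduceFinMk]; push_cast; ring)
    · rw [coords_chart]
      fin_cases i <;>
        (simp only [limitPoint, Matrix.cons_val, Fin.zero_eta, Fin.mk_one, Fin.reduceFinMk]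
         push_cast
         ring)
  · refine ⟨![1, s, s ^ 2, 1, s ^ 2, 0], 5, 1,
      ![1 - s - s ^ 2 + s ^ 3, -1 + s + s ^ 2 - s ^ 3, 0, -1 + 2 * s - s ^ 3,
      -5 + 5 * s + s ^ 2 - 2 * s ^ 3],
      ![-3 + 2 * s, -1, 3 - 2 * s - 2 * s ^ 2 + 2 * s ^ 3, 1 + 2 * s - 2 * s ^ 2, -1],
      by simp, fun i => ?_, fun i => ?_⟩
    · rw [params_chart]
      fin_cases i <;>
        (simp only [Matrix.cons_val, Fin.zero_eta, Fin.mk_one, Fin.reduceFinMk]; push_cast; ring)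
    · rw [coords_chart]
      fin_cases i <;>
        (simp only [limitPoint, Matrix.cons_val, Fin.zero_eta, Fin.mk_one, Fin.reduceFinMk]
         push_cast
         ring)
  · refine ⟨![0, 1, s, 1, 1, 1 + s], 2, 1,
      ![-1, 0, 0, -1, -2],
      ![-1, -1, -1, -1, -1],
      by simp, fun i => ?_, fun i => ?_⟩
    · rw [params_chart]
      fin_cases i <;>
        (simp only [Matrix.cons_val, Fin.zero_eta, Fin.mk_one, Fin.reduceFinMk]; push_cast; ring)
    · rw [coords_chart]
      fin_cases i <;>
        (simp only [limitPoint, Matrix.cons_val, Fin.zero_eta, Fin.mk_one, Fin.reduceFinMk]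
         push_cast
         ring)
  · refine ⟨![s ^ 2, 0, 1, s, s ^ 2, 1], 5, 1,
      ![1 - s - s ^ 2 + s ^ 3, -1 + 2 * s - s ^ 2, 1 - s, 0, -3 + 3 * s - s ^ 3],
      ![-2 + s + s ^ 2 - s ^ 3, -2 + s - s ^ 2 + s ^ 3, -3 * s + s ^ 2 + s ^ 3,
      4 - 3 * s - s ^ 2 + s ^ 3, s + s ^ 2 - s ^ 3],
      by simp, fun i => ?_, fun i => ?_⟩
    · rw [params_chart]
      fin_cases i <;>
        (simp only [Matrix.cons_val, Fin.zero_eta, Fin.mk_one, Fin.reduceFinMk]; push_cast; ring)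
    · rw [coords_chart]
      fin_cases i <;>
        (simp only [limitPoint, Matrix.cons_val, Fin.zero_eta, Fin.mk_one, Fin.reduceFinMk]
         push_cast
         ring)
  · refine ⟨![s, 1, s, 0, 1, s], 3, -1,
      ![0, 0, -1 + s, 0, 2 - s],
      ![2 - s, 2 - s, 2 - s, s, 2 - s],
      by simp, fun i => ?_, fun i => ?_⟩
    · rw [params_chart]
      fin_cases i <;>
        (simp only [Matrix.cons_val, Fin.zero_eta, Fin.mk_one, Fin.reduceFinMk]; push_cast; ring)
    · rw [coords_chart]
      fin_cases i <;>
        (simp only [limitPoint, Matrix.cons_val, Fin.zero_eta, Fin.mk_one, Fin.reduceFinMk]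
         push_cast
         ring)

/-- Two of the points differ by `±1` or `±2` in some coordinate, so they remain distinct in every
characteristic other than two. -/
theorem limitPoint_injective {K : Type*} [Field K] (hK : (2 : K) ≠ 0) {k k' : Fin 27}
    (h : k ≠ k') : ∃ j, (limitPoint k j : K) ≠ limitPoint k' j := by
  have key : ∀ k k' : Fin 27, k ≠ k' → ∃ j, limitPoint k j - limitPoint k' j ∈ [1, -1, 2, -2] := by
    decide
  obtain ⟨j, hj⟩ := key k k' h
  refine ⟨j, fun e => ?_⟩
  have e' : ((limitPoint k j - limitPoint k' j : ℤ) : K) = 0 := by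
    rw [Int.cast_sub, e, sub_self]
  simp only [List.mem_cons, List.not_mem_nil, or_false] at hj
  rcases hj with hj | hj | hj | hj <;> simp [hj, hK] at e'

end LimitPoints

/-! ### Algebraic tools: dependence, integrality, separation of points -/

section Freeness

/-- If a power basis type family lies in the span of a dependent family of `n` elements, then the
element satisfies a nonzero polynomial of degree less than `n`. -/
theorem exists_aeval_eq_zero_of_not_linearIndependent {P A : Type*} [CommRing P] [IsDomain P]
    [CommRing A] [IsDomain A] [Algebra P A] [FaithfulSMul P A] {n : ℕ} {b : Fin n → A} {a : A}
    (ha : ∀ m, a ^ m ∈ Submodule.span P (Set.range b)) (hb : ¬ LinearIndependent P b) :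
    ∃ f : Polynomial P, f ≠ 0 ∧ f.natDegree < n ∧ Polynomial.aeval a f = 0 := by
  classical
  rw [Fintype.not_linearIndependent_iff] at hb
  obtain ⟨g, hg, i, hi⟩ := hb
  set s : Finset A := (Finset.univ.erase i).image b with hs
  -- The relation expresses `g i • b i` through the other generators, so `g i` moves the whole span
  -- into the span of at most `n - 1` elements.
  have hmem : ∀ x ∈ Submodule.span P (Set.range b), g i • x ∈ Submodule.span P (s : Set A) := by
    intro x hx
    induction hx using Submodule.span_induction with
    | mem x hx =>
      obtain ⟨j, rfl⟩ := hx
      by_cases hj : j = i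
      · subst hj
        rw [← Finset.add_sum_erase _ _ (Finset.mem_univ j)] at hg
        rw [eq_neg_of_add_eq_zero_left hg]
        refine neg_mem (sum_mem fun k hk => Submodule.smul_mem _ _ (Submodule.subset_span ?_))
        exact Finset.mem_coe.2 (Finset.mem_image_of_mem _ hk)
      · refine Submodule.smul_mem _ _ (Submodule.subset_span (Finset.mem_coe.2
          (Finset.mem_image_of_mem _ ?_)))
        simp [hj]
    | zero => simp
    | add x y _ _ hx hy =>
      rw [smul_add]
      exact add_mem hx hy
    | smul c x _ hx =>
      rw [smul_comm]
      exact Submodule.smul_mem _ _ hx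
  -- The `n` elements `g i • a ^ m`, `m < n`, lie in that smaller span and must be dependent.
  have hn : ¬ LinearIndependent P fun m : Fin n => g i • a ^ (m : ℕ) := by
    intro h
    have hc := linearIndependent_le_span' _ h (s : Set A) (by
      rintro _ ⟨m, rfl⟩
      exact hmem _ (ha m))
    have hcard : Fintype.card s ≤ n - 1 := by
      have h2 := Finset.card_image_le (s := Finset.univ.erase i) (f := b)
      rw [Finset.card_erase_of_mem (Finset.mem_univ i), Finset.card_univ, Fintype.card_fin] at h2
      simpa [hs] using h2
    have : 0 < n := i.pos
    simp only [Cardinal.mk_fin] at hc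
    have h3 : n ≤ Fintype.card s := by exact_mod_cast hc
    omega
  rw [Fintype.not_linearIndependent_iff] at hn
  obtain ⟨c, hc, j, hj⟩ := hn
  refine ⟨∑ m : Fin n, Polynomial.monomial (m : ℕ) (c m * g i), fun h => ?_, ?_, ?_⟩
  · have h2 := congrArg (fun f => f.coeff (j : ℕ)) h
    simp only [Polynomial.finsetSum_coeff, Polynomial.coeff_monomial, Polynomial.coeff_zero] at h2
    rw [Finset.sum_eq_single j] at h2
    · rw [if_pos rfl] at h2
      exact (mul_ne_zero hj hi) h2
    · intro m _ hm
      rw [if_neg (fun h => hm (Fin.ext h))]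
    · simp
  · refine lt_of_le_of_lt (Polynomial.natDegree_sum_le_of_forall_le (n := n - 1) _ _
      fun m _ => (Polynomial.natDegree_monomial_le _).trans (by omega)) ?_
    have := i.pos
    omega
  · rw [map_sum, ← hc]
    refine Finset.sum_congr rfl fun m _ => ?_
    rw [Polynomial.aeval_monomial, map_mul, Algebra.smul_def, Algebra.smul_def, mul_assoc]

/-- The algebra generated by `a` is a submodule of a finitely generated module over a Noetherian
ring. -/
theorem isIntegral_of_pow_mem {P A : Type*} [CommRing P] [IsNoetherianRing P] [CommRing A]
    [Algebra P A] {a : A} {N : Submodule P A} (hN : N.FG) (ha : ∀ m, a ^ m ∈ N) :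
    IsIntegral P a := by
  refine IsIntegral.of_mem_of_fg (Algebra.adjoin P {a}) ?_ a
    (Algebra.subset_adjoin (Set.mem_singleton a))
  have h : Subalgebra.toSubmodule (Algebra.adjoin P {a}) ≤ N := by
    rw [Algebra.adjoin_eq_span, Submodule.span_le]
    rintro x hx
    obtain ⟨m, rfl⟩ := Submonoid.mem_closure_singleton.1 hx
    exact ha m
  exact Submodule.FG.of_le hN h

/-- A linear form that separates the limit points. -/
theorem exists_separating {L : Type*} [Field L] [Infinite L] (hL : (2 : L) ≠ 0) :
    ∃ c : Fin 5 → L, Function.Injective fun k => ∑ j, c j * (limitPoint k j : L) := by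
  classical
  let f : Fin 27 → Fin 27 → MvPolynomial (Fin 5) L := fun k k' =>
    ∑ j, MvPolynomial.C ((limitPoint k j : L) - limitPoint k' j) * MvPolynomial.X j
  have hf : ∀ k k', k ≠ k' → f k k' ≠ 0 := by
    intro k k' h h0
    obtain ⟨j, hj⟩ := limitPoint_injective hL h
    have e := congrArg (MvPolynomial.eval (Pi.single j (1 : L))) h0
    simp only [f, map_sum, map_mul, MvPolynomial.eval_C, MvPolynomial.eval_X, map_zero] at e
    rw [Finset.sum_eq_single j] at e
    · simp only [Pi.single_eq_same, mul_one] at e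
      exact hj (sub_eq_zero.1 e)
    · intro i _ hi
      simp [hi]
    · simp
  -- Over an infinite field some vector `c` lies outside the zero sets of the finitely many linear
  -- forms given by differences of the points. Diagonal pairs contribute the factor `1`.
  have hne : ∏ p : Fin 27 × Fin 27, (if p.1 = p.2 then 1 else f p.1 p.2) ≠ 0 := by
    refine Finset.prod_ne_zero_iff.2 fun p _ => ?_
    split_ifs with h
    · exact one_ne_zero
    · exact hf _ _ h
  obtain ⟨c, hc⟩ : ∃ c : Fin 5 → L, MvPolynomial.eval c
      (∏ p : Fin 27 × Fin 27, (if p.1 = p.2 then 1 else f p.1 p.2)) ≠ 0 := by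
    by_contra! h
    exact hne (MvPolynomial.funext fun x => by rw [h x, map_zero])
  refine ⟨c, fun k k' h => ?_⟩
  by_contra hkk
  rw [map_prod] at hc
  have h1 := Finset.prod_ne_zero_iff.1 hc (k, k') (Finset.mem_univ _)
  simp only [if_neg hkk, f, map_sum, map_mul, MvPolynomial.eval_C, MvPolynomial.eval_X] at h1
  apply h1
  simp only at h
  rw [← sub_eq_zero, ← Finset.sum_sub_distrib] at h
  rw [← h]
  exact Finset.sum_congr rfl fun j _ => by ring

end Freeness

/-! ### Independence of the twenty-seven generators over the parameters -/

section Injectivity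

/-- A monic relation over the polynomial ring in the parameters that is satisfied by a linear
combination of the coordinates specialises to a relation at every limit point. -/
theorem eval₂_limitPoint_eq_zero {L : Type*} [Field L] (hL : (2 : L) ≠ 0) (c : Fin 5 → L)
    (f : Polynomial (MvPolynomial (Fin 5) L))
    (hf : f.eval₂ (MvPolynomial.aeval (params (genericGamma L))).toRingHom
      (∑ j, c j • coords (genericGamma L) j) = 0) (k : Fin 27) :
    f.eval₂ (MvPolynomial.eval ![0, 0, 0, 0, 1]) (∑ j, c j * (limitPoint k j : L)) = 0 := by
  obtain ⟨w, m, u, p, q, hu, hp, hq⟩ := exists_curve (Polynomial.X : Polynomial L) k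
  have hu0 : (u : L) ≠ 0 := by
    have h4 : (4 : L) ≠ 0 := by
      rw [show (4 : L) = 2 * 2 by norm_num]
      exact mul_ne_zero hL hL
    simp only [List.mem_cons, List.not_mem_nil, or_false] at hu
    rcases hu with rfl | rfl | rfl | rfl | rfl <;> simp [hL, h4]
  set F := FractionRing (Polynomial L)
  set ι : Polynomial L →ₐ[L] F := IsScalarTower.toAlgHom L (Polynomial L) F with hι
  have hinj : Function.Injective ι := IsFractionRing.injective (Polynomial L) F
  have hX : ι (Polynomial.X ^ m) ≠ 0 := by
    rw [Ne, map_eq_zero_iff ι hinj]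
    exact pow_ne_zero _ Polynomial.X_ne_zero
  set t : F := algebraMap L F (u : L)⁻¹ * (ι (Polynomial.X ^ m))⁻¹ with ht
  set p' : Fin 5 → Polynomial L := fun i => Polynomial.C (u : L)⁻¹ *
    ((u : Polynomial L) * (![0, 0, 0, 0, 1] : Fin 5 → Polynomial L) i + Polynomial.X * p i) with hp'
  set q' : Fin 5 → Polynomial L := fun i => Polynomial.C (u : L)⁻¹ *
    ((u : Polynomial L) * (limitPoint k i : Polynomial L) + Polynomial.X * q i) with hq'
  -- Restriction to the curve, with the scaling variable sent to `1 / (u * s ^ m)`. The parameters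
  -- and coordinates then have values in `L[s]`, so that `s = 0` may be inserted afterwards.
  set θ : MvPolynomial (Fin 7) L →ₐ[L] F :=
    MvPolynomial.aeval (Fin.snoc (α := fun _ => F) (fun i => ι (w i)) t) with hθ
  have hC : algebraMap L F (u : L)⁻¹ = ι (Polynomial.C (u : L)⁻¹) := by
    rw [← Polynomial.algebraMap_eq, AlgHom.commutes]
  have hθp : ∀ i, θ (params (genericGamma L) i) = ι (p' i) := by
    intro i
    rw [hθ, aeval_params_genericGamma]
    simp only [Fin.snoc_last, Fin.snoc_castSucc]
    have h := map_params ι.toRingHom 1 w i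
    simp only [AlgHom.toRingHom_eq_coe, RingHom.coe_coe, map_one] at h
    rw [params_scaledGamma, ← one_mul (params (gammaList _) i), ← params_scaledGamma, ← h,
      params_scaledGamma, one_mul, hp, hp', map_mul ι (Polynomial.X ^ m), map_mul ι, ht, hC]
    rw [mul_assoc, inv_mul_cancel_left₀ hX]
  have hθq : ∀ i, θ (coords (genericGamma L) i) = ι (q' i) := by
    intro i
    rw [hθ, aeval_coords_genericGamma]
    simp only [Fin.snoc_last, Fin.snoc_castSucc]
    have h := map_coords ι.toRingHom 1 w i
    simp only [AlgHom.toRingHom_eq_coe, RingHom.coe_coe, map_one] at h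
    rw [coords_scaledGamma, ← one_mul (coords (gammaList _) i), ← coords_scaledGamma, ← h,
      coords_scaledGamma, one_mul, hq, hq', map_mul ι (Polynomial.X ^ m), map_mul ι, ht, hC]
    rw [mul_assoc, inv_mul_cancel_left₀ hX]
  have h1 : f.eval₂ (MvPolynomial.aeval p').toRingHom (∑ j, c j • q' j) = 0 := by
    apply hinj
    have h2 := congrArg θ hf
    rw [map_zero, ← AlgHom.coe_toRingHom, Polynomial.hom_eval₂] at h2
    rw [map_zero, ← h2, ← AlgHom.coe_toRingHom, Polynomial.hom_eval₂]
    congr 1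
    · apply MvPolynomial.ringHom_ext
      · intro a
        simpa using ι.commutes a
      · intro i
        simp [hθp]
    · simp [hθq]
  have h2 := congrArg (Polynomial.evalRingHom (0 : L)) h1
  rw [map_zero, Polynomial.hom_eval₂] at h2
  refine Eq.trans ?_ h2
  congr 1
  · apply MvPolynomial.ringHom_ext
    · intro a
      simp
    · intro i
      fin_cases i <;> simp [hp', hu0]
  · simp [hq', hu0]

/-- A dependence would make the separating linear form `a` algebraic of degree `< 27` over the
parameters, while its monic equation must have `27` distinct roots at the point `(0,0,0,0,1)`. -/
theorem combination_injective_of_infinite {L : Type*} [Field L] [Infinite L] (hL : (2 : L) ≠ 0) :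
    Function.Injective
      (combination (K := L) (params (genericGamma L)) (coords (genericGamma L))) := by
  classical
  have hai := algebraicIndependent_params hL
  let : Algebra (MvPolynomial (Fin 5) L) (MvPolynomial (Fin 7) L) :=
    (MvPolynomial.aeval (params (genericGamma L))).toRingHom.toAlgebra
  have hmap : ∀ x : MvPolynomial (Fin 5) L, algebraMap (MvPolynomial (Fin 5) L)
      (MvPolynomial (Fin 7) L) x = MvPolynomial.aeval (params (genericGamma L)) x := fun _ => rfl
  have : FaithfulSMul (MvPolynomial (Fin 5) L) (MvPolynomial (Fin 7) L) :=
    (faithfulSMul_iff_algebraMap_injective _ _).2 hai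
  set b := quotBasis (coords (genericGamma L)) with hb
  have hli : LinearIndependent (MvPolynomial (Fin 5) L) b := by
    by_contra hli
    obtain ⟨c, hc⟩ := exists_separating hL
    set a : MvPolynomial (Fin 7) L := ∑ j, c j • coords (genericGamma L) j with ha
    have hZ : a ∈ fullSpan L (genericGamma L) := sum_mem fun j _ => Submodule.smul_mem _ _
      (Submodule.mem_sup_right (Submodule.subset_span (Set.mem_range_self j)))
    have hpow : ∀ m, a ^ m ∈ Submodule.span (MvPolynomial (Fin 5) L) (Set.range b) := by
      intro m
      have h := Submodule.pow_mem_pow _ hZ m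
      rw [genericGamma, fullSpan_pow hL] at h
      obtain ⟨p, -, hp⟩ := h
      rw [← hp, combination_apply]
      refine sum_mem fun i _ => ?_
      have h2 := Submodule.smul_mem (Submodule.span (MvPolynomial (Fin 5) L) (Set.range b)) (p i)
        (Submodule.subset_span (Set.mem_range_self i))
      rwa [Algebra.smul_def, hmap] at h2
    obtain ⟨f, hf0, hfd, hfa⟩ := exists_aeval_eq_zero_of_not_linearIndependent hpow hli
    have hint : IsIntegral (MvPolynomial (Fin 5) L) a :=
      isIntegral_of_pow_mem (Submodule.fg_span (Set.finite_range b)) hpow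
    -- A polynomial ring is integrally closed, so the minimal polynomial over it is monic and of
    -- minimal degree among all nonzero equations for `a`. Monicity keeps the specialised polynomial
    -- nonzero.
    have hdeg : (minpoly (MvPolynomial (Fin 5) L) a).natDegree < 27 := by
      have h := minpoly.IsIntegrallyClosed.degree_le_of_ne_zero hf0 hfa
      exact (Polynomial.natDegree_le_natDegree h).trans_lt hfd
    have hroot := fun k => eval₂_limitPoint_eq_zero hL c _ (minpoly.aeval _ a) k
    set e : MvPolynomial (Fin 5) L →+* L := MvPolynomial.eval ![0, 0, 0, 0, 1]
    have hmon := (minpoly.monic hint).map e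
    have hcard := Polynomial.card_roots' ((minpoly (MvPolynomial (Fin 5) L) a).map e)
    have hsub : Finset.univ.image (fun k => ∑ j, c j * (limitPoint k j : L)) ⊆
        ((minpoly (MvPolynomial (Fin 5) L) a).map e).roots.toFinset := by
      intro x hx
      obtain ⟨k, -, rfl⟩ := Finset.mem_image.1 hx
      rw [Multiset.mem_toFinset, Polynomial.mem_roots hmon.ne_zero, Polynomial.IsRoot,
        Polynomial.eval_map]
      exact hroot k
    have h27 := Finset.card_le_card hsub
    rw [Finset.card_image_of_injective _ hc, Finset.card_univ, Fintype.card_fin] at h27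
    have h3 := Multiset.toFinset_card_le
      ((minpoly (MvPolynomial (Fin 5) L) a).map e).roots
    have h4 := Polynomial.natDegree_map_le (f := e) (p := minpoly (MvPolynomial (Fin 5) L) a)
    omega
  rw [← LinearMap.ker_eq_bot, LinearMap.ker_eq_bot']
  intro p hp
  funext i
  refine Fintype.linearIndependent_iff.1 hli p ?_ i
  rw [← hp, combination_apply]
  exact Finset.sum_congr rfl fun i _ => by rw [Algebra.smul_def, hmap]

/-- The separating form needs an infinite field; a relation over `K` is viewed over the algebraic
closure. -/
theorem combination_injective {K : Type*} [Field K] (hK : (2 : K) ≠ 0) :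
    Function.Injective
      (combination (K := K) (params (genericGamma K)) (coords (genericGamma K))) := by
  set L := AlgebraicClosure K
  have hinj := (algebraMap K L).injective
  have hL : (2 : L) ≠ 0 := by
    have h := (map_ne_zero (algebraMap K L)).2 hK
    rwa [map_ofNat] at h
  rw [← LinearMap.ker_eq_bot, LinearMap.ker_eq_bot']
  intro p hp
  have hg : ∀ n, MvPolynomial.map (algebraMap K L) (genericGamma K n) = genericGamma L n := by
    intro n
    simp [genericGamma, map_scaledGamma]
  have hpar : ∀ i, MvPolynomial.map (algebraMap K L) (params (genericGamma K) i) =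
      params (genericGamma L) i := by
    intro i
    simp [genericGamma, map_params]
  have hcoo : ∀ i, MvPolynomial.map (algebraMap K L) (coords (genericGamma K) i) =
      coords (genericGamma L) i := by
    intro i
    simp [genericGamma, map_coords]
  have hb : ∀ i, MvPolynomial.map (algebraMap K L) (quotBasis (coords (genericGamma K)) i) =
      quotBasis (coords (genericGamma L)) i := by
    intro i
    fin_cases i <;> simp [quotBasis, hcoo]
  have h : combination (K := L) (params (genericGamma L)) (coords (genericGamma L))
      (fun i => MvPolynomial.map (algebraMap K L) (p i)) = 0 := by
    have h1 := congrArg (MvPolynomial.map (algebraMap K L)) hp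
    rw [map_zero, combination_apply, map_sum] at h1
    rw [← h1, combination_apply]
    refine Finset.sum_congr rfl fun i _ => ?_
    rw [map_mul, hb]
    congr 1
    have e : (MvPolynomial.aeval (params (genericGamma L))).toRingHom.comp
        (MvPolynomial.map (algebraMap K L)) = (MvPolynomial.map (algebraMap K L)).comp
          (MvPolynomial.aeval (params (genericGamma K))).toRingHom := by
      apply MvPolynomial.ringHom_ext
      · intro a
        simp [MvPolynomial.algebraMap_eq]
      · intro i
        simp [hpar]
    exact congrArg (fun f => f (p i)) e
  have h0 := combination_injective_of_infinite hL (h.trans (map_zero _).symm)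
  funext i
  exact MvPolynomial.map_injective _ hinj ((congrFun h0 i).trans (map_zero _).symm)

end Injectivity

/-! ### Behaviour of the invariants under rescaling and linear maps -/

section Scaling

theorem cminor_mul {R : Type*} [CommRing R] (x : Matrix (Fin 6) (Fin 3) R)
    (G : Matrix (Fin 3) (Fin 3) R) (S : Finset (Fin 6)) :
    cminor (x * G) S = cminor x S * G.det := by
  rw [cminor, cminor]
  split_ifs with h
  · rw [← Matrix.det_mul]
    rfl
  · rw [zero_mul]

theorem rowMinor_mul {R : Type*} [CommRing R] (x : Matrix (Fin 6) (Fin 3) R)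
    (G : Matrix (Fin 3) (Fin 3) R) (i j k : Fin 6) :
    rowMinor (x * G) i j k = rowMinor x i j k * G.det := by
  rw [rowMinor, rowMinor, ← cminor_mul]

theorem rowMinor_diagonal_mul {R : Type*} [CommRing R] (x : Matrix (Fin 6) (Fin 3) R)
    (d : Fin 6 → R) {i j k : Fin 6} (hij : i ≠ j) (hik : i ≠ k) (hjk : j ≠ k) :
    rowMinor (Matrix.diagonal d * x) i j k = d i * d j * d k * rowMinor x i j k := by
  have hc : ({i, j, k} : Finset (Fin 6)).card = 3 :=
    Finset.card_eq_three.2 ⟨i, j, k, hij, hik, hjk, rfl⟩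
  have hp : ∏ l, d (({i, j, k} : Finset (Fin 6)).orderEmbOfFin hc l) = d i * d j * d k := by
    have h := Finset.prod_image (s := Finset.univ) (f := d)
      (g := ({i, j, k} : Finset (Fin 6)).orderEmbOfFin hc)
      fun a _ b _ h => (Finset.orderEmbOfFin _ hc).injective h
    rw [← h, Finset.image_orderEmbOfFin_univ, Finset.prod_insert, Finset.prod_insert,
      Finset.prod_singleton, mul_assoc]
    · simpa using hjk
    · simpa using ⟨hij, hik⟩
  rw [rowMinor, rowMinor, cminor, cminor, dif_pos hc, dif_pos hc, ← hp, ← Matrix.det_mul_column]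
  congr 1
  ext a b
  simp [Matrix.diagonal_mul]

theorem cconic_diagonal_mul {R : Type*} [CommRing R] (x : Matrix (Fin 6) (Fin 3) R)
    (d : Fin 6 → R) : cconic (Matrix.diagonal d * x) = (∏ i, d i) ^ 2 * cconic x := by
  rw [cconic, cconic, ← Finset.prod_pow, ← Matrix.det_mul_column]
  congr 1
  ext a b
  fin_cases b <;> simp [cmonomials, Matrix.diagonal_mul] <;> ring

/-- The action of a matrix on quadratic monomials. -/
def symSquare {R : Type*} [CommRing R] (G : Matrix (Fin 3) (Fin 3) R) :
    Matrix (Fin 6) (Fin 6) R :=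
  !![G 0 0 ^ 2, G 0 1 ^ 2, G 0 2 ^ 2, G 0 0 * G 0 1, G 0 0 * G 0 2, G 0 1 * G 0 2;
    G 1 0 ^ 2, G 1 1 ^ 2, G 1 2 ^ 2, G 1 0 * G 1 1, G 1 0 * G 1 2, G 1 1 * G 1 2;
    G 2 0 ^ 2, G 2 1 ^ 2, G 2 2 ^ 2, G 2 0 * G 2 1, G 2 0 * G 2 2, G 2 1 * G 2 2;
    2 * G 0 0 * G 1 0, 2 * G 0 1 * G 1 1, 2 * G 0 2 * G 1 2, G 0 0 * G 1 1 + G 1 0 * G 0 1,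
      G 0 0 * G 1 2 + G 1 0 * G 0 2, G 0 1 * G 1 2 + G 1 1 * G 0 2;
    2 * G 0 0 * G 2 0, 2 * G 0 1 * G 2 1, 2 * G 0 2 * G 2 2, G 0 0 * G 2 1 + G 2 0 * G 0 1,
      G 0 0 * G 2 2 + G 2 0 * G 0 2, G 0 1 * G 2 2 + G 2 1 * G 0 2;
    2 * G 1 0 * G 2 0, 2 * G 1 1 * G 2 1, 2 * G 1 2 * G 2 2, G 1 0 * G 2 1 + G 2 0 * G 1 1,
      G 1 0 * G 2 2 + G 2 0 * G 1 2, G 1 1 * G 2 2 + G 2 1 * G 1 2]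

theorem cconic_mul {R : Type*} [CommRing R] (x : Matrix (Fin 6) (Fin 3) R)
    (G : Matrix (Fin 3) (Fin 3) R) : cconic (x * G) = cconic x * (symSquare G).det := by
  rw [cconic, cconic, ← Matrix.det_mul]
  congr 1
  ext a b
  rw [Matrix.mul_apply, Fin.sum_univ_six]
  fin_cases b <;> simp [cmonomials, symSquare, Matrix.mul_apply, Fin.sum_univ_three] <;> ring

/-- Six points that impose independent conditions on conics. -/
def frame (R : Type*) [CommRing R] : Matrix (Fin 6) (Fin 3) R :=
  !![1, 0, 0; 0, 1, 0; 0, 0, 1; 1, 1, 0; 1, 0, 1; 0, 1, 1]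

theorem cconic_frame (R : Type*) [CommRing R] : cconic (frame R) = 1 := by
  have e : (Matrix.of fun i => cmonomials (frame R i)) =
      !![1, 0, 0, 0, 0, 0; 0, 1, 0, 0, 0, 0; 0, 0, 1, 0, 0, 0; 1, 1, 0, 1, 0, 0; 1, 0, 1, 0, 1, 0;
        0, 1, 1, 0, 0, 1] := by
    ext i j
    fin_cases i <;> fin_cases j <;> simp [cmonomials, frame]
  rw [cconic, e, Matrix.det_of_isLowerTriangular]
  · simp [Fin.prod_univ_six]
  · intro i j h
    change i < j at h
    fin_cases i <;> fin_cases j <;> first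
      | exact absurd h (by decide)
      | simp

/-- The determinant of `symSquare` is read off from its effect on the sextuple `frame`, where `d₂ =
1`. -/
theorem det_symSquare_mul {R : Type*} [CommRing R] (A B : Matrix (Fin 3) (Fin 3) R) :
    (symSquare (A * B)).det = (symSquare A).det * (symSquare B).det := by
  have h := cconic_mul (frame R) (A * B)
  rw [← Matrix.mul_assoc, cconic_mul, cconic_mul, cconic_frame, one_mul, one_mul] at h
  exact h.symm

theorem det_symSquare_one {R : Type*} [CommRing R] :
    (symSquare (1 : Matrix (Fin 3) (Fin 3) R)).det = 1 := by
  have h := cconic_mul (frame R) 1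
  rwa [Matrix.mul_one, cconic_frame, one_mul, eq_comm] at h

/-- As a function of `c` the determinant is a homomorphism from the additive group. It is even,
since conjugation by the diagonal sign matrix `D` turns `c` into `-c`. Writing `c = c/2 + c/2` gives
the value at `c/2 - c/2 = 0`. -/
theorem det_symSquare_transvection {L : Type*} [Field L] (hL : (2 : L) ≠ 0) {i j : Fin 3}
    (h : i ≠ j) (c : L) : (symSquare (Matrix.transvection i j c)).det = 1 := by
  have hadd : ∀ a b : L, (symSquare (Matrix.transvection i j (a + b))).det =
      (symSquare (Matrix.transvection i j a)).det *
        (symSquare (Matrix.transvection i j b)).det := by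
    intro a b
    rw [← det_symSquare_mul, Matrix.transvection_mul_transvection_same _ _ h]
  set D : Matrix (Fin 3) (Fin 3) L := Matrix.diagonal fun k => if k = i then -1 else 1 with hD
  have hDD : D * D = 1 := by
    rw [hD, Matrix.diagonal_mul_diagonal, ← Matrix.diagonal_one]
    congr 1
    funext k
    split_ifs <;> simp
  have hneg : ∀ a : L, (symSquare (Matrix.transvection i j (-a))).det =
      (symSquare (Matrix.transvection i j a)).det := by
    intro a
    have e : Matrix.transvection i j (-a) = D * (Matrix.transvection i j a * D) := by
      rw [Matrix.transvection, Matrix.transvection, add_mul, one_mul, mul_add, hDD]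
      congr 1
      ext k l
      by_cases hk : i = k <;> by_cases hl : j = l <;>
        simp [hD, hk, hl]
      subst hk hl
      simp [h.symm]
    have hD1 : (symSquare D).det * (symSquare D).det = 1 := by
      rw [← det_symSquare_mul, hDD, det_symSquare_one]
    rw [e, det_symSquare_mul, det_symSquare_mul]
    linear_combination (symSquare (Matrix.transvection i j a)).det * hD1
  have h0 := hadd (c / 2) (-(c / 2))
  rw [hneg, ← hadd, add_neg_cancel, Matrix.transvection_zero, det_symSquare_one] at h0
  rw [h0]
  congr 3
  field_simp
  ring

/-- This amounts to `det (Sym² G) = (det G) ^ 4`, checked on diagonal matrices and transvections,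
which generate `GL₃`. -/
theorem cconic_mul_eq {L : Type*} [Field L] (hL : (2 : L) ≠ 0) (x : Matrix (Fin 6) (Fin 3) L)
    (G : Matrix (Fin 3) (Fin 3) L) (hG : G.det ≠ 0) : cconic (x * G) = cconic x * G.det ^ 4 := by
  refine Matrix.diagonal_transvection_induction_of_det_ne_zero
    (fun G => ∀ x : Matrix (Fin 6) (Fin 3) L, cconic (x * G) = cconic x * G.det ^ 4) G hG
    (fun D _ x => ?_) (fun t x => ?_) (fun A B _ _ ihA ihB x => ?_) x
  · have e : symSquare (Matrix.diagonal D) = Matrix.diagonal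
        ![D 0 ^ 2, D 1 ^ 2, D 2 ^ 2, D 0 * D 1, D 0 * D 2, D 1 * D 2] := by
      ext i j
      fin_cases i <;> fin_cases j <;> simp [symSquare]
    rw [cconic_mul, e, Matrix.det_diagonal, Matrix.det_diagonal, Fin.prod_univ_three,
      Fin.prod_univ_six]
    simp only [Matrix.cons_val]
    ring
  · rw [cconic_mul, Matrix.TransvectionStruct.det, Matrix.TransvectionStruct.toMatrix,
      det_symSquare_transvection hL t.hij, one_pow]
  · rw [← Matrix.mul_assoc, ihB, ihA, Matrix.det_mul, mul_pow, mul_assoc]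

theorem prod_perm_six {R : Type*} [CommRing R] (d : Fin 6 → R) (s : Equiv.Perm (Fin 6)) :
    ∏ i, d i = d (s 0) * d (s 1) * d (s 2) * d (s 3) * d (s 4) * d (s 5) := by
  rw [← Equiv.prod_comp s, Fin.prod_univ_six]

/-- All forty forms have the same weight. In a triple symbol each point occurs once in the minors
and with weight two in `d₂`; in a pair symbol it occurs in three of the six minors. The power of
`det G` is `1 + 1 + 4`, respectively `6`. -/
theorem cgamma_diagonal_mul_mul {L : Type*} [Field L] (hL : (2 : L) ≠ 0) (d : Fin 6 → L)
    (x : Matrix (Fin 6) (Fin 3) L) {G : Matrix (Fin 3) (Fin 3) L} (hG : G.det ≠ 0) (s : Symbols) :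
    cgamma (Matrix.diagonal d * (x * G)) s = (∏ i, d i) ^ 3 * G.det ^ 6 * cgamma x s := by
  rcases s with ⟨s, hs⟩ | ⟨s, hs⟩
  · have h := s.injective
    rw [cgamma, cgamma, tval, tval, rowMinor_diagonal_mul, rowMinor_diagonal_mul,
      cconic_diagonal_mul, rowMinor_mul, rowMinor_mul, cconic_mul_eq hL _ _ hG, prod_perm_six d s]
    · ring
    all_goals exact h.ne (by decide)
  · have h := s.injective
    rw [cgamma, cgamma, pval, pval]
    iterate 6 rw [rowMinor_diagonal_mul _ _ (h.ne (by decide)) (h.ne (by decide))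
      (h.ne (by decide))]
    simp only [rowMinor_mul]
    rw [prod_perm_six d s]
    ring

end Scaling

/-! ### Homogeneous ideals of sets of projective points -/

section HomogeneousIdeals

variable {K L ι : Type*} [Field K] [Field L] [Algebra K L]

theorem aeval_smul_of_isHomogeneous {f : MvPolynomial ι K} {n : ℕ} (hf : f.IsHomogeneous n) (c : L)
    (v : ι → L) : MvPolynomial.aeval (c • v) f = c ^ n * MvPolynomial.aeval v f := by
  rw [MvPolynomial.aeval_def, MvPolynomial.aeval_def, MvPolynomial.eval₂_eq,
    MvPolynomial.eval₂_eq, Finset.mul_sum]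
  refine Finset.sum_congr rfl fun d hd => ?_
  simp only [Pi.smul_apply, smul_eq_mul, mul_pow, Finset.prod_mul_distrib,
    Finset.prod_pow_eq_pow_sum]
  rw [show ∑ i ∈ d.support, d i = n from (hf.degree_eq_sum_deg_support hd).symm]
  ring

/-- For fixed `v` the value of `f` at `c • v` is a polynomial in `c` whose coefficients are the
values of the homogeneous components. It vanishes for infinitely many `c`. -/
theorem isHomogeneousIdeal_homogeneousIdeal [Infinite L] (Z : Set (ℙ L (ι → L))) :
    IsHomogeneousIdeal (homogeneousIdeal K Z) := by
  rintro f hf n v ⟨hv, hZ⟩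
  set p : Polynomial L := ∑ m ∈ Finset.range (f.totalDegree + 1),
    Polynomial.monomial m (MvPolynomial.aeval v (MvPolynomial.homogeneousComponent m f)) with hp
  have hp0 : p = 0 := by
    refine Polynomial.eq_zero_of_infinite_isRoot p (Set.Infinite.mono (s := {0}ᶜ) ?_
      (Set.finite_singleton 0).infinite_compl)
    intro c hc
    have hc0 : c ≠ 0 := hc
    have hcv : c • v ≠ 0 := smul_ne_zero hc0 hv
    have e : Projectivization.mk L (c • v) hcv = Projectivization.mk L v hv :=
      (Projectivization.mk_eq_mk_iff' L _ _ _ _).2 ⟨c, rfl⟩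
    have h := hf (c • v) ⟨hcv, by rwa [e]⟩
    rw [← MvPolynomial.sum_homogeneousComponent f, map_sum] at h
    change p.eval c = 0
    rw [← h, hp, Polynomial.eval_finsetSum]
    refine Finset.sum_congr rfl fun m _ => ?_
    rw [Polynomial.eval_monomial,
      aeval_smul_of_isHomogeneous (MvPolynomial.homogeneousComponent_isHomogeneous m f), mul_comm]
  by_cases hn : n ∈ Finset.range (f.totalDegree + 1)
  · have h := congrArg (fun q => q.coeff n) hp0
    simp only [hp, Polynomial.finsetSum_coeff, Polynomial.coeff_monomial,
      Polynomial.coeff_zero] at h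
    rwa [Finset.sum_ite_eq' , if_pos hn] at h
  · rw [MvPolynomial.homogeneousComponent_eq_zero _ _ (by simpa using hn), map_zero]

/-- The closure is tested at one representative of each point only; homogeneity transfers the
vanishing to the other representatives. -/
theorem homogeneousIdeal_zariskiClosure [Infinite L] (Z : Set (ℙ L (ι → L))) :
    homogeneousIdeal K (zariskiClosure K Z) = homogeneousIdeal K Z := by
  apply le_antisymm
  · rintro f hf v ⟨hv, hZ⟩
    refine hf v ⟨hv, fun g hg => hg _ ⟨Projectivization.rep_nonzero _, ?_⟩⟩
    rwa [Projectivization.mk_rep]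
  · rintro f hf v ⟨hv, hZ⟩
    obtain ⟨c, hc⟩ := Projectivization.exists_smul_eq_mk_rep L v hv
    have hv' : v = (c : L)⁻¹ • (Projectivization.mk L v hv).rep := by
      rw [← hc, Units.smul_def, smul_smul, inv_mul_cancel₀ c.ne_zero, one_smul]
    rw [hv', ← MvPolynomial.sum_homogeneousComponent f, map_sum]
    refine Finset.sum_eq_zero fun n _ => ?_
    rw [aeval_smul_of_isHomogeneous (MvPolynomial.homogeneousComponent_isHomogeneous n f),
      hZ _ (isHomogeneousIdeal_homogeneousIdeal Z f hf n), mul_zero]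

end HomogeneousIdeals

/-! ### General position and normal forms of sextuples -/

section GeneralPosition

variable {L : Type*} [Field L]

theorem linearIndependent_rows_iff (x : Matrix (Fin 6) (Fin 3) L) {i j k : Fin 6} (hij : i < j)
    (hjk : j < k) : LinearIndependent L ![x i, x j, x k] ↔ rowMinor x i j k ≠ 0 := by
  have e : ![x i, x j, x k] = (x.submatrix ![i, j, k] id).row := by
    funext l
    fin_cases l <;> rfl
  rw [e, Matrix.linearIndependent_rows_iff_isUnit, Matrix.isUnit_iff_isUnit_det,
    rowMinor_of_lt x hij hjk, isUnit_iff_ne_zero]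

theorem exists_conic_iff (x : Matrix (Fin 6) (Fin 3) L) :
    (∃ c : Fin 6 → L, c ≠ 0 ∧ ∀ i, ∑ j, c j * quadraticMonomials (x i) j = 0) ↔
      cconic x = 0 := by
  rw [cconic, ← Matrix.exists_mulVec_eq_zero_iff]
  refine exists_congr fun c => and_congr_right fun _ => ?_
  rw [funext_iff]
  refine forall_congr' fun i => ?_
  simp only [Matrix.mulVec, dotProduct, Matrix.of_apply, Pi.zero_apply, mul_comm (c _)]
  rfl

theorem generalPosition_iff (x : Matrix (Fin 6) (Fin 3) L) :
    GeneralPosition x ↔ (∀ i j k, i < j → j < k → rowMinor x i j k ≠ 0) ∧ cconic x ≠ 0 := by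
  rw [GeneralPosition, exists_conic_iff]
  refine and_congr_left fun _ => forall₃_congr fun i j k => forall₂_congr fun hij hjk => ?_
  exact linearIndependent_rows_iff x hij hjk

/-- These four invariants, the first four parameters, contain each of the twenty minors exactly
once, and `d₂`. -/
theorem generalPosition_of_gammaList_ne_zero {x : Matrix (Fin 6) (Fin 3) L}
    (h6 : gammaList x 6 ≠ 0) (h15 : gammaList x 15 ≠ 0) (h24 : gammaList x 24 ≠ 0)
    (h33 : gammaList x 33 ≠ 0) : GeneralPosition x := by
  rw [generalPosition_iff]
  change tval x 0 2 5 1 3 4 ≠ 0 at h6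
  change pval x 0 1 4 5 2 3 ≠ 0 at h15
  change pval x 0 3 1 5 2 4 ≠ 0 at h24
  change pval x 0 4 3 5 1 2 ≠ 0 at h33
  simp only [tval, pval, rowMinor_swap_left, rowMinor_swap_right, Fin.reduceLT, Fin.isValue,
    mul_ne_zero_iff] at h6 h15 h24 h33
  refine ⟨fun i j k hij hjk => ?_, h6.2⟩
  have key : ∀ i j k : Fin 6, i < j → j < k → (i, j, k) ∈ [(0, 2, 5), (1, 3, 4),
      (0, 4, 5), (1, 4, 5), (2, 3, 4), (2, 3, 5), (0, 1, 2), (0, 1, 3),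
      (0, 1, 5), (1, 3, 5), (1, 2, 4), (2, 4, 5), (0, 2, 3), (0, 3, 4),
      (0, 3, 5), (3, 4, 5), (1, 2, 3), (1, 2, 5), (0, 1, 4), (0, 2, 4)] := by
    decide
  have h := key i j k hij hjk
  simp only [List.mem_cons, List.not_mem_nil, or_false, Prod.mk.injEq] at h
  rcases h with ⟨rfl, rfl, rfl⟩ | ⟨rfl, rfl, rfl⟩ | ⟨rfl, rfl, rfl⟩ | ⟨rfl, rfl, rfl⟩ |
    ⟨rfl, rfl, rfl⟩ | ⟨rfl, rfl, rfl⟩ | ⟨rfl, rfl, rfl⟩ | ⟨rfl, rfl, rfl⟩ | ⟨rfl, rfl, rfl⟩ |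
    ⟨rfl, rfl, rfl⟩ | ⟨rfl, rfl, rfl⟩ | ⟨rfl, rfl, rfl⟩ | ⟨rfl, rfl, rfl⟩ | ⟨rfl, rfl, rfl⟩ |
    ⟨rfl, rfl, rfl⟩ | ⟨rfl, rfl, rfl⟩ | ⟨rfl, rfl, rfl⟩ | ⟨rfl, rfl, rfl⟩ | ⟨rfl, rfl, rfl⟩ |
    ⟨rfl, rfl, rfl⟩ <;> tauto

theorem gamma_ne_zero {x : Matrix (Fin 6) (Fin 3) L} (hx : GeneralPosition x) : gamma x ≠ 0 := by
  rw [generalPosition_iff] at hx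
  obtain ⟨s, hs⟩ := exists_symbol (R := L) 6
  intro h
  have h' := congrFun h s
  rw [← cgamma_eq_gamma, hs, Pi.zero_apply] at h'
  exact mul_ne_zero (mul_ne_zero (hx.1 0 2 5 (by decide) (by decide))
    (hx.1 1 3 4 (by decide) (by decide))) hx.2 h'

/-- The first three points become the coordinate points under `B⁻¹`, and a diagonal matrix moves the
fourth one to `(1,1,1)`; the factors `d` restore the representatives of the first three. -/
theorem exists_chart {x : Matrix (Fin 6) (Fin 3) L} (hx : GeneralPosition x) :
    ∃ (d w : Fin 6 → L) (G : Matrix (Fin 3) (Fin 3) L), G.det ≠ 0 ∧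
      x = Matrix.diagonal d * (chart w * G) := by
  rw [generalPosition_iff] at hx
  set B : Matrix (Fin 3) (Fin 3) L := x.submatrix ![0, 1, 2] id with hB
  have hdet : B.det ≠ 0 := by
    have h := hx.1 0 1 2 (by decide) (by decide)
    rwa [rowMinor_of_lt x (by decide) (by decide)] at h
  set y := x * B⁻¹ with hy
  have hyB : x = y * B := by
    rw [hy, Matrix.mul_assoc, Matrix.nonsing_inv_mul _ (isUnit_iff_ne_zero.2 hdet), Matrix.mul_one]
  have h1 : ∀ i j, y (![0, 1, 2] i) j = (1 : Matrix (Fin 3) (Fin 3) L) i j := by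
    intro i j
    rw [← Matrix.mul_nonsing_inv B (isUnit_iff_ne_zero.2 hdet)]
    rfl
  have hm : ∀ i j k, i < j → j < k → (y.submatrix ![i, j, k] id).det ≠ 0 := by
    intro i j k hij hjk
    have h := hx.1 i j k hij hjk
    rw [hyB, rowMinor_mul, rowMinor_of_lt y hij hjk] at h
    exact left_ne_zero_of_mul h
  have y00 := h1 0 0
  have y01 := h1 0 1
  have y02 := h1 0 2
  have y10 := h1 1 0
  have y11 := h1 1 1
  have y12 := h1 1 2
  have y20 := h1 2 0
  have y21 := h1 2 1
  have y22 := h1 2 2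
  simp at y00 y01 y02 y10 y11 y12 y20 y21 y22
  -- Up to sign these minors are the three coordinates of the fourth point, which are therefore
  -- nonzero.
  have e0 := hm 1 2 3 (by decide) (by decide)
  have e1 := hm 0 2 3 (by decide) (by decide)
  have e2 := hm 0 1 3 (by decide) (by decide)
  rw [det_submatrix_rows] at e0 e1 e2
  simp [y00, y01, y02, y10, y11, y12, y20, y21, y22] at e0 e1 e2
  refine ⟨![(y 3 0)⁻¹, (y 3 1)⁻¹, (y 3 2)⁻¹, 1, 1, 1],
    ![y 4 0 / y 3 0, y 4 1 / y 3 1, y 4 2 / y 3 2, y 5 0 / y 3 0, y 5 1 / y 3 1, y 5 2 / y 3 2],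
    Matrix.diagonal (y 3) * B, ?_, ?_⟩
  · rw [Matrix.det_mul, Matrix.det_diagonal, Fin.prod_univ_three]
    exact mul_ne_zero (mul_ne_zero (mul_ne_zero e0 e1) e2) hdet
  · rw [← Matrix.mul_assoc, ← Matrix.mul_assoc]
    nth_rewrite 1 [hyB]
    congr 1
    ext i j
    rw [Matrix.mul_diagonal, Matrix.diagonal_mul]
    fin_cases i <;> fin_cases j <;>
      simp [chart, y00, y01, y02, y10, y11, y12, y20, y21, y22, e0, e1, e2]

end GeneralPosition

/-! ### The gamma ideal as the kernel of the parametrisation -/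

section GammaIdeal

variable (K : Type*) [Field K]

/-- The generic values of the invariants, labelled by the symbols. -/
def genericSymbol (s : Symbols) : MvPolynomial (Fin 7) K :=
  MvPolynomial.X (Fin.last 6) * cgamma (chart fun i => MvPolynomial.X i.castSucc) s

/-- The parametrisation of the affine cone over the gamma variety. -/
def gammaHom : MvPolynomial Symbols K →ₐ[K] MvPolynomial (Fin 7) K :=
  MvPolynomial.aeval (genericSymbol K)

theorem range_genericSymbol : Set.range (genericSymbol K) = Set.range (genericGamma K) := by
  apply Set.Subset.antisymm
  · rintro _ ⟨s, rfl⟩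
    obtain ⟨n, hn⟩ := exists_gammaList (R := MvPolynomial (Fin 7) K) s
    exact ⟨n, by rw [genericSymbol, hn, genericGamma, scaledGamma]⟩
  · rintro _ ⟨n, rfl⟩
    obtain ⟨s, hs⟩ := exists_symbol (R := MvPolynomial (Fin 7) K) n
    exact ⟨s, by rw [genericSymbol, hs, genericGamma, scaledGamma]⟩

theorem map_cgamma {R S : Type*} [CommRing R] [CommRing S] (φ : R →+* S)
    (x : Matrix (Fin 6) (Fin 3) R) (s : Symbols) : φ (cgamma x s) = cgamma (x.map φ) s := by
  cases s with
  | inl s => exact map_tval φ x _ _ _ _ _ _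
  | inr s => exact map_pval φ x _ _ _ _ _ _

variable {K}

theorem aeval_genericSymbol {R : Type*} [CommRing R] [Algebra K R] (w : Fin 7 → R) (s : Symbols) :
    MvPolynomial.aeval w (genericSymbol K s) =
      w (Fin.last 6) * cgamma (chart fun i => w i.castSucc) s := by
  have h := map_cgamma (MvPolynomial.aeval (R := K) w).toRingHom
    (chart fun i => MvPolynomial.X i.castSucc) s
  rw [map_chart] at h
  simp only [AlgHom.toRingHom_eq_coe, RingHom.coe_coe, MvPolynomial.aeval_X] at h
  rw [genericSymbol, map_mul, MvPolynomial.aeval_X, h]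

theorem aeval_gammaHom {R : Type*} [CommRing R] [Algebra K R] (w : Fin 7 → R)
    (f : MvPolynomial Symbols K) : MvPolynomial.aeval w (gammaHom K f) =
      MvPolynomial.aeval (w (Fin.last 6) • cgamma (chart fun i => w i.castSucc)) f := by
  rw [gammaHom, ← AlgHom.comp_apply, MvPolynomial.comp_aeval]
  congr 2
  funext s
  rw [aeval_genericSymbol]
  rfl

/-- Where the first four parameters do not vanish, the sextuple is in general position and `f`
vanishes. So the product of `gammaHom K f` with these nonzero polynomials vanishes everywhere, hence
identically over the infinite field `L`. -/
theorem homogeneousIdeal_gammaImage_le {L : Type*} [Field L] [Infinite L] [Algebra K L]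
    (hL : (2 : L) ≠ 0) : homogeneousIdeal K (gammaImage L) ≤ RingHom.ker (gammaHom K) := by
  intro f hf
  have hprod : MvPolynomial.map (algebraMap K L) (gammaHom K f) *
      ∏ i : Fin 4, params (genericGamma L) i.castSucc = 0 := by
    apply MvPolynomial.funext
    intro w
    rw [map_zero, map_mul, map_prod]
    by_cases hw : ∀ i : Fin 4, MvPolynomial.eval w (params (genericGamma L) i.castSucc) ≠ 0
    · have hw' : ∀ i : Fin 4, params (scaledGamma (w (Fin.last 6)) fun i => w i.castSucc)
          i.castSucc ≠ 0 := by
        intro i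
        have h := hw i
        rwa [← MvPolynomial.coe_aeval_eq_eval, RingHom.coe_coe, aeval_params_genericGamma] at h
      have h6 := mul_ne_zero_iff.1
        (hw' 0 : w (Fin.last 6) * gammaList (chart fun i => w i.castSucc) 6 ≠ 0)
      have hx : GeneralPosition (chart fun i => w i.castSucc) :=
        generalPosition_of_gammaList_ne_zero h6.2
          (right_ne_zero_of_mul
            (hw' 1 : w (Fin.last 6) * gammaList (chart fun i => w i.castSucc) 15 ≠ 0))
          (right_ne_zero_of_mul
            (hw' 2 : w (Fin.last 6) * gammaList (chart fun i => w i.castSucc) 24 ≠ 0))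
          (right_ne_zero_of_mul
            (hw' 3 : w (Fin.last 6) * gammaList (chart fun i => w i.castSucc) 33 ≠ 0))
      have hne := gamma_ne_zero hx
      rw [← cgamma_eq_gamma] at hne
      have h0 := hf (w (Fin.last 6) • cgamma (chart fun i => w i.castSucc))
        ⟨smul_ne_zero h6.1 hne, _, hx, by rwa [← cgamma_eq_gamma],
          (Projectivization.mk_eq_mk_iff' L _ _ _ _).2
            ⟨w (Fin.last 6), by rw [cgamma_eq_gamma]⟩⟩
      rw [MvPolynomial.eval_map, ← MvPolynomial.aeval_def, aeval_gammaHom, h0, zero_mul]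
    · push Not at hw
      obtain ⟨i, hi⟩ := hw
      rw [Finset.prod_eq_zero (Finset.mem_univ i) hi, mul_zero]
  have hne : ∏ i : Fin 4, params (genericGamma L) i.castSucc ≠ 0 :=
    Finset.prod_ne_zero_iff.2 fun i _ => (algebraicIndependent_params hL).ne_zero _
  rw [RingHom.mem_ker]
  apply MvPolynomial.map_injective _ (algebraMap K L).injective
  rw [(mul_eq_zero.1 hprod).resolve_right hne, map_zero]

/-- Every vector representing a point of the image is a multiple of the invariants of a normalised
sextuple; the factor is absorbed by the seventh variable. -/
theorem le_homogeneousIdeal_gammaImage {L : Type*} [Field L] [Algebra K L]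
    (hL : (2 : L) ≠ 0) : RingHom.ker (gammaHom K) ≤ homogeneousIdeal K (gammaImage L) := by
  rintro f hf v ⟨hv, x, hx, hγ, hP⟩
  obtain ⟨a, ha⟩ := (Projectivization.mk_eq_mk_iff' L _ _ _ _).1 hP
  obtain ⟨d, w, G, hG, hxw⟩ := exists_chart hx
  have e : v = (Fin.snoc (α := fun _ => L) w (a * ((∏ i, d i) ^ 3 * G.det ^ 6)) (Fin.last 6)) •
      cgamma (chart fun i => Fin.snoc (α := fun _ => L) w
        (a * ((∏ i, d i) ^ 3 * G.det ^ 6)) i.castSucc) := by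
    simp only [Fin.snoc_last, Fin.snoc_castSucc]
    rw [← ha, ← cgamma_eq_gamma, mul_smul]
    congr 1
    funext s
    rw [hxw, cgamma_diagonal_mul_mul hL d _ hG]
    rfl
  rw [e, ← aeval_gammaHom, (RingHom.mem_ker).1 hf, map_zero]

theorem gammaIdeal_eq_ker (hK : (2 : K) ≠ 0) : gammaIdeal K = RingHom.ker (gammaHom K) := by
  have hL : (2 : AlgebraicClosure K) ≠ 0 := by
    have h := (map_ne_zero (algebraMap K (AlgebraicClosure K))).2 hK
    rwa [map_ofNat] at h
  rw [gammaIdeal, gammaVariety, homogeneousIdeal_zariskiClosure]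
  exact le_antisymm (homogeneousIdeal_gammaImage_le hL) (le_homogeneousIdeal_gammaImage hL)

theorem isHomogeneousIdeal_gammaIdeal : IsHomogeneousIdeal (gammaIdeal K) :=
  isHomogeneousIdeal_homogeneousIdeal _

theorem isPrime_gammaIdeal (hK : (2 : K) ≠ 0) : (gammaIdeal K).IsPrime := by
  rw [gammaIdeal_eq_ker hK]
  exact RingHom.ker_isPrime _

theorem map_gammaHom_homogeneousSubmodule (hK : (2 : K) ≠ 0) (n : ℕ) :
    (MvPolynomial.homogeneousSubmodule Symbols K n).map (gammaHom K).toLinearMap =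
      (gradedCoeff K n).map (combination (params (genericGamma K)) (coords (genericGamma K))) := by
  rw [gammaHom, map_aeval_homogeneousSubmodule, range_genericSymbol, genericGamma,
    span_scaledGamma hK, fullSpan_pow hK]

end GammaIdeal

/-! ### Hilbert function, Hilbert series and Hilbert polynomial -/

section HilbertFunction

variable {K : Type*} [Field K]

theorem finite_homogeneousSubmodule (m n : ℕ) :
    Module.Finite K (MvPolynomial.homogeneousSubmodule (Fin m) K n) :=
  Module.Finite.iff_fg.2 (MvPolynomial.homogeneousSubmodule_fg _ _ n)

theorem finrank_homogeneousSubmodule (m n : ℕ) :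
    Module.finrank K (MvPolynomial.homogeneousSubmodule (Fin (m + 1)) K n) =
      (m + n).choose m := by
  have e : MvPolynomial.homogeneousSubmodule (Fin (m + 1)) K n =
      MvPolynomial.restrictSupport K {d | d.degree = n} :=
    MvPolynomial.homogeneousSubmodule_eq_finsupp_supported _ _ n
  rw [e, Module.finrank_eq_nat_card_basis (MvPolynomial.basisRestrictSupport K _)]
  have h : {d : Fin (m + 1) →₀ ℕ | d.degree = n} =
      ((Finset.univ : Finset (Fin (m + 1))).finsuppAntidiag n : Set _) := by
    ext d
    simp [Finsupp.degree_eq_sum]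
  rw [h, Nat.card_coe_set_eq, Set.ncard_coe_finset, Finset.card_finsuppAntidiag_nat_eq_choose,
    Finset.card_univ, Fintype.card_fin, Nat.add_right_comm, Nat.add_sub_cancel,
    Nat.choose_symm_add]

theorem finrank_pi_univ {ι V : Type*} [Fintype ι] [AddCommGroup V] [Module K V]
    (p : ι → Submodule K V) (hp : ∀ i, Module.Finite K (p i)) :
    Module.finrank K (Submodule.pi Set.univ p : Submodule K (ι → V)) =
      ∑ i, Module.finrank K (p i) := by
  let e : (Submodule.pi Set.univ p : Submodule K (ι → V)) ≃ₗ[K] ∀ i, p i :=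
    { toFun := fun x i => ⟨x.1 i, x.2 i (Set.mem_univ i)⟩
      invFun := fun x => ⟨fun i => x i, fun i _ => (x i).2⟩
      left_inv := fun _ => rfl
      right_inv := fun _ => rfl
      map_add' := fun _ _ => rfl
      map_smul' := fun _ _ => rfl }
  rw [e.finrank_eq, Module.finrank_pi_fintype]

theorem finrank_gradedCoeff (n : ℕ) : Module.finrank K (gradedCoeff K n) =
    ∑ i, if quotDegree i ≤ n then (4 + (n - quotDegree i)).choose 4 else 0 := by
  rw [gradedCoeff, finrank_pi_univ]
  · refine Finset.sum_congr rfl fun i _ => ?_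
    by_cases h : quotDegree i ≤ n
    · rw [if_pos h, if_pos h, finrank_homogeneousSubmodule]
    · rw [if_neg h, if_neg h, finrank_bot]
  · intro i
    by_cases h : quotDegree i ≤ n
    · rw [if_pos h]
      exact finite_homogeneousSubmodule _ _
    · rw [if_neg h]
      exact Module.Finite.bot K _

theorem hilbertFunction_ker {σ R : Type*} [CommRing R] [Algebra K R]
    (ψ : MvPolynomial σ K →ₐ[K] R) (n : ℕ) : hilbertFunction (RingHom.ker ψ) n =
      Module.finrank K ((MvPolynomial.homogeneousSubmodule σ K n).map ψ.toLinearMap) := by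
  have h : (quotientComponent (RingHom.ker ψ) n).map (Ideal.kerLiftAlg ψ).toLinearMap =
      (MvPolynomial.homogeneousSubmodule σ K n).map ψ.toLinearMap := by
    rw [quotientComponent, ← Submodule.map_comp]
    rfl
  rw [hilbertFunction, ← h]
  exact (Submodule.equivMapOfInjective _ (Ideal.kerLiftAlg_injective ψ) _).finrank_eq

/-- The degree `n` part of `S/I` is isomorphic to that of the free module with generators in the
degrees `quotDegree`, over a polynomial ring in five variables. -/
theorem hilbertFunction_gammaIdeal (hK : (2 : K) ≠ 0) (n : ℕ) :
    hilbertFunction (gammaIdeal K) n =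
      ∑ i, if quotDegree i ≤ n then (4 + (n - quotDegree i)).choose 4 else 0 := by
  rw [gammaIdeal_eq_ker hK, hilbertFunction_ker, map_gammaHom_homogeneousSubmodule hK,
    ← finrank_gradedCoeff (K := K)]
  exact (Submodule.equivMapOfInjective _ (combination_injective hK) _).finrank_eq.symm

theorem sum_quotDegree {A : Type*} [CommRing A] (f : ℕ → A) :
    ∑ i, f (quotDegree i) = f 0 + 5 * f 1 + 15 * f 2 + 5 * f 3 + f 4 := by
  simp only [Fin.sum_univ_succ, Fin.sum_univ_zero, quotDegree, Matrix.cons_val_zero,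
    Matrix.cons_val_succ]
  ring

theorem hilbertSeries_gammaIdeal (hK : (2 : K) ≠ 0) : hilbertSeries (gammaIdeal K) =
    (1 + 5 * PowerSeries.X + 15 * PowerSeries.X ^ 2 + 5 * PowerSeries.X ^ 3 +
      PowerSeries.X ^ 4) * ((1 - PowerSeries.X) ^ 5)⁻¹ := by
  have hc : PowerSeries.constantCoeff ((1 - PowerSeries.X : PowerSeries ℚ) ^ 5) ≠ 0 := by simp
  have hC : (PowerSeries.mk fun n => ((4 + n).choose 4 : ℚ)) *
      (1 - PowerSeries.X) ^ 5 = 1 := PowerSeries.mk_add_choose_mul_one_sub_pow_eq_one ℚ 4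
  have h : hilbertSeries (gammaIdeal K) = ∑ i, PowerSeries.X ^ quotDegree i *
      PowerSeries.mk fun n => ((4 + n).choose 4 : ℚ) := by
    ext n
    rw [hilbertSeries, PowerSeries.coeff_mk, hilbertFunction_gammaIdeal hK, map_sum, Nat.cast_sum]
    refine Finset.sum_congr rfl fun i _ => ?_
    rw [PowerSeries.coeff_X_pow_mul', PowerSeries.coeff_mk]
    split_ifs <;> simp
  rw [PowerSeries.eq_mul_inv_iff_mul_eq hc, h, ← Finset.sum_mul, mul_assoc, hC, mul_one,
    sum_quotDegree]
  ring

theorem choose_four_cast (n : ℕ) :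
    ((n.choose 4 : ℕ) : ℚ) = (n : ℚ) * (n - 1) * (n - 2) * (n - 3) / 24 := by
  rw [Nat.cast_choose_eq_descPochhammer_div]
  simp [descPochhammer_succ_eval, Nat.factorial]

theorem hilbertFunction_gammaIdeal_eq (hK : (2 : K) ≠ 0) (n : ℕ) :
    (hilbertFunction (gammaIdeal K) n : ℚ) =
      9 / 8 * n ^ 4 + 9 / 4 * n ^ 3 + 27 / 8 * n ^ 2 + 9 / 4 * n + 1 := by
  -- For `n < d ≤ 4` the difference `n - d` is one of `-1, …, -4`, where the polynomial for the
  -- binomial coefficient vanishes. Hence there are no exceptional degrees.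
  have hterm : ∀ d ≤ 4, ((if d ≤ n then (4 + (n - d)).choose 4 else 0 : ℕ) : ℚ) =
      ((n : ℚ) - d + 4) * (n - d + 3) * (n - d + 2) * (n - d + 1) / 24 := by
    intro d hd
    split_ifs with h
    · rw [choose_four_cast]
      push_cast [h]
      ring
    · push Not at h
      have h0 : ((n : ℚ) - d + 4) * (n - d + 3) * (n - d + 2) * (n - d + 1) = 0 := by
        obtain ⟨k, hk, rfl⟩ : ∃ k < 4, d = n + k + 1 := ⟨d - n - 1, by omega, by omega⟩
        interval_cases k <;> push_cast <;> ring
      rw [h0]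
      simp
  rw [hilbertFunction_gammaIdeal hK, Nat.cast_sum, sum_quotDegree
    (fun d => ((if d ≤ n then (4 + (n - d)).choose 4 else 0 : ℕ) : ℚ)), hterm 0 (by norm_num),
    hterm 1 (by norm_num), hterm 2 (by norm_num), hterm 3 (by norm_num), hterm 4 (by norm_num)]
  push_cast
  ring

end HilbertFunction

/-! ### The parameters as a regular sequence -/

section LinearSystem

open MvPolynomial

variable {K : Type*} [Field K]

/-- The families of polynomials all of which lie in the ideal generated by some variables. -/
abbrev FamilyInSpan (s : Set (Fin 5)) (p : Fin 27 → MvPolynomial (Fin 5) K) : Prop :=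
  ∀ i, p i ∈ Ideal.span (X '' s : Set (MvPolynomial (Fin 5) K))

theorem exists_combination_eq (hK : (2 : K) ≠ 0) (f : MvPolynomial Symbols K) :
    ∃ p : Fin 27 → MvPolynomial (Fin 5) K,
      combination (params (genericGamma K)) (coords (genericGamma K)) p = gammaHom K f := by
  have h : ∀ n, ∃ p : Fin 27 → MvPolynomial (Fin 5) K,
      combination (params (genericGamma K)) (coords (genericGamma K)) p =
        gammaHom K (homogeneousComponent n f) := by
    intro n
    have h2 : gammaHom K (homogeneousComponent n f) ∈
        (homogeneousSubmodule Symbols K n).map (gammaHom K).toLinearMap :=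
      ⟨_, homogeneousComponent_isHomogeneous n f, rfl⟩
    rw [map_gammaHom_homogeneousSubmodule hK] at h2
    obtain ⟨p, -, hp⟩ := h2
    exact ⟨p, hp⟩
  choose p hp using h
  refine ⟨∑ n ∈ Finset.range (f.totalDegree + 1), p n, ?_⟩
  rw [map_sum]
  conv_rhs => rw [← sum_homogeneousComponent f, map_sum]
  exact Finset.sum_congr rfl fun n _ => hp n

theorem exists_gammaHom_eq_params (hK : (2 : K) ≠ 0) (j : Fin 5) :
    ∃ l : MvPolynomial Symbols K, l.IsHomogeneous 1 ∧
      gammaHom K l = params (genericGamma K) j := by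
  have h : params (genericGamma K) j ∈
      (homogeneousSubmodule Symbols K 1).map (gammaHom K).toLinearMap := by
    rw [gammaHom, map_aeval_homogeneousSubmodule, range_genericSymbol, pow_one, genericGamma,
      span_scaledGamma hK]
    exact Submodule.mem_sup_left (Submodule.subset_span (Set.mem_range_self j))
  obtain ⟨l, hl, h⟩ := h
  exact ⟨l, hl, h⟩

theorem exists_gammaHom_eq_quotBasis (hK : (2 : K) ≠ 0) (i : Fin 27) :
    ∃ f : MvPolynomial Symbols K, f.IsHomogeneous (quotDegree i) ∧
      gammaHom K f = quotBasis (coords (genericGamma K)) i := by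
  have h : quotBasis (coords (genericGamma K)) i ∈
      (homogeneousSubmodule Symbols K (quotDegree i)).map (gammaHom K).toLinearMap := by
    rw [map_gammaHom_homogeneousSubmodule hK]
    exact quotBasis_mem_map _ _ i
  obtain ⟨f, hf, h⟩ := h
  exact ⟨f, hf, h⟩

theorem combination_X_mul {R : Type*} [CommRing R] [Algebra K R] (l y : Fin 5 → R) (j : Fin 5)
    (p : Fin 27 → MvPolynomial (Fin 5) K) :
    combination l y (fun i => X j * p i) = l j * combination l y p := by
  simp only [combination_apply, map_mul, aeval_X, Finset.mul_sum, mul_assoc]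

theorem exists_gammaHom_eq_combination (hK : (2 : K) ≠ 0) (p : Fin 27 → MvPolynomial (Fin 5) K) :
    ∃ f, gammaHom K f =
      combination (params (genericGamma K)) (coords (genericGamma K)) p := by
  choose l hl hl' using exists_gammaHom_eq_params hK
  choose b hb hb' using exists_gammaHom_eq_quotBasis hK
  refine ⟨∑ i, aeval l (p i) * b i, ?_⟩
  rw [map_sum, combination_apply]
  refine Finset.sum_congr rfl fun i _ => ?_
  rw [map_mul, hb', ← AlgHom.comp_apply, comp_aeval]
  simp only [hl']

/-- In the free module over the parameters, the ideal `J` corresponds to coefficients in the ideal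
of the variables with index in `s`. Regularity of the next parameter becomes that of a variable
modulo other variables, and adjoining it enlarges `s`. -/
theorem isLinearSystem_of_mem_iff (hK : (2 : K) ≠ 0) {l : Fin 5 → MvPolynomial Symbols K}
    (hl : ∀ j, (l j).IsHomogeneous 1) (hl' : ∀ j, gammaHom K (l j) = params (genericGamma K) j)
    {ls : List (Fin 5)} (hls : ls.Nodup) {s : Set (Fin 5)} (hs : ∀ a ∈ ls, a ∉ s)
    (hs' : ∀ a, a ∈ s ∨ a ∈ ls) {J : Ideal (MvPolynomial Symbols K)}
    (hJ : ∀ f, f ∈ J ↔ ∃ p : Fin 27 → MvPolynomial (Fin 5) K, FamilyInSpan s p ∧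
      combination (params (genericGamma K)) (coords (genericGamma K)) p = gammaHom K f) :
    IsLinearSystem 4 (ls.map l) J := by
  induction ls generalizing s J with
  | nil =>
    have huniv : s = Set.univ := Set.eq_univ_of_forall fun a => by simpa using hs' a
    subst huniv
    refine ⟨fun n hn f hf => ?_, ?_⟩
    · have h : gammaHom K f ∈ (homogeneousSubmodule Symbols K n).map (gammaHom K).toLinearMap :=
        ⟨f, hf, rfl⟩
      rw [map_gammaHom_homogeneousSubmodule hK] at h
      obtain ⟨p, hp, h⟩ := h
      refine (hJ f).2 ⟨p, fun i => ?_, h⟩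
      have hi : quotDegree i < n := by
        refine lt_of_le_of_lt ?_ hn
        revert i
        decide
      rw [mem_ideal_span_X_image]
      intro m hm
      have hd := ((mem_gradedCoeff.1 hp) i).1 hi.le (mem_support_iff.1 hm)
      by_contra! h0
      have hm0 : m = 0 := by
        ext k
        exact h0 k (Set.mem_univ k)
      rw [hm0, map_zero] at hd
      omega
    -- The generator of degree four has coefficient `1`, which is not in the ideal of all variables,
    -- and coefficients are unique.
    · obtain ⟨f, hf, hf'⟩ := exists_gammaHom_eq_quotBasis hK 26
      refine ⟨f, hf, fun h => ?_⟩
      obtain ⟨p, hp, h⟩ := (hJ f).1 h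
      have h1 : combination (params (genericGamma K)) (coords (genericGamma K))
          (Pi.single (26 : Fin 27) (1 : MvPolynomial (Fin 5) K)) = gammaHom K f := by
        rw [hf', combination_apply, Finset.sum_eq_single 26]
        · rw [Pi.single_eq_same, map_one, one_mul]
        · intro j _ hj
          rw [Pi.single_eq_of_ne hj, map_zero, zero_mul]
        · simp
      have h2 := hp 26
      rw [combination_injective hK (h.trans h1.symm), Pi.single_eq_same,
        mem_ideal_span_X_image] at h2
      obtain ⟨i, -, hi⟩ := h2 0 (by simp)
      exact hi rfl
  | cons a ls ih =>
    rw [List.nodup_cons] at hls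
    refine ⟨hl a, fun f hf => ?_, ih hls.2 (s := insert a s) ?_ ?_ ?_⟩
    · obtain ⟨p, hp, h⟩ := (hJ _).1 hf
      obtain ⟨q, hq⟩ := exists_combination_eq hK f
      rw [map_mul, hl', ← hq, ← combination_X_mul] at h
      have e := combination_injective hK h
      refine (hJ f).2 ⟨q, fun i => ?_, hq⟩
      refine mem_span_X_image_of_X_mul_mem (hs a (by simp)) ?_
      have hpi := hp i
      rwa [e] at hpi
    · intro b hb
      rw [Set.mem_insert_iff, not_or]
      exact ⟨fun h => hls.1 (h ▸ hb), hs b (by simp [hb])⟩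
    · intro b
      have := hs' b
      rw [List.mem_cons] at this
      rw [Set.mem_insert_iff]
      tauto
    · intro f
      constructor
      · intro hf
        obtain ⟨g, hg, h, hh, rfl⟩ := Submodule.mem_sup.1 hf
        obtain ⟨c, rfl⟩ := Ideal.mem_span_singleton.1 hh
        obtain ⟨p, hp, hp'⟩ := (hJ g).1 hg
        obtain ⟨q, hq⟩ := exists_combination_eq hK c
        refine ⟨p + fun i => X a * q i, fun i => ?_, ?_⟩
        · rw [← span_X_image_sup]
          exact add_mem (Ideal.mem_sup_left (hp i))
            (Ideal.mem_sup_right (Ideal.mul_mem_right _ _ (Ideal.mem_span_singleton_self _)))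
        · rw [map_add, combination_X_mul, hp', hq, map_add, map_mul, hl']
      · rintro ⟨p, hp, hpf⟩
        have h : ∀ i, ∃ q ∈ Ideal.span (X '' s : Set (MvPolynomial (Fin 5) K)), ∃ r,
            q + X a * r = p i := by
          intro i
          have hi := hp i
          rw [← span_X_image_sup] at hi
          obtain ⟨q, hq, r, hr, e⟩ := Submodule.mem_sup.1 hi
          obtain ⟨r, rfl⟩ := Ideal.mem_span_singleton.1 hr
          exact ⟨q, hq, r, e⟩
        choose q hq r hr using h
        obtain ⟨c, hc⟩ := exists_gammaHom_eq_combination hK r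
        have hmem : f - l a * c ∈ J := by
          refine (hJ _).2 ⟨q, hq, ?_⟩
          rw [map_sub, map_mul, hl', hc, ← hpf, ← combination_X_mul, ← map_sub]
          congr 1
          funext i
          rw [Pi.sub_apply, ← hr i, add_sub_cancel_right]
        rw [← sub_add_cancel f (l a * c)]
        exact add_mem (Ideal.mem_sup_left hmem)
          (Ideal.mem_sup_right (Ideal.mul_mem_right _ _ (Ideal.mem_span_singleton_self _)))

theorem exists_isLinearSystem_gammaIdeal (hK : (2 : K) ≠ 0) :
    ∃ ls : List (MvPolynomial Symbols K), ls.length = 5 ∧ IsLinearSystem 4 ls (gammaIdeal K) := by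
  choose l hl hl' using exists_gammaHom_eq_params hK
  refine ⟨(List.finRange 5).map l, by simp, isLinearSystem_of_mem_iff hK hl hl'
    (List.nodup_finRange 5) (s := ∅) (by simp) (by simp) fun f => ?_⟩
  rw [gammaIdeal_eq_ker hK, RingHom.mem_ker]
  constructor
  · intro hf
    exact ⟨0, fun i => zero_mem _, by rw [map_zero, hf]⟩
  · rintro ⟨p, hp, h⟩
    have hp0 : p = 0 := funext fun i => by simpa using hp i
    rw [← h, hp0, map_zero]

/-- The invariants span the part of degree one of the free module, of dimension `5 + 5 = 10`; so
there are at least ten symbols. -/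
theorem five_lt_card_symbols (hK : (2 : K) ≠ 0) : 5 < Fintype.card Symbols := by
  have h := map_gammaHom_homogeneousSubmodule hK 1
  rw [gammaHom, map_aeval_homogeneousSubmodule, pow_one] at h
  have h2 := finrank_range_le_card (R := K) (genericSymbol K)
  have h3 := (Submodule.equivMapOfInjective _ (combination_injective hK)
    (gradedCoeff K 1)).finrank_eq
  rw [finrank_gradedCoeff, ← h] at h3
  rw [Set.finrank, ← h3] at h2
  exact lt_of_lt_of_le (by decide) h2

theorem hasRegularity_structureGrading_gammaIdeal (hK : (2 : K) ≠ 0) :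
    HasRegularity K Symbols (structureGrading (gammaIdeal K)) 4 := by
  obtain ⟨ls, h5, h⟩ := exists_isLinearSystem_gammaIdeal hK
  exact h.hasRegularity isHomogeneousIdeal_gammaIdeal (by omega)

theorem hasRegularity_idealGrading_gammaIdeal (hK : (2 : K) ≠ 0) :
    HasRegularity K Symbols (idealGrading (gammaIdeal K)) 5 := by
  obtain ⟨ls, h5, h⟩ := exists_isLinearSystem_gammaIdeal hK
  exact h.hasRegularity_ideal isHomogeneousIdeal_gammaIdeal (by omega)
    (by rw [h5]; exact five_lt_card_symbols hK)

end LinearSystem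

end CobleGamma

end

/-! ### The main theorem -/

theorem mainTheorem6 (K : Type*) [Field K] (hK : (2 : K) ≠ 0) :
    -- the Hilbert series
    CobleGamma.hilbertSeries (CobleGamma.gammaIdeal K) =
      (1 + 5 * PowerSeries.X + 15 * PowerSeries.X ^ 2 + 5 * PowerSeries.X ^ 3 +
        PowerSeries.X ^ 4) * ((1 - PowerSeries.X) ^ 5)⁻¹ ∧
    -- the Hilbert polynomial, which agrees with the Hilbert function in all degrees
    (∃ P : Polynomial ℚ,
      P = Polynomial.C (9 / 8) * Polynomial.X ^ 4 + Polynomial.C (9 / 4) * Polynomial.X ^ 3 +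
        Polynomial.C (27 / 8) * Polynomial.X ^ 2 + Polynomial.C (9 / 4) * Polynomial.X + 1 ∧
      CobleGamma.IsHilbertPolynomial (CobleGamma.gammaIdeal K) P ∧
      ∀ n : ℕ, (CobleGamma.hilbertFunction (CobleGamma.gammaIdeal K) n : ℚ) = P.eval (n : ℚ)) ∧
    -- a projective variety of degree 27
    ((CobleGamma.gammaIdeal K).IsPrime ∧ CobleGamma.HasDegree (CobleGamma.gammaIdeal K) 27) ∧
    -- the Castelnuovo-Mumford regularity of the structure sheaf and of the ideal sheaf
    CobleGamma.HasRegularity K CobleGamma.Symbols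
      (CobleGamma.structureGrading (CobleGamma.gammaIdeal K)) 4 ∧
    CobleGamma.HasRegularity K CobleGamma.Symbols
      (CobleGamma.idealGrading (CobleGamma.gammaIdeal K)) 5 := by
  have hH : ∀ n : ℕ, (CobleGamma.hilbertFunction (CobleGamma.gammaIdeal K) n : ℚ) =
      (Polynomial.C (9 / 8) * Polynomial.X ^ 4 + Polynomial.C (9 / 4) * Polynomial.X ^ 3 +
        Polynomial.C (27 / 8) * Polynomial.X ^ 2 + Polynomial.C (9 / 4) * Polynomial.X +
          1 : Polynomial ℚ).eval (n : ℚ) := by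
    intro n
    rw [CobleGamma.hilbertFunction_gammaIdeal_eq hK]
    simp
  refine ⟨CobleGamma.hilbertSeries_gammaIdeal hK, ⟨_, rfl, Filter.Eventually.of_forall hH, hH⟩,
    ⟨CobleGamma.isPrime_gammaIdeal hK, _, Filter.Eventually.of_forall hH, ?_⟩,
    CobleGamma.hasRegularity_structureGrading_gammaIdeal hK,
    CobleGamma.hasRegularity_idealGrading_gammaIdeal hK⟩
  have hd : (Polynomial.C (9 / 8) * Polynomial.X ^ 4 + Polynomial.C (9 / 4) * Polynomial.X ^ 3 +
      Polynomial.C (27 / 8) * Polynomial.X ^ 2 + Polynomial.C (9 / 4) * Polynomial.X +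
        1 : Polynomial ℚ).natDegree = 4 := by
    compute_degree!
  -- The degree is `4! * (9 / 8) = 27`.
  rw [Polynomial.leadingCoeff, hd]
  simp [Polynomial.coeff_one, Nat.factorial]
  norm_num
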